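/- **Setting.** Let $R$ be a commutative ring in which $2$ is invertible, and let $V=R[X]/(X^2-1)$ with basis $1,X$, comultiplication $\Delta(1)=1\otimes X+X\otimes 1$, $\Delta(X)=X\otimes X+1\otimes 1$, the bar operation $\overline{1}=1$, $\overline{X}=-X$, and the idempotents $\mathbf r=\frac{1+X}{2}$ (red), $\mathbf g=\frac{1-X}{2}$ (green). Let $K$ be an oriented virtual link diagram (a signed oriented Gauss code, possibly with components without classical crossings), with $n_-$ negative classical crossings. *Cut loci.* Draw each classical crossing with both strands pointing up. Its source-sink orientation orients the two ends of the strand running from bottom left to top right towards the crossing and the two other ends away from it. A semi-arc carries a cut locus (a cross cut of the associated abstract link diagram, ALD) if the source-sink orientations at its two ends disagree. *Complex.* A state is a choice of $A$- or $B$-smoothing at each classical crossing (the $A$-smoothing of a positive and the $B$-smoothing of a negative crossing being the oriented ones); it has homological degree (number of $B$-smoothings) $-\,n_-$. For each state fix, arbitrarily, a marked point off the cut loci on each cycle that meets a crossing, and a total order of all cycles. The Khovanov–Lee complex is, in degree $i$, the direct sum of the modules $V^{\otimes\{\text{cycles of }s\}}$ over the states $s$ of degree $i$. Its differential is the sum over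 the $A$-smoothed crossings of the maps that change this smoothing to $B$: the multiplication $m$ of $V$ if two cycles merge, $\Delta$ if a cycle splits, and $0$ if one cycle is turned into one cycle, and the identity on the tensor factors of the other cycles. Elements are transported along cycles between the marked points and the crossing (for the other cycles, between the marked points in the two states), the bar operation being applied once for each cut locus passed; and the map is multiplied by the signs of the permutations that compare, before and after, the chosen order of the cycles with the local order, in which the cycle through the left (respectively top) arc of the smoothed crossing comes first, the one through the right (respectively bottom) arc second if it is different, and then the remaining cycles, in an order that is the same before and after. *Alternately coloured smoothings.* An alternately coloured smoothing of $K$ on its ALD with cross cuts is a state of $K$ with a red/green colouring of its cycles such that the colour changes exactly at the cross cuts and the two arcs at each smoothed crossing have different colours. Its generator is the object of the Karoubi envelope given by $V^{\otimes\{\text{cycles}\}}$ and the projection that multiplies the factor of each cycle by $\mathbf r$ or $\mathbf g$ according to its colour at the marked point (or its constant colour if it meets no crossing). **Theorem.** For every such $K$, every choice of marked points and orders, and every $R$, the differential above squares to zero, and in the Karoubi envelope (of the category of $R$-modules) the Khovanov–Lee complex of $K$ is homotopy equivalent to the complex with vanishing differentials whose object in degree $i$ is the direct sum of the generators of the alternately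 coloured smoothings of $K$ whose state has degree $i$. Each of these generators is isomorphic to $R$. -/

import Mathlib

open CategoryTheory

namespace VirtualKhovanovLee

/-! ### Virtual link diagrams -/

/-- An oriented virtual link diagram with set `ι` of classical crossings, given by its signed
oriented Gauss code.  Every classical crossing `c` is passed twice, once on the over-strand
`(c, true)` and once on the under-strand `(c, false)`; `next` sends each passage to the one that
follows it along the oriented link.  `circles` is the number of components that meet no classical
crossing.  Virtual crossings are not recorded by a Gauss code. -/
structure VirtualLinkDiagram (ι : Type) where
  /-- whether the crossing is positive -/
  positive : ι → Bool
  /-- the passage that follows a given passage along the oriented link -/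
  next : Equiv.Perm (ι × Bool)
  /-- the number of components without classical crossings -/
  circles : ℕ

/-- The ends of the semi-arcs: `(c, o, e)` is the end at the crossing `c` lying on the over-strand
(`o = true`) or the under-strand (`o = false`), which leaves the crossing (`e = true`) or enters it
(`e = false`) in the orientation of the link.

Draw a crossing with both strands pointing upwards.  The over-strand of a positive crossing and the
under-strand of a negative one run from bottom left to top right, so an end `(c, o, e)` is at the
bottom left or the top right if `o = positive c`, and at the bottom right or the top left
otherwise. -/
abbrev HalfEdge (ι : Type) : Type := ι × Bool × Bool

/-- The state (choice of smoothings): `false` is the `A`-smoothing, `true` the `B`-smoothing. -/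
abbrev State (ι : Type) : Type := ι → Bool

variable {ι : Type}

namespace VirtualLinkDiagram

variable (D : VirtualLinkDiagram ι)

/-- The other end of the semi-arc. -/
def glue : HalfEdge ι → HalfEdge ι
  | (c, o, true) => ((D.next (c, o)).1, (D.next (c, o)).2, false)
  | (c, o, false) => ((D.next.symm (c, o)).1, (D.next.symm (c, o)).2, true)

/-- The other end of the arc of the smoothed crossing.  The `A`-smoothing of a positive crossing and
the `B`-smoothing of a negative one are the oriented smoothings, which join an entering end to the
leaving end of the other strand; the remaining smoothings join the two entering ends and the two
leaving ends. -/
def smooth (s : State ι) : HalfEdge ι → HalfEdge ι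
  | (c, o, e) => if s c ≠ D.positive c then (c, !o, !e) else (c, !o, e)

/-- The canonical source-sink orientation of the four ends at a crossing: the ends of the strand
that runs from bottom left to top right point towards the crossing, the two other ends point away
from it. -/
def Inward : HalfEdge ι → Prop
  | (c, o, _) => o = D.positive c

/-- A semi-arc carries a cut locus if the source-sink orientations at its two ends disagree. -/
def IsCut (h : HalfEdge ι) : Prop := D.Inward h ↔ D.Inward (D.glue h)

/-- The top left end at a crossing.  It lies on the first arc of either smoothing (the left arc of
the oriented one, the top arc of the other one). -/
def site₁ (c : ι) : HalfEdge ι := (c, !D.positive c, true)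

/-- The bottom right end at a crossing.  It lies on the second arc of either smoothing (the right
arc of the oriented one, the bottom arc of the other one). -/
def site₂ (c : ι) : HalfEdge ι := (c, !D.positive c, false)

theorem glue_glue (h : HalfEdge ι) : D.glue (D.glue h) = h := by
  rcases h with ⟨c, o, _ | _⟩ <;> simp [glue]

theorem smooth_smooth (s : State ι) (h : HalfEdge ι) : D.smooth s (D.smooth s h) = h := by
  rcases h with ⟨c, o, e⟩
  by_cases hc : s c = D.positive c <;> simp [smooth, hc]

theorem isCut_glue (h : HalfEdge ι) : D.IsCut (D.glue h) ↔ D.IsCut h := by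
  simp only [IsCut, glue_glue]; exact Iff.comm

/-! ### Cycles of a state -/

open Classical in
/-- `D.CutPath s h k n`: in the state `s` there is a path along the cycles from `h` to `k` that
crosses `n` cut loci. -/
inductive CutPath (s : State ι) (h : HalfEdge ι) : HalfEdge ι → ℕ → Prop
  | refl : CutPath s h h 0
  | smooth {k : HalfEdge ι} {n : ℕ} : CutPath s h k n → CutPath s h (D.smooth s k) n
  | glue {k : HalfEdge ι} {n : ℕ} : CutPath s h k n →
      CutPath s h (D.glue k) (n + if D.IsCut k then 1 else 0)

variable {D} in
theorem CutPath.trans {s : State ι} {h k l : HalfEdge ι} {m n : ℕ} (p : D.CutPath s h k m)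
    (q : D.CutPath s k l n) : D.CutPath s h l (m + n) := by
  induction q with
  | refl => exact p
  | smooth _ ih => exact ih.smooth
  | glue _ ih => rw [← add_assoc]; exact ih.glue

open Classical in
variable {D} in
theorem CutPath.symm {s : State ι} {h k : HalfEdge ι} {n : ℕ} (p : D.CutPath s h k n) :
    D.CutPath s k h n := by
  induction p with
  | refl => exact .refl
  | @smooth k n _ ih =>
    have := (CutPath.refl (D := D) (s := s) (h := D.smooth s k)).smooth
    rw [D.smooth_smooth] at this
    simpa using this.trans ih
  | @glue k n _ ih =>
    have := (CutPath.refl (D := D) (s := s) (h := D.glue k)).glue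
    rw [D.glue_glue, zero_add] at this
    have e : (if D.IsCut (D.glue k) then 1 else 0) = if D.IsCut k then 1 else 0 :=
      if_congr (D.isCut_glue k) rfl rfl
    rw [e] at this
    rw [add_comm]
    exact this.trans ih

/-- Two ends are equivalent if they lie on the same cycle of the state `s`. -/
def cycleSetoid (s : State ι) : Setoid (HalfEdge ι) where
  r h k := ∃ n, D.CutPath s h k n
  iseqv := ⟨fun _ => ⟨0, .refl⟩, fun ⟨n, p⟩ => ⟨n, p.symm⟩,
    fun ⟨m, p⟩ ⟨n, q⟩ => ⟨m + n, p.trans q⟩⟩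

/-- The cycles of the state `s` that pass through some crossing. -/
abbrev CrossingCycle (s : State ι) : Type := Quotient (D.cycleSetoid s)

/-- All cycles of the state `s`. -/
abbrev Cycle (s : State ι) : Type := D.CrossingCycle s ⊕ Fin D.circles

/-- The cycle of the state `s` through `h`. -/
def cycleOf (s : State ι) (h : HalfEdge ι) : D.CrossingCycle s := Quotient.mk (D.cycleSetoid s) h

noncomputable instance (s : State ι) : DecidableEq (D.Cycle s) := Classical.decEq _

noncomputable instance [Finite ι] (s : State ι) : Fintype (D.Cycle s) :=
  haveI : Finite (D.CrossingCycle s) := Quotient.finite _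
  Fintype.ofFinite _

/-- The parity condition for the bar operation: transporting an algebra element from `h` to `k`
along a cycle crosses an odd number of cut loci. -/
def Barred (s : State ι) (h k : HalfEdge ι) : Prop := ∃ n, Odd n ∧ D.CutPath s h k n

/-- The (arbitrary) global choices for the states of a diagram: a marked point on each cycle, at
which the global orientation agrees with the local one, and an order of the cycles. -/
structure GlobalData [Finite ι] where
  /-- the marked point of a cycle -/
  star : ∀ s : State ι, D.CrossingCycle s → HalfEdge ι
  cycleOf_star : ∀ (s : State ι) (z : D.CrossingCycle s), D.cycleOf s (star s z) = z
  /-- the global order of the cycles -/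
  order : ∀ s : State ι, D.Cycle s ≃ Fin (Fintype.card (D.Cycle s))

end VirtualLinkDiagram

/-! ### The Frobenius algebra `R[X]/(X² - 1)` -/

/-- The basis `1, X` of the algebra. -/
inductive Label : Type
  | one
  | X
  deriving DecidableEq

instance : Fintype Label := ⟨{.one, .X}, fun a => by cases a <;> decide⟩

/-- The product of two basis elements: `X * X = 1`. -/
def Label.mul : Label → Label → Label
  | .one, b => b
  | .X, .one => .X
  | .X, .X => .one

section Algebra

variable (R : Type*) [CommRing R]

/-- The coefficient of `c` in the product `m (a ⊗ b)`. -/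
def mulCoeff (a b c : Label) : R := if a.mul b = c then 1 else 0

/-- The coefficient of `b ⊗ c` in `Δ a`: `Δ 1 = 1 ⊗ X + X ⊗ 1` and `Δ X = X ⊗ X + 1 ⊗ 1`. -/
def comulCoeff : Label → Label → Label → R
  | .one, .one, .X => 1
  | .one, .X, .one => 1
  | .X, .X, .X => 1
  | .X, .one, .one => 1
  | _, _, _ => 0

open Classical in
/-- The sign by which the bar operation (`1 ↦ 1`, `X ↦ -X`), applied if `P` holds, multiplies a
basis element. -/
noncomputable def barSign (P : Prop) (a : Label) : R := if P ∧ a = .X then -1 else 1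

end Algebra

/-- The two colours. -/
inductive Colour : Type
  | red
  | green
  deriving DecidableEq

instance : Fintype Colour := ⟨{.red, .green}, fun a => by cases a <;> decide⟩

/-- The coefficients of the idempotents `red = (1 + X) / 2` and `green = (1 - X) / 2`. -/
def Colour.coeff (R : Type*) [CommRing R] [Invertible (2 : R)] : Colour → Label → R
  | .red, _ => ⅟2
  | .green, .one => ⅟2
  | .green, .X => -⅟2

/-- The coefficient of `b` in the product of the idempotent `k` with the basis element `a`. -/
def Colour.projCoeff (R : Type*) [CommRing R] [Invertible (2 : R)] (k : Colour) (b a : Label) : R :=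
  ∑ l, k.coeff R l * mulCoeff R l a b

/-! ### The differential -/

namespace VirtualLinkDiagram

variable (D : VirtualLinkDiagram ι)

/-- The cycle `z` of the state `s` does not meet the crossing `c`, and `z'` is the same cycle in the
state `s'`. -/
def Unaffected (c : ι) (s s' : State ι) : D.Cycle s × D.Cycle s' → Prop
  | (.inl z, .inl z') => z ≠ D.cycleOf s (D.site₁ c) ∧ z ≠ D.cycleOf s (D.site₂ c) ∧
      ∃ h, D.cycleOf s h = z ∧ D.cycleOf s' h = z'
  | (.inr i, .inr j) => i = j
  | _ => False

/-- An enhanced state: a state whose cycles are labelled by `1` or `X`.  These form a basis of the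
direct sum over the states `s` of the tensor powers `V^{⊗ cycles of s}`. -/
abbrev EnhancedState : Type := (s : State ι) × (D.Cycle s → Label)

variable {D} [Finite ι] (G : D.GlobalData)

namespace GlobalData

/-- The sign of the permutation that moves the cycle `z` to the first place. -/
noncomputable def sign₁ (s : State ι) (z : D.CrossingCycle s) : ℤ := (-1) ^ (G.order s (.inl z) : ℕ)

/-- The sign of the permutation that moves `z` to the first and `w` to the second place. -/
noncomputable def sign₂ (s : State ι) (z w : D.CrossingCycle s) : ℤ :=
  if G.order s (.inl z) < G.order s (.inl w) then
    (-1) ^ ((G.order s (.inl z) : ℕ) + (G.order s (.inl w) : ℕ) + 1)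
  else (-1) ^ ((G.order s (.inl z) : ℕ) + (G.order s (.inl w) : ℕ))

open Classical in
/-- The sign of the permutation that compares the global orders of `s` and `s'` on the cycles that
do not meet the crossing `c`. -/
noncomputable def restSign (c : ι) (s s' : State ι) : ℤ :=
  (-1) ^ (Finset.univ.filter fun p : (D.Cycle s × D.Cycle s') × (D.Cycle s × D.Cycle s') =>
    D.Unaffected c s s' p.1 ∧ D.Unaffected c s s' p.2 ∧
      G.order s p.1.1 < G.order s p.2.1 ∧ G.order s' p.2.2 < G.order s' p.1.2).card

/-- Whether transport between the marked points of the same cycle in two states crosses an odd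
number of cut loci. -/
def StarBarred (s s' : State ι) : D.Cycle s × D.Cycle s' → Prop
  | (.inl z, .inl z') => D.Barred s (G.star s z) (G.star s' z')
  | _ => False

variable (R : Type*) [CommRing R]

open Classical in
/-- The identity on the tensor factors of the cycles that do not meet `c`: their labels stay the
same, up to transport between the marked points. -/
noncomputable def restCoeff (c : ι) (s s' : State ι) (l : D.Cycle s → Label)
    (l' : D.Cycle s' → Label) : R :=
  ∏ p : D.Cycle s × D.Cycle s', if D.Unaffected c s s' p then
    (if l p.1 = l' p.2 then barSign R (G.StarBarred s s' p) (l p.1) else 0) else 1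

/-- The effect of the bar operation on the label of the cycle through `h` when it is transported
between `h` and the marked point of the cycle. -/
noncomputable def siteSign (s : State ι) (l : D.Cycle s → Label) (h : HalfEdge ι) : R :=
  barSign R (D.Barred s h (G.star s (D.cycleOf s h))) (l (.inl (D.cycleOf s h)))

open Classical in
/-- The local map at the crossing `c` from the state `s` (with `A`-smoothing at `c`) to the state
`s'` (with `B`-smoothing at `c`): multiplication if two cycles merge, comultiplication if a cycle
splits, each pre- and post-composed with the bar operations and the signs of the permutations
between local and global orders, and the zero map `η` if one cycle is turned into one cycle. -/
noncomputable def localCoeff (c : ι) (s s' : State ι) (l : D.Cycle s → Label)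
    (l' : D.Cycle s' → Label) : R :=
  if D.cycleOf s (D.site₁ c) ≠ D.cycleOf s (D.site₂ c) ∧
      D.cycleOf s' (D.site₁ c) = D.cycleOf s' (D.site₂ c) then
    ((G.sign₂ s (D.cycleOf s (D.site₁ c)) (D.cycleOf s (D.site₂ c)) *
        G.sign₁ s' (D.cycleOf s' (D.site₁ c)) : ℤ) : R) *
      (G.siteSign R s l (D.site₁ c) * G.siteSign R s l (D.site₂ c) *
        mulCoeff R (l (.inl (D.cycleOf s (D.site₁ c)))) (l (.inl (D.cycleOf s (D.site₂ c))))
          (l' (.inl (D.cycleOf s' (D.site₁ c)))) *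
        G.siteSign R s' l' (D.site₁ c))
  else if D.cycleOf s (D.site₁ c) = D.cycleOf s (D.site₂ c) ∧
      D.cycleOf s' (D.site₁ c) ≠ D.cycleOf s' (D.site₂ c) then
    ((G.sign₁ s (D.cycleOf s (D.site₁ c)) *
        G.sign₂ s' (D.cycleOf s' (D.site₁ c)) (D.cycleOf s' (D.site₂ c)) : ℤ) : R) *
      (G.siteSign R s l (D.site₁ c) *
        comulCoeff R (l (.inl (D.cycleOf s (D.site₁ c))))
          (l' (.inl (D.cycleOf s' (D.site₁ c)))) (l' (.inl (D.cycleOf s' (D.site₂ c)))) *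
        (G.siteSign R s' l' (D.site₁ c) * G.siteSign R s' l' (D.site₂ c)))
  else 0

end GlobalData

end VirtualLinkDiagram

namespace VirtualLinkDiagram.GlobalData

variable [Fintype ι] [DecidableEq ι] {D : VirtualLinkDiagram ι} (G : D.GlobalData)

section Differential

variable (R : Type*) [CommRing R]

/-- The matrix of the differential: the entry at `(y, x)` is the coefficient of the enhanced state
`y` in `∂ x`, the sum over the sites `c` with an `A`-smoothing in `x` of the partial differentials
that resmooth `c`. -/
noncomputable def differential : Matrix D.EnhancedState D.EnhancedState R := fun y x =>
  ∑ c, if x.1 c = false ∧ y.1 = Function.update x.1 c true then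
    (G.restSign c x.1 y.1 : R) * G.restCoeff R c x.1 y.1 x.2 y.2 *
      G.localCoeff R c x.1 y.1 x.2 y.2 else 0

end Differential

end VirtualLinkDiagram.GlobalData

namespace VirtualLinkDiagram

variable [Fintype ι]

/-- The homological degree of a state: the number of `B`-smoothings minus the number of negative
crossings. -/
def height (D : VirtualLinkDiagram ι) (s : State ι) : ℤ :=
  ((Finset.univ.filter fun c => s c = true).card : ℤ) -
    ((Finset.univ.filter fun c => D.positive c = false).card : ℤ)

theorem height_update [DecidableEq ι] (D : VirtualLinkDiagram ι) (s : State ι) (c : ι)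
    (hc : s c = false) : D.height (Function.update s c true) = D.height s + 1 := by
  have h : (Finset.univ.filter fun i => Function.update s c true i = true) =
      insert c (Finset.univ.filter fun i => s i = true) := by
    ext i
    by_cases hi : i = c
    · subst hi; simp
    · simp [hi]
  rw [height, height, h, Finset.card_insert_of_notMem (by simp [hc])]
  push_cast
  ring

end VirtualLinkDiagram

namespace VirtualLinkDiagram.GlobalData

universe u

variable [Fintype ι] [DecidableEq ι] {D : VirtualLinkDiagram ι} (G : D.GlobalData)
  (R : Type u) [CommRing R]

theorem differential_eq_zero (x y : D.EnhancedState) (h : D.height x.1 + 1 ≠ D.height y.1) :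
    G.differential R y x = 0 := by
  unfold differential
  refine Finset.sum_eq_zero fun c _ => if_neg ?_
  rintro ⟨hc, hy⟩
  exact h (by rw [hy, D.height_update _ _ hc])

/-! ### The Khovanov-Lee complex -/

/-- The Khovanov-Lee complex: in degree `i` the free module on the enhanced states of height `i`. -/
noncomputable def complex (hd : G.differential R * G.differential R = 0) :
    CochainComplex (ModuleCat.{u} R) ℤ where
  X i := ModuleCat.of R ({x : D.EnhancedState // D.height x.1 = i} → R)
  d i j := ModuleCat.ofHom (Matrix.toLin' ((G.differential R).submatrix
    (Subtype.val : {x : D.EnhancedState // D.height x.1 = j} → _)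
    (Subtype.val : {x : D.EnhancedState // D.height x.1 = i} → _)))
  shape i j hij := by
    have : (G.differential R).submatrix
        (Subtype.val : {x : D.EnhancedState // D.height x.1 = j} → _)
        (Subtype.val : {x : D.EnhancedState // D.height x.1 = i} → _) = 0 := by
      ext y x
      exact G.differential_eq_zero R _ _ (by rw [x.2, y.2]; exact hij)
    rw [this, map_zero, ModuleCat.ofHom_zero]
  d_comp_d' i j k hij hjk := by
    rw [← ModuleCat.ofHom_comp, ← Matrix.toLin'_mul]
    have : (G.differential R).submatrix
        (Subtype.val : {x : D.EnhancedState // D.height x.1 = k} → _)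
        (Subtype.val : {x : D.EnhancedState // D.height x.1 = j} → _) *
        (G.differential R).submatrix
        (Subtype.val : {x : D.EnhancedState // D.height x.1 = j} → _)
        (Subtype.val : {x : D.EnhancedState // D.height x.1 = i} → _) = 0 := by
      ext z x
      have h := congrFun (congrFun hd z.1) x.1
      rw [Matrix.mul_apply] at h ⊢
      simp only [Matrix.submatrix_apply, Matrix.zero_apply] at h ⊢
      rw [← h]
      rw [← Finset.sum_subtype (Finset.univ.filter fun y : D.EnhancedState => D.height y.1 = j)
        (by simp) fun y => G.differential R z.1 y * G.differential R y x.1]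
      refine Finset.sum_subset (Finset.subset_univ _) fun y _ hy => ?_
      rw [G.differential_eq_zero R x.1 y, mul_zero]
      rw [x.2]
      intro e
      apply hy
      simp only [Finset.mem_filter, Finset.mem_univ, true_and]
      rw [← e]; exact hij
    rw [this, map_zero, ModuleCat.ofHom_zero]

end VirtualLinkDiagram.GlobalData

/-! ### Alternately coloured smoothings -/

/-- An alternately coloured smoothing on the abstract link diagram with cross cuts: a state together
with a red/green colouring of its strands that is constant along the strands of the smoothing,
changes exactly where a strand passes a cross cut (that is, a cut locus), and gives different colours
to the two arcs at each smoothed crossing. -/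
@[ext]
structure AlternatelyColouredSmoothing (D : VirtualLinkDiagram ι) where
  /-- the underlying state -/
  state : State ι
  /-- the colours of the strands at crossings -/
  colour : HalfEdge ι → Colour
  /-- the colours of the components without crossings -/
  circleColour : Fin D.circles → Colour
  colour_smooth : ∀ h, colour (D.smooth state h) = colour h
  colour_glue : ∀ h, colour (D.glue h) = colour h ↔ ¬ D.IsCut h
  alternate : ∀ c, colour (D.site₁ c) ≠ colour (D.site₂ c)

instance [Finite ι] (D : VirtualLinkDiagram ι) : Finite (AlternatelyColouredSmoothing D) :=
  Finite.of_injective (fun a => (a.state, a.colour, a.circleColour)) fun a b h => by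
    simp only [Prod.mk.injEq] at h
    exact AlternatelyColouredSmoothing.ext h.1 h.2.1 h.2.2

section Generators

universe u

variable (R : Type u) [CommRing R] [Invertible (2 : R)]

theorem Colour.sum_projCoeff (k : Colour) (c a : Label) :
    ∑ b, k.projCoeff R c b * k.projCoeff R b a = k.projCoeff R c a := by
  have h2 : (⅟2 : R) + ⅟2 = 1 := by rw [← two_mul, mul_invOf_self]
  have h4 : (⅟2 : R) * ⅟2 + ⅟2 * ⅟2 = ⅟2 := by rw [← mul_add, h2, mul_one]
  have hu : (Finset.univ : Finset Label) = {Label.one, Label.X} := by decide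
  cases k <;> cases c <;> cases a <;>
    simp [Colour.projCoeff, Colour.coeff, mulCoeff, Label.mul, hu, h4] <;>
    linear_combination -h4

/-- The projection of `V^{⊗ Z}` onto the summand with colours `k`: multiplication by the tensor
product of the idempotents `red` and `green` given by `k`, in the basis of labellings. -/
def colourProjection {Z : Type} [Fintype Z] (k : Z → Colour) : Matrix (Z → Label) (Z → Label) R :=
  fun b a => ∏ z, (k z).projCoeff R (b z) (a z)

theorem colourProjection_mul_self {Z : Type} [Fintype Z] [DecidableEq Z] (k : Z → Colour) :
    colourProjection R k * colourProjection R k = colourProjection R k := by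
  ext c a
  simp only [Matrix.mul_apply, colourProjection, ← Finset.prod_mul_distrib]
  rw [← Fintype.piFinset_univ, ← Finset.prod_univ_sum (fun _ => Finset.univ)
    (fun z b => (k z).projCoeff R (c z) b * (k z).projCoeff R b (a z))]
  exact Finset.prod_congr rfl fun z _ => Colour.sum_projCoeff R _ _ _

variable [Fintype ι] {D : VirtualLinkDiagram ι} (G : D.GlobalData)

/-- The colours of the cycles of an alternately coloured smoothing, read at the marked points. -/
def AlternatelyColouredSmoothing.cycleColour (a : AlternatelyColouredSmoothing D) :
    D.Cycle a.state → Colour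
  | .inl z => a.colour (G.star a.state z)
  | .inr i => a.circleColour i

/-- The generator of an alternately coloured smoothing: the object of the Karoubi envelope given by
the tensor power of its underlying state and the projection of its colouring. -/
noncomputable def AlternatelyColouredSmoothing.generator (a : AlternatelyColouredSmoothing D) :
    Idempotents.Karoubi (ModuleCat.{u} R) where
  X := ModuleCat.of R ((D.Cycle a.state → Label) → R)
  p := ModuleCat.ofHom (Matrix.toLin' (colourProjection R (a.cycleColour G)))
  idem := by rw [← ModuleCat.ofHom_comp, ← Matrix.toLin'_mul, colourProjection_mul_self]

/-- The complex with one generator for each alternately coloured smoothing, placed in the degree of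
its state, and with vanishing differentials. -/
noncomputable def generatorComplex :
    CochainComplex (Idempotents.Karoubi (ModuleCat.{u} R)) ℤ where
  X i := Limits.biproduct
    (fun a : {a : AlternatelyColouredSmoothing D // D.height a.state = i} => a.1.generator R G)
  d _ _ := 0

end Generators

end VirtualKhovanovLee

/-! Since 2 is invertible, the idempotents red and green diagonalise the Frobenius algebra: the
product of two different colours is zero, Δ(red) = 2 red ⊗ red, Δ(green) = -2 green ⊗ green, and the
bar operation exchanges the colours. Transport past a cut locus therefore changes the colour, and a
tensor product of idempotents over the cycles of a state amounts to a colouring of the ends of the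
semi-arcs that is constant along the strands and changes exactly at the cut loci (`Compatible`).
These coloured states form a basis (`colourCoord_colourVector`, `sum_colourCoord_smul`). On it all
bar operations disappear: the differential keeps the colouring ψ of the ends and resmooths exactly
the A-smoothed crossings whose two arcs have one colour (`differential_mulVec_colourVector`). The
complex is thus a sum over ψ of cubes spanned by the crossings at which ψ has a single colour.

Two facts about these cubes suffice. First, every edge weight is a unit. The source-sink orientation
on red strands and its reverse on green ones orient all cycles of a coloured state, which become the
cycles of a permutation `flow`. Resmoothing a crossing of a single colour multiplies `flow` by a
transposition (`flow_resmooth`), so it merges two cycles or splits one and never turns one cycle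
into one. The weight is then ±1 for a merge and ±2 for a split.

Second, every face anticommutes (`face_anticomm`). The order of the cycles of a state defines an
alternating volume form on lists of points, and merging the cycles of x and y contracts it by x - y,
up to the sign in the differential (`form_merge`); a split is a merge read backwards. If one corner
of the face has the most cycles, the claim is the anticommutation of two contractions. Otherwise two
opposite corners have the most cycles, and in each of them both crossings join the same two cycles.
Comparing how the sites are paired there gives a sign that is compensated by the signs of the
factors 2 and -2 (`exists_pairing_signs`).

Anticommuting faces give d² = 0. A cube with at least one direction contracts along a crossing
chosen in terms of ψ alone, by inverting the weights of the edges in that direction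
(`differential_contraction_add`). The remaining cubes are single vertices: the alternately coloured
smoothings. Each spans a free module of rank one, which is the image of its colour projection. -/

namespace Equiv.Perm

/-! ### Products of a permutation with transpositions. -/

variable {α : Type*}

/-- An equivalence relation that contains all pairs `(a, f a)` contains `f.SameCycle`. -/
theorem SameCycle.of_equivalence {f : Equiv.Perm α} {r : α → α → Prop} (hr : Equivalence r)
    (hf : ∀ a, r a (f a)) {a b : α} (h : f.SameCycle a b) : r a b := by
  obtain ⟨n, rfl⟩ := h
  induction n with
  | zero => exact hr.refl a
  | succ n ih =>
    rw [add_comm, zpow_add, zpow_one]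
    exact hr.trans ih (hf _)
  | pred n ih =>
    rw [sub_eq_add_neg, add_comm, zpow_add, zpow_neg_one]
    refine hr.trans ih (hr.symm ?_)
    simpa using hf (f⁻¹ ((f ^ (-(n : ℤ))) a))

variable [DecidableEq α] {f : Equiv.Perm α} {x y u v : α}

theorem swap_mul_apply_pow (i : ℕ) :
    (swap x y * f) ((f ^ i) x) = swap x y ((f ^ (i + 1)) x) := by
  rw [pow_succ']; rfl

theorem swap_mul_pow_apply (n : ℕ) (h : ∀ i, 0 < i → i < n → (f ^ i) x ≠ x ∧ (f ^ i) x ≠ y)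
    {i : ℕ} (hi : i < n) : ((swap x y * f) ^ i) x = (f ^ i) x := by
  induction i with
  | zero => rfl
  | succ i ih =>
    rw [pow_succ', mul_apply, ih (by omega), swap_mul_apply_pow]
    exact swap_apply_of_ne_of_ne (h _ (by omega) hi).1 (h _ (by omega) hi).2

variable [Finite α]

/-- Let n be the first time at which the orbit of x reaches y. The new permutation follows this
orbit up to time n - 1 and then returns to x, so its orbit of x closes without meeting y. -/
theorem not_sameCycle_swap_mul (hne : x ≠ y) (h : f.SameCycle x y) :
    ¬ (swap x y * f).SameCycle x y := by
  classical
  have hex := h.exists_nat_pow_eq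
  obtain ⟨hn, hmin⟩ := Nat.find_spec hex, fun m => Nat.find_min (m := m) hex
  set n := Nat.find hex
  have h0 : 0 < n := by
    rcases Nat.eq_zero_or_pos n with h | h
    · rw [h] at hn; exact absurd hn hne
    · exact h
  have key : ∀ i, 0 < i → i < n → (f ^ i) x ≠ x ∧ (f ^ i) x ≠ y := by
    intro i hi hin
    refine ⟨fun hx => hmin (n - i) (by omega) ?_, hmin i hin⟩
    rw [← hn]
    conv_rhs => rw [show n = (n - i) + i by omega, pow_add, mul_apply, hx]
  have hper : ((swap x y * f) ^ n) x = x := by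
    obtain ⟨m, hm⟩ : ∃ m, n = m + 1 := ⟨n - 1, by omega⟩
    rw [hm, pow_succ', mul_apply, swap_mul_pow_apply n key (by omega), swap_mul_apply_pow, ← hm,
      hn, swap_apply_right]
  intro hc
  obtain ⟨m, hm⟩ := hc.exists_nat_pow_eq
  have hk : ∀ k : ℕ, (((swap x y * f) ^ n) ^ k) x = x := by
    intro k
    induction k with
    | zero => rfl
    | succ k ih => rw [pow_succ, mul_apply, hper, ih]
  rw [← Nat.mod_add_div m n, pow_add, mul_apply, pow_mul, hk,
    swap_mul_pow_apply n key (Nat.mod_lt _ h0)] at hm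
  exact hmin _ (Nat.mod_lt _ h0) hm

/-- The new permutation follows the old orbit of x, which avoids y, until its first return to x; the
transposition sends that step to y instead. -/
theorem sameCycle_swap_mul (h : ¬ f.SameCycle x y) : (swap x y * f).SameCycle x y := by
  classical
  have hex : ∃ n, 0 < n ∧ (f ^ n) x = x := ⟨orderOf f, orderOf_pos f, by rw [pow_orderOf_eq_one]; rfl⟩
  obtain ⟨⟨h0, hn⟩, hmin⟩ := Nat.find_spec hex, fun m => Nat.find_min (m := m) hex
  set n := Nat.find hex
  have key : ∀ i, 0 < i → i < n → (f ^ i) x ≠ x ∧ (f ^ i) x ≠ y := fun i hi hin =>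
    ⟨fun hx => hmin i hin ⟨hi, hx⟩, fun hx => h ⟨i, by simpa using hx⟩⟩
  refine ⟨(n : ℤ), ?_⟩
  obtain ⟨m, hm⟩ : ∃ m, n = m + 1 := ⟨n - 1, by omega⟩
  rw [zpow_natCast, hm, pow_succ', mul_apply, swap_mul_pow_apply n key (by omega),
    swap_mul_apply_pow, ← hm, hn, swap_apply_left]

/-- Multiplication by a transposition of elements of different cycles merges these cycles. -/
theorem sameCycle_swap_mul_iff (h : ¬ f.SameCycle x y) {a b : α} :
    (swap x y * f).SameCycle a b ↔
      f.SameCycle a b ∨ (f.SameCycle a x ∧ f.SameCycle y b) ∨ (f.SameCycle a y ∧ f.SameCycle x b) := by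
  have hxy := sameCycle_swap_mul h
  have hsub : ∀ {a b}, f.SameCycle a b → (swap x y * f).SameCycle a b := by
    intro a b
    refine SameCycle.of_equivalence (SameCycle.equivalence _) fun a => ?_
    have h1 : (swap x y * f).SameCycle a (swap x y (f a)) := ⟨1, by simp⟩
    refine h1.trans ?_
    rcases eq_or_ne (f a) x with hx | hx
    · rw [hx, swap_apply_left]; exact hxy.symm
    rcases eq_or_ne (f a) y with hy | hy
    · rw [hy, swap_apply_right]; exact hxy
    rw [swap_apply_of_ne_of_ne hx hy]
  constructor
  · refine SameCycle.of_equivalence (r := fun a b => f.SameCycle a b ∨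
      (f.SameCycle a x ∧ f.SameCycle y b) ∨ (f.SameCycle a y ∧ f.SameCycle x b)) ?_ fun a => ?_
    · refine ⟨fun a => .inl .rfl, ?_, ?_⟩
      · rintro a b (h | h | h)
        · exact .inl h.symm
        · exact .inr (.inr ⟨h.2.symm, h.1.symm⟩)
        · exact .inr (.inl ⟨h.2.symm, h.1.symm⟩)
      · rintro a b c (h1 | h1 | h1) (h2 | h2 | h2)
        · exact .inl (h1.trans h2)
        · exact .inr (.inl ⟨h1.trans h2.1, h2.2⟩)
        · exact .inr (.inr ⟨h1.trans h2.1, h2.2⟩)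
        · exact .inr (.inl ⟨h1.1, h1.2.trans h2⟩)
        · exact absurd (h1.2.trans h2.1).symm h
        · exact .inl (h1.1.trans h2.2)
        · exact .inr (.inr ⟨h1.1, h1.2.trans h2⟩)
        · exact .inl (h1.1.trans h2.2)
        · exact absurd (h1.2.trans h2.1) h
    · have h1 : f.SameCycle a (f a) := ⟨1, by simp⟩
      rw [mul_apply]
      rcases eq_or_ne (f a) x with hx | hx
      · rw [hx, swap_apply_left]; rw [hx] at h1; exact .inr (.inl ⟨h1, .rfl⟩)
      rcases eq_or_ne (f a) y with hy | hy
      · rw [hy, swap_apply_right]; rw [hy] at h1; exact .inr (.inr ⟨h1, .rfl⟩)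
      rw [swap_apply_of_ne_of_ne hx hy]; exact .inl h1
  · rintro (h | h | h)
    · exact hsub h
    · exact (hsub h.1).trans (hxy.trans (hsub h.2))
    · exact (hsub h.1).trans (hxy.symm.trans (hsub h.2))

/-- If `x, u` and `y, v` lie on two different cycles, then exchanging both `x` with `y` and `u` with
`v` separates `x` from `u`. -/
theorem not_sameCycle_swap_mul_swap_mul (hxu : f.SameCycle x u) (hyv : f.SameCycle y v)
    (hxy : ¬ f.SameCycle x y) (h1 : x ≠ u) (h2 : y ≠ v) :
    ¬ (swap x y * (swap u v * f)).SameCycle x u := by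
  have exy : x ≠ y := fun h => hxy (h ▸ .rfl)
  have exv : x ≠ v := fun h => hxy (h ▸ hyv.symm)
  have eyu : y ≠ u := fun h => hxy (h ▸ hxu)
  have euv : u ≠ v := fun h => hxy (hxu.trans (h ▸ hyv.symm))
  -- Both cycles are first cut in two: for `k` the elements x, u, y, v lie on four different cycles,
  -- which makes the effect of any further transpositions transparent.
  set g := swap y v * f with hg
  set k := swap x u * g with hk
  have hfg : f = swap y v * g := by rw [hg, swap_mul_self_mul]
  have hgk : g = swap x u * k := by rw [hk, swap_mul_self_mul]
  have gyv : ¬ g.SameCycle y v := not_sameCycle_swap_mul h2 hyv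
  have hf : ∀ {a b}, f.SameCycle a b ↔ g.SameCycle a b ∨
      (g.SameCycle a y ∧ g.SameCycle v b) ∨ (g.SameCycle a v ∧ g.SameCycle y b) := by
    intro a b; rw [hfg]; exact sameCycle_swap_mul_iff gyv
  have gsub : ∀ {a b}, g.SameCycle a b → f.SameCycle a b := fun h => hf.2 (.inl h)
  have gxu : g.SameCycle x u := by
    rcases hf.1 hxu with h | h | h
    · exact h
    · exact absurd (gsub h.1) hxy
    · exact absurd ((gsub h.1).trans hyv.symm) hxy
  have kxu : ¬ k.SameCycle x u := not_sameCycle_swap_mul h1 gxu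
  have ksub : ∀ {a b}, k.SameCycle a b → g.SameCycle a b := by
    intro a b h; rw [hgk]; exact (sameCycle_swap_mul_iff kxu).2 (.inl h)
  have kxy : ¬ k.SameCycle x y := fun h => hxy (gsub (ksub h))
  have kxv : ¬ k.SameCycle x v := fun h => hxy ((gsub (ksub h)).trans hyv.symm)
  have kyu : ¬ k.SameCycle y u := fun h => hxy (hxu.trans (gsub (ksub h)).symm)
  have kuv : ¬ k.SameCycle u v := fun h => hxy (hxu.trans ((gsub (ksub h)).trans hyv.symm))
  have kyv : ¬ k.SameCycle y v := fun h => gyv (ksub h)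
  -- In terms of `k` the double exchange just joins x to v and y to u, so x and u stay apart.
  have heq : swap x y * (swap u v * f) = swap x v * (swap y u * k) := by
    have h4 : swap x y * (swap u v * (swap y v * (swap x u))) = swap x v * swap y u := by
      ext a
      simp only [mul_apply, swap_apply_def]
      clear * - exy exv eyu euv h1 h2
      grind
    rw [hfg, hgk, ← mul_assoc (swap x v), ← h4]; simp only [mul_assoc]
  rw [heq]
  have hl : ∀ {a b}, (swap y u * k).SameCycle a b ↔ k.SameCycle a b ∨
      (k.SameCycle a y ∧ k.SameCycle u b) ∨ (k.SameCycle a u ∧ k.SameCycle y b) :=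
    sameCycle_swap_mul_iff kyu
  have lxv : ¬ (swap y u * k).SameCycle x v := by
    rw [hl]; rintro (h | h | h)
    exacts [kxv h, kxy h.1, kxu h.1]
  rw [sameCycle_swap_mul_iff lxv]
  rintro (h | h | h)
  · rcases hl.1 h with h | h | h
    exacts [kxu h, kxy h.1, kxu h.1]
  · rcases hl.1 h.2 with h | h | h
    exacts [kuv h.symm, kyv h.1.symm, kuv h.1.symm]
  · exact lxv h.1

end Equiv.Perm

/-! ### Colourings that change at the cut loci. -/

namespace VirtualKhovanovLee

variable {ι : Type}

/-- The other colour. -/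
def Colour.other : Colour → Colour
  | .red => .green
  | .green => .red

theorem Colour.ne_iff {a b : Colour} : a ≠ b ↔ a = b.other := by
  cases a <;> cases b <;> decide

namespace VirtualLinkDiagram

variable (D : VirtualLinkDiagram ι)

theorem cycleOf_eq_iff {s : State ι} {h k : HalfEdge ι} :
    D.cycleOf s h = D.cycleOf s k ↔ ∃ n, D.CutPath s h k n :=
  Quotient.eq (r := D.cycleSetoid s)

theorem cycleOf_smooth (s : State ι) (h : HalfEdge ι) :
    D.cycleOf s (D.smooth s h) = D.cycleOf s h :=
  (D.cycleOf_eq_iff.2 ⟨_, CutPath.refl.smooth⟩).symm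

theorem cycleOf_glue (s : State ι) (h : HalfEdge ι) :
    D.cycleOf s (D.glue h) = D.cycleOf s h :=
  (D.cycleOf_eq_iff.2 ⟨_, CutPath.refl.glue⟩).symm

theorem smooth_ne (s : State ι) (h : HalfEdge ι) : D.smooth s h ≠ h := by
  rcases h with ⟨c, o, e⟩
  simp only [smooth]
  split <;> simp

theorem glue_ne (h : HalfEdge ι) : D.glue h ≠ h := by
  rcases h with ⟨c, o, _ | _⟩ <;> simp [glue]

/-- Each arc of either smoothing joins ends of different strands, and the source-sink orientation is
constant on a strand. It therefore orients the arcs of both smoothings. -/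
theorem inward_smooth (s : State ι) (h : HalfEdge ι) :
    D.Inward (D.smooth s h) ↔ ¬ D.Inward h := by
  rcases h with ⟨c, o, e⟩
  simp only [smooth]
  split <;> simp only [Inward] <;> cases o <;> cases D.positive c <;> simp

/-- A colouring of the ends that is constant along the strands of the state `s` except that it
changes at each cut locus. -/
structure Compatible (s : State ι) (χ : HalfEdge ι → Colour) : Prop where
  smooth : ∀ h, χ (D.smooth s h) = χ h
  glue : ∀ h, χ (D.glue h) = χ h ↔ ¬ D.IsCut h

variable {D}

namespace Compatible

variable {s s' : State ι} {χ χ' : HalfEdge ι → Colour}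

theorem even_iff (hχ : D.Compatible s χ) {h k : HalfEdge ι} {n : ℕ} (p : D.CutPath s h k n) :
    χ k = χ h ↔ Even n := by
  induction p with
  | refl => simp
  | smooth _ ih => rw [hχ.smooth, ih]
  | @glue k n _ ih =>
    by_cases hk : D.IsCut k
    · have h1 : χ (D.glue k) ≠ χ k := fun h => (hχ.glue k).1 h hk
      rw [if_pos hk, Nat.even_add_one, ← ih]
      rw [Colour.ne_iff] at h1
      rw [h1]
      cases χ k <;> cases χ h <;> simp [Colour.other]
    · rw [if_neg hk, add_zero, (hχ.glue k).2 hk, ih]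

/-- A compatible colouring makes the parity of the number of cut loci independent of the path. The
bar condition, which only asks for some odd path, thus becomes a comparison of two colours. -/
theorem barred_iff (hχ : D.Compatible s χ) {h k : HalfEdge ι}
    (hk : D.cycleOf s h = D.cycleOf s k) : D.Barred s h k ↔ χ h ≠ χ k := by
  constructor
  · rintro ⟨n, hn, p⟩ e
    exact (Nat.not_even_iff_odd.2 hn) ((hχ.even_iff p).1 e.symm)
  · intro e
    obtain ⟨n, p⟩ := D.cycleOf_eq_iff.1 hk
    exact ⟨n, Nat.not_even_iff_odd.1 fun h => e ((hχ.even_iff p).2 h).symm, p⟩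

theorem eq_iff (hχ : D.Compatible s χ) (hχ' : D.Compatible s χ') {h k : HalfEdge ι}
    (hk : D.cycleOf s h = D.cycleOf s k) : χ h = χ k ↔ χ' h = χ' k := by
  obtain ⟨n, p⟩ := D.cycleOf_eq_iff.1 hk
  rw [eq_comm, hχ.even_iff p, eq_comm, hχ'.even_iff p]

theorem apply_eq (hχ : D.Compatible s χ) (hχ' : D.Compatible s χ') {h k : HalfEdge ι}
    (hk : D.cycleOf s h = D.cycleOf s k) (e : χ h = χ' h) : χ k = χ' k := by
  have := hχ.eq_iff hχ' hk
  revert this e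
  cases χ h <;> cases χ' h <;> cases χ k <;> cases χ' k <;> simp

end Compatible

/-! ### Existence of compatible colourings -/

variable (D) in
/-- Two steps along the cycles of a state. -/
def doubleStep (s : State ι) : Equiv.Perm (HalfEdge ι) :=
  (Function.Involutive.toPerm _ (D.smooth_smooth s)) * (Function.Involutive.toPerm _ D.glue_glue)

/-- The dihedral relation: an involution conjugates its product with another involution to the
inverse. -/
theorem smooth_doubleStep_zpow (s : State ι) (n : ℤ) (h : HalfEdge ι) :
    D.smooth s ((D.doubleStep s ^ n) h) = (D.doubleStep s ^ (-n)) (D.smooth s h) := by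
  set a : Equiv.Perm (HalfEdge ι) := Function.Involutive.toPerm _ (D.smooth_smooth s)
  set b : Equiv.Perm (HalfEdge ι) := Function.Involutive.toPerm _ D.glue_glue
  have ha : a * a = 1 := by ext1 h; exact D.smooth_smooth s h
  have hb : b * b = 1 := by ext1 h; exact D.glue_glue h
  have ha' : a⁻¹ = a := inv_eq_of_mul_eq_one_left ha
  have hb' : b⁻¹ = b := inv_eq_of_mul_eq_one_left hb
  have hc : a * (a * b) * a⁻¹ = (a * b)⁻¹ := by
    rw [mul_inv_rev, ha', hb', ← mul_assoc, ha, one_mul]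
  have hz : a * (a * b) ^ n = (a * b) ^ (-n) * a := by
    rw [zpow_neg, ← inv_zpow, ← hc, conj_zpow, mul_assoc, inv_mul_cancel, mul_one]
  exact congrArg (fun f : Equiv.Perm _ => f h) hz

/-- By the dihedral relation, an orbit containing both ends of an arc has a midpoint fixed by
`smooth` or by `glue`, according to the parity of the distance; neither has fixed points. Hence the
ends on a cycle form two orbits, one for each side of the arcs, which amounts to an orientation of
the cycle. -/
theorem not_sameCycle_smooth (s : State ι) (h : HalfEdge ι) :
    ¬ (D.doubleStep s).SameCycle h (D.smooth s h) := by
  rintro ⟨n, hn⟩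
  rcases Int.even_or_odd' n with ⟨m, rfl | rfl⟩
  · apply D.smooth_ne s ((D.doubleStep s ^ m) h)
    rw [smooth_doubleStep_zpow, ← hn, ← Equiv.Perm.mul_apply, ← zpow_add]
    congr 2; ring
  · apply D.glue_ne ((D.doubleStep s ^ m) h)
    have h1 : D.smooth s ((D.doubleStep s ^ m) h) = D.doubleStep s ((D.doubleStep s ^ m) h) := by
      rw [smooth_doubleStep_zpow, ← hn, ← Equiv.Perm.mul_apply, ← zpow_add,
        ← Equiv.Perm.mul_apply, ← zpow_one_add]
      congr 2; ring
    have h2 := congrArg (D.smooth s) h1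
    rw [D.smooth_smooth] at h2
    rw [eq_comm]
    refine h2.trans ?_
    exact D.smooth_smooth s _

theorem sameCycle_or_of_cutPath {s : State ι} {h k : HalfEdge ι} {n : ℕ} (p : D.CutPath s h k n) :
    (D.doubleStep s).SameCycle h k ∨ (D.doubleStep s).SameCycle h (D.smooth s k) := by
  induction p with
  | refl => exact .inl .rfl
  | smooth _ ih => rw [D.smooth_smooth]; exact ih.symm
  | @glue k n _ ih =>
    rcases ih with ih | ih
    · right
      refine ih.trans ⟨1, rfl⟩
    · left
      refine ih.trans (Equiv.Perm.SameCycle.symm ⟨1, ?_⟩)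
      rw [zpow_one]
      change D.smooth s (D.glue (D.glue k)) = _
      rw [D.glue_glue]

variable (D) in
-- Orient each cycle by one of its two orbits under `doubleStep`, and colour an end red where this
-- agrees with the source-sink orientation. Along an arc both orientations switch between inward and
-- outward; along a semi-arc the source-sink one fails to do so exactly at a cut locus. In
-- particular every cycle carries an even number of cut loci.
theorem exists_compatible (s : State ι) : ∃ χ, D.Compatible s χ := by
  classical
  let rep : HalfEdge ι → HalfEdge ι := fun h => (D.cycleOf s h).out
  have hrep : ∀ h, D.cycleOf s (rep h) = D.cycleOf s h := fun h => Quotient.out_eq _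
  let dir : HalfEdge ι → Prop := fun h => (D.doubleStep s).SameCycle (rep h) h
  have hsm : ∀ h, dir (D.smooth s h) ↔ ¬ dir h := by
    intro h
    have e : rep (D.smooth s h) = rep h := by simp only [rep, D.cycleOf_smooth]
    simp only [dir, e]
    constructor
    · intro h1 h2
      exact not_sameCycle_smooth s h (h2.symm.trans h1)
    · intro h1
      obtain ⟨n, p⟩ := D.cycleOf_eq_iff.1 (hrep h)
      exact (sameCycle_or_of_cutPath p).resolve_left h1
  have hgl : ∀ h, dir (D.glue h) ↔ ¬ dir h := by
    intro h
    have e : rep (D.smooth s (D.glue h)) = rep h := by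
      simp only [rep, D.cycleOf_smooth, D.cycleOf_glue]
    have h1 : dir (D.smooth s (D.glue h)) ↔ dir h := by
      simp only [dir, e]
      exact Equiv.Perm.sameCycle_apply_right (f := D.doubleStep s)
    rw [← h1, hsm, not_not]
  refine ⟨fun h => if dir h ↔ D.Inward h then .red else .green, fun h => ?_, fun h => ?_⟩
  · simp only [hsm, D.inward_smooth, not_iff_not]
  · simp only [hgl, IsCut]
    by_cases h1 : dir h <;> by_cases h2 : D.Inward h <;> by_cases h3 : D.Inward (D.glue h) <;>
      simp [h1, h2, h3]

/-- A compatible colouring may be prescribed arbitrarily at one point of each cycle. -/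
theorem exists_compatible_of_star {s : State ι} (star : D.CrossingCycle s → HalfEdge ι)
    (hstar : ∀ z, D.cycleOf s (star z) = z) (k : D.CrossingCycle s → Colour) :
    ∃ χ, D.Compatible s χ ∧ ∀ z, χ (star z) = k z := by
  classical
  obtain ⟨χ₀, h₀⟩ := D.exists_compatible s
  refine ⟨fun h => if χ₀ h = χ₀ (star (D.cycleOf s h)) then k (D.cycleOf s h)
    else (k (D.cycleOf s h)).other, ⟨fun h => ?_, fun h => ?_⟩, fun z => ?_⟩
  · simp only [D.cycleOf_smooth, h₀.smooth]
  · simp only [D.cycleOf_glue, ← h₀.glue]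
    generalize χ₀ (star (D.cycleOf s h)) = a
    generalize k (D.cycleOf s h) = b
    cases χ₀ (D.glue h) <;> cases χ₀ h <;> cases a <;> cases b <;> decide
  · simp [hstar]

/-! ### The flow of a coloured state -/

variable (D) in
/-- The direction of the strand given by the colouring (the source-sink orientation on red strands
and its reverse on green ones) points towards the crossing at `h`. -/
def Entering (χ : HalfEdge ι → Colour) (h : HalfEdge ι) : Prop := D.Inward h ↔ χ h = .red

namespace Compatible

variable {s s' : State ι} {χ : HalfEdge ι → Colour}

theorem entering_smooth (hχ : D.Compatible s χ) (h : HalfEdge ι) :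
    D.Entering χ (D.smooth s h) ↔ ¬ D.Entering χ h := by
  rw [Entering, Entering, D.inward_smooth, hχ.smooth]; tauto

theorem entering_glue (hχ : D.Compatible s χ) (h : HalfEdge ι) :
    D.Entering χ (D.glue h) ↔ ¬ D.Entering χ h := by
  have := hχ.glue h
  rw [IsCut] at this
  rw [Entering, Entering]
  revert this
  by_cases h2 : D.Inward h <;> by_cases h3 : D.Inward (D.glue h) <;>
    cases χ (D.glue h) <;> cases χ h <;> simp [h2, h3]

open Classical in
/-- The permutation that moves each end one step along its cycle, in the direction given by the
colouring. -/
noncomputable def flow (hχ : D.Compatible s χ) : Equiv.Perm (HalfEdge ι) where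
  toFun h := if D.Entering χ h then D.smooth s h else D.glue h
  invFun h := if D.Entering χ h then D.glue h else D.smooth s h
  left_inv h := by
    dsimp only
    by_cases hh : D.Entering χ h
    · rw [if_pos hh, if_neg (by rw [hχ.entering_smooth]; exact not_not_intro hh), D.smooth_smooth]
    · rw [if_neg hh, if_pos ((hχ.entering_glue h).2 hh), D.glue_glue]
  right_inv h := by
    dsimp only
    by_cases hh : D.Entering χ h
    · rw [if_pos hh, if_neg (by rw [hχ.entering_glue]; exact not_not_intro hh), D.glue_glue]
    · rw [if_neg hh, if_pos ((hχ.entering_smooth h).2 hh), D.smooth_smooth]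

theorem flow_of_entering (hχ : D.Compatible s χ) {h : HalfEdge ι} (hh : D.Entering χ h) :
    hχ.flow h = D.smooth s h := if_pos hh

theorem flow_of_not_entering (hχ : D.Compatible s χ) {h : HalfEdge ι} (hh : ¬ D.Entering χ h) :
    hχ.flow h = D.glue h := if_neg hh

theorem sameCycle_flow_iff (hχ : D.Compatible s χ) {h k : HalfEdge ι} :
    hχ.flow.SameCycle h k ↔ D.cycleOf s h = D.cycleOf s k := by
  constructor
  · refine Equiv.Perm.SameCycle.of_equivalence (r := fun h k => D.cycleOf s h = D.cycleOf s k)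
      ⟨fun _ => rfl, fun h => h.symm, fun h k => h.trans k⟩ fun h => ?_
    by_cases hh : D.Entering χ h
    · rw [hχ.flow_of_entering hh, D.cycleOf_smooth]
    · rw [hχ.flow_of_not_entering hh, D.cycleOf_glue]
  · rw [D.cycleOf_eq_iff]
    rintro ⟨n, p⟩
    induction p with
    | refl => exact .rfl
    | @smooth k _ _ ih =>
      refine ih.trans ?_
      by_cases hh : D.Entering χ k
      · exact ⟨1, by rw [zpow_one, hχ.flow_of_entering hh]⟩
      · refine Equiv.Perm.SameCycle.symm ⟨1, ?_⟩
        rw [zpow_one, hχ.flow_of_entering ((hχ.entering_smooth k).2 hh), D.smooth_smooth]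
    | @glue k _ _ ih =>
      refine ih.trans ?_
      by_cases hh : D.Entering χ k
      · refine Equiv.Perm.SameCycle.symm ⟨1, ?_⟩
        rw [zpow_one, hχ.flow_of_not_entering (by rw [hχ.entering_glue]; exact not_not_intro hh),
          D.glue_glue]
      · exact ⟨1, by rw [zpow_one, hχ.flow_of_not_entering hh]⟩

/-- The sites are the two ends of one strand, and the arcs join them to the two ends of the other
strand. -/
theorem eq_site₁ (hχ : D.Compatible s χ) {c : ι} (hc : χ (D.site₁ c) = χ (D.site₂ c)) (o e : Bool) :
    χ (c, o, e) = χ (D.site₁ c) := by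
  have h1 := hχ.smooth (c, o, e)
  rw [site₁, site₂] at hc
  rw [site₁]
  rcases eq_or_ne o (D.positive c) with rfl | ho
  · rw [← h1]
    simp only [VirtualLinkDiagram.smooth]
    split <;> cases e <;> simp [hc]
  · have : o = !D.positive c := by
      revert ho; cases o <;> cases D.positive c <;> simp
    subst this
    cases e <;> simp [hc]

/-- All four ends at such a crossing have one colour, so either smoothing is allowed there. This is
why a colouring lives on a whole subcube of states. -/
theorem of_free (hχ : D.Compatible s χ) {c : ι} (hc : χ (D.site₁ c) = χ (D.site₂ c))
    (hs : ∀ d, d ≠ c → s' d = s d) : D.Compatible s' χ := by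
  refine ⟨fun h => ?_, hχ.glue⟩
  rcases h with ⟨d, o, e⟩
  rcases eq_or_ne d c with rfl | hd
  · simp only [VirtualLinkDiagram.smooth]
    split <;> simp only [hχ.eq_site₁ hc]
  · have := hχ.smooth (d, o, e)
    simp only [VirtualLinkDiagram.smooth] at this ⊢
    rw [hs d hd]; exact this

end Compatible

open Classical in
variable (D) in
/-- The end at which the arc through `h` leaves the crossing. -/
noncomputable def leave (χ : HalfEdge ι → Colour) (s : State ι) (h : HalfEdge ι) : HalfEdge ι :=
  if D.Entering χ h then D.smooth s h else h

theorem leave_fst (χ : HalfEdge ι → Colour) (s : State ι) (h : HalfEdge ι) :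
    (D.leave χ s h).1 = h.1 := by
  rcases h with ⟨c, o, e⟩
  rw [leave]; split
  · simp only [smooth]; split <;> rfl
  · rfl

theorem cycleOf_leave (χ : HalfEdge ι → Colour) (s : State ι) (h : HalfEdge ι) :
    D.cycleOf s (D.leave χ s h) = D.cycleOf s h := by
  rw [leave]; split
  · exact D.cycleOf_smooth s h
  · rfl

theorem leave_congr {s s' : State ι} {χ : HalfEdge ι → Colour} {h : HalfEdge ι} (hs : s h.1 = s' h.1) :
    D.leave χ s h = D.leave χ s' h := by
  rcases h with ⟨c, o, e⟩
  simp only at hs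
  simp only [leave, smooth, hs]

theorem entering_site₁ {χ : HalfEdge ι → Colour} {c : ι} :
    D.Entering χ (D.site₁ c) ↔ χ (D.site₁ c) = .green := by
  simp only [Entering, site₁, Inward]
  cases χ (c, !D.positive c, true) <;> simp

theorem entering_site₂ {χ : HalfEdge ι → Colour} {c : ι} :
    D.Entering χ (D.site₂ c) ↔ χ (D.site₂ c) = .green := by
  simp only [Entering, site₂, Inward]
  cases χ (c, !D.positive c, false) <;> simp

/-- At a green crossing the strands enter at the sites, so the leaving ends lie on the other strand,
and the two smoothings attach them to the sites in opposite ways. At a red crossing the sites are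
themselves the leaving ends, whatever the smoothing. -/
theorem leave_site₁_of_ne {s s' : State ι} {χ : HalfEdge ι → Colour} {c : ι}
    (hg : χ (D.site₁ c) = .green) (hc : χ (D.site₁ c) = χ (D.site₂ c)) (hs : s c ≠ s' c) :
    D.leave χ s' (D.site₁ c) = D.leave χ s (D.site₂ c) := by
  rw [leave, leave, if_pos (entering_site₁.2 hg), if_pos (entering_site₂.2 (hc ▸ hg))]
  simp only [site₁, site₂, smooth]
  rcases (s c).eq_false_or_eq_true with h1 | h1 <;>
    rcases (s' c).eq_false_or_eq_true with h2 | h2 <;>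
    rcases (D.positive c).eq_false_or_eq_true with h3 | h3 <;> simp_all

theorem leave_site₂_of_ne {s s' : State ι} {χ : HalfEdge ι → Colour} {c : ι}
    (hg : χ (D.site₁ c) = .green) (hc : χ (D.site₁ c) = χ (D.site₂ c)) (hs : s c ≠ s' c) :
    D.leave χ s' (D.site₂ c) = D.leave χ s (D.site₁ c) :=
  (leave_site₁_of_ne hg hc hs.symm).symm

theorem leave_site₁_of_red {s : State ι} {χ : HalfEdge ι → Colour} {c : ι}
    (hg : χ (D.site₁ c) = .red) : D.leave χ s (D.site₁ c) = D.site₁ c := by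
  rw [leave, if_neg (by rw [entering_site₁, hg]; simp)]

theorem leave_site₂_of_red {s : State ι} {χ : HalfEdge ι → Colour} {c : ι}
    (hg : χ (D.site₂ c) = .red) : D.leave χ s (D.site₂ c) = D.site₂ c := by
  rw [leave, if_neg (by rw [entering_site₂, hg]; simp)]

/-! ### Resmoothing crossings of a single colour. -/

section Resmoothing

variable {s s' : State ι} {χ : HalfEdge ι → Colour} {c : ι}

/-- At a crossing of one colour two ends enter and two leave, and the two smoothings are the two
ways of sending the former to the latter. The flow is unchanged elsewhere. -/
theorem flow_resmooth [DecidableEq ι] (hχ : D.Compatible s χ) (hχ' : D.Compatible s' χ)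
    (hc : χ (D.site₁ c) = χ (D.site₂ c)) (hs : ∀ d, d ≠ c → s' d = s d) (hsc : s c ≠ s' c) :
    hχ'.flow = Equiv.swap (D.leave χ s (D.site₁ c)) (D.leave χ s (D.site₂ c)) * hχ.flow := by
  have hl1 : ¬ D.Entering χ (D.leave χ s (D.site₁ c)) := by
    rw [leave]; split
    · rw [hχ.entering_smooth]; exact not_not_intro ‹_›
    · assumption
  have hl2 : ¬ D.Entering χ (D.leave χ s (D.site₂ c)) := by
    rw [leave]; split
    · rw [hχ.entering_smooth]; exact not_not_intro ‹_›
    · assumption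
  ext1 h
  rw [Equiv.Perm.mul_apply]
  by_cases hh : D.Entering χ h
  · rw [hχ.flow_of_entering hh, hχ'.flow_of_entering hh]
    rcases h with ⟨d, o, e⟩
    rcases eq_or_ne d c with rfl | hd
    · have h1 := entering_site₁ (D := D) (χ := χ) (c := d)
      have h2 := entering_site₂ (D := D) (χ := χ) (c := d)
      rw [← hc] at h2
      simp only [Entering, hχ.eq_site₁ hc] at hh
      simp only [leave, h1, h2]
      cases hx : χ (D.site₁ d)
      · simp only [hx, Inward, iff_true] at hh
        subst hh
        rw [if_neg (by simp), if_neg (by simp)]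
        simp only [smooth, site₁, site₂]
        clear hl1 hl2
        rcases (s d).eq_false_or_eq_true with h1 | h1 <;>
          rcases (s' d).eq_false_or_eq_true with h2 | h2 <;>
          rcases (D.positive d).eq_false_or_eq_true with h3 | h3 <;> cases e <;> simp_all
      · simp only [hx, Inward] at hh
        obtain rfl : o = !D.positive d := by
          revert hh; cases o <;> cases D.positive d <;> simp
        rw [if_pos rfl, if_pos rfl]
        simp only [smooth, site₁, site₂]
        clear hl1 hl2
        rcases (s d).eq_false_or_eq_true with h1 | h1 <;>
          rcases (s' d).eq_false_or_eq_true with h2 | h2 <;>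
          rcases (D.positive d).eq_false_or_eq_true with h3 | h3 <;> cases e <;> simp_all
    · have e1 : D.smooth s' (d, o, e) = D.smooth s (d, o, e) := by
        simp only [smooth, hs d hd]
      have e2 : (D.smooth s (d, o, e)).1 = d := by
        simp only [smooth]; split <;> rfl
      rw [e1, Equiv.swap_apply_of_ne_of_ne]
      · intro h; apply hd; rw [← e2, h, leave_fst]; rfl
      · intro h; apply hd; rw [← e2, h, leave_fst]; rfl
  · rw [hχ.flow_of_not_entering hh, hχ'.flow_of_not_entering hh, Equiv.swap_apply_of_ne_of_ne]
    · intro h; apply hl1; rw [← h, hχ.entering_glue]; exact hh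
    · intro h; apply hl2; rw [← h, hχ.entering_glue]; exact hh

theorem leave_site₁_ne_leave_site₂ (hc : χ (D.site₁ c) = χ (D.site₂ c)) :
    D.leave χ s (D.site₁ c) ≠ D.leave χ s (D.site₂ c) := by
  have hne : D.site₁ c ≠ D.site₂ c := by simp [site₁, site₂]
  have h1 := entering_site₁ (D := D) (χ := χ) (c := c)
  have h2 := entering_site₂ (D := D) (χ := χ) (c := c)
  rw [← hc, ← h1] at h2
  rw [leave, leave]
  by_cases h : D.Entering χ (D.site₁ c)
  · rw [if_pos h, if_pos (h2.2 h)]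
    intro e
    apply hne
    rw [← D.smooth_smooth s (D.site₁ c), e, D.smooth_smooth]
  · rw [if_neg h, if_neg (fun h' => h (h2.1 h'))]
    exact hne

variable [Finite ι]

/-- If a resmoothed crossing has a single colour, then the resmoothing merges two cycles or splits
one. -/
theorem cycleOf_site_iff (hχ : D.Compatible s χ) (hc : χ (D.site₁ c) = χ (D.site₂ c))
    (hs : ∀ d, d ≠ c → s' d = s d) (hsc : s c ≠ s' c) :
    D.cycleOf s' (D.site₁ c) = D.cycleOf s' (D.site₂ c) ↔
      D.cycleOf s (D.site₁ c) ≠ D.cycleOf s (D.site₂ c) := by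
  classical
  have hχ' := hχ.of_free hc hs
  have key : ∀ {s s' : State ι} (hχ : D.Compatible s χ) (hχ' : D.Compatible s' χ)
      (_ : ∀ d, d ≠ c → s' d = s d) (_ : s c ≠ s' c),
      D.cycleOf s (D.site₁ c) = D.cycleOf s (D.site₂ c) →
      D.cycleOf s' (D.leave χ s (D.site₁ c)) ≠ D.cycleOf s' (D.leave χ s (D.site₂ c)) := by
    intro s s' hχ hχ' hs hsc h
    rw [← cycleOf_leave χ s (D.site₁ c), ← cycleOf_leave χ s (D.site₂ c),
      ← hχ.sameCycle_flow_iff] at h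
    rw [Ne, ← hχ'.sameCycle_flow_iff, flow_resmooth hχ hχ' hc hs hsc]
    exact Equiv.Perm.not_sameCycle_swap_mul (leave_site₁_ne_leave_site₂ hc) h
  -- The transposed leaving ends are read in `s`, the conclusion concerns the sites in `s'`: on red
  -- they coincide, on green they are exchanged, which does not affect a symmetric relation.
  have aux : ∀ s s' : State ι, s c ≠ s' c →
      (D.cycleOf s' (D.leave χ s (D.site₁ c)) = D.cycleOf s' (D.leave χ s (D.site₂ c)) ↔
      D.cycleOf s' (D.site₁ c) = D.cycleOf s' (D.site₂ c)) := by
    intro s s' hsc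
    cases hx : χ (D.site₁ c)
    · rw [leave_site₁_of_red hx, leave_site₂_of_red (hc ▸ hx)]
    · rw [← leave_site₁_of_ne hx hc hsc, ← leave_site₂_of_ne hx hc hsc, cycleOf_leave,
        cycleOf_leave, eq_comm]
  constructor
  · intro h' h
    exact key hχ hχ' hs hsc h ((aux s s' hsc).2 h')
  · intro h
    rw [← aux s s' hsc]
    rw [← cycleOf_leave χ s (D.site₁ c), ← cycleOf_leave χ s (D.site₂ c), Ne,
      ← hχ.sameCycle_flow_iff] at h
    rw [← hχ'.sameCycle_flow_iff, flow_resmooth hχ hχ' hc hs hsc]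
    exact Equiv.Perm.sameCycle_swap_mul h

/-- The cycles after a merge. -/
theorem cycleOf_eq_iff_of_merge (hχ : D.Compatible s χ) (hc : χ (D.site₁ c) = χ (D.site₂ c))
    (hs : ∀ d, d ≠ c → s' d = s d) (hsc : s c ≠ s' c)
    (hm : D.cycleOf s (D.site₁ c) ≠ D.cycleOf s (D.site₂ c)) {a b : HalfEdge ι} :
    D.cycleOf s' a = D.cycleOf s' b ↔ D.cycleOf s a = D.cycleOf s b ∨
      (D.cycleOf s a = D.cycleOf s (D.site₁ c) ∧ D.cycleOf s (D.site₂ c) = D.cycleOf s b) ∨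
      (D.cycleOf s a = D.cycleOf s (D.site₂ c) ∧ D.cycleOf s (D.site₁ c) = D.cycleOf s b) := by
  classical
  have hχ' := hχ.of_free hc hs
  rw [← cycleOf_leave χ s (D.site₁ c), ← cycleOf_leave χ s (D.site₂ c), Ne,
    ← hχ.sameCycle_flow_iff] at hm
  rw [← cycleOf_leave χ s (D.site₁ c), ← cycleOf_leave χ s (D.site₂ c)]
  simp only [← hχ.sameCycle_flow_iff, ← hχ'.sameCycle_flow_iff]
  rw [flow_resmooth hχ hχ' hc hs hsc]
  exact Equiv.Perm.sameCycle_swap_mul_iff hm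

end Resmoothing

/-- If two crossings of single colours both connect the same two cycles, then resmoothing both
exchanges the pairing of the sites if the colours agree, and keeps it otherwise. -/
theorem cycleOf_ne_of_resmooth_two [Finite ι] [DecidableEq ι] {s s' : State ι}
    {χ : HalfEdge ι → Colour} {c c' : ι} {u v : HalfEdge ι} (hcc : c ≠ c')
    (huv : (u = D.site₁ c' ∧ v = D.site₂ c') ∨ (u = D.site₂ c' ∧ v = D.site₁ c'))
    (hχ : D.Compatible s χ) (hc : χ (D.site₁ c) = χ (D.site₂ c))
    (hc' : χ (D.site₁ c') = χ (D.site₂ c'))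
    (hs : ∀ d, d ≠ c → d ≠ c' → s' d = s d) (hsc : s c ≠ s' c) (hsc' : s c' ≠ s' c')
    (hxu : D.cycleOf s (D.site₁ c) = D.cycleOf s u)
    (hyv : D.cycleOf s (D.site₂ c) = D.cycleOf s v)
    (hxy : D.cycleOf s (D.site₁ c) ≠ D.cycleOf s (D.site₂ c)) :
    D.cycleOf s' (D.site₁ c) ≠ D.cycleOf s'
      (if χ (D.site₁ c) = χ (D.site₁ c') then u else v) := by
  set t : State ι := Function.update s c' (s' c') with ht
  have ht' : ∀ d, d ≠ c' → t d = s d := fun d hd => Function.update_of_ne hd _ _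
  have htc : t c = s c := ht' c hcc
  have htc' : t c' = s' c' := Function.update_self _ _ _
  have hts : ∀ d, d ≠ c → s' d = t d := by
    intro d hd
    rcases eq_or_ne d c' with rfl | hd'
    · exact htc'.symm
    · rw [ht' d hd', hs d hd hd']
  have hχt := hχ.of_free hc' ht'
  have hχ' := hχt.of_free hc hts
  have hflow : hχ'.flow = Equiv.swap (D.leave χ s (D.site₁ c)) (D.leave χ s (D.site₂ c)) *
      (Equiv.swap (D.leave χ s u) (D.leave χ s v) * hχ.flow) := by
    rw [flow_resmooth hχt hχ' hc hts (by rw [htc]; exact hsc),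
      flow_resmooth hχ hχt hc' ht' (by rw [htc']; exact hsc'),
      leave_congr (s := t) (s' := s) (by exact htc), leave_congr (s := t) (s' := s) (by exact htc)]
    rcases huv with ⟨rfl, rfl⟩ | ⟨rfl, rfl⟩
    · rfl
    · rw [Equiv.swap_comm (D.leave χ s (D.site₁ c'))]
  have hfst : u.1 = c' ∧ v.1 = c' := by
    rcases huv with ⟨rfl, rfl⟩ | ⟨rfl, rfl⟩ <;> exact ⟨rfl, rfl⟩
  have hred : χ (D.site₁ c') = .red → D.leave χ s u = u ∧ D.leave χ s v = v := by
    intro h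
    have h1 := leave_site₁_of_red (s := s) h
    have h2 := leave_site₂_of_red (s := s) (c := c') (hc' ▸ h)
    rcases huv with ⟨rfl, rfl⟩ | ⟨rfl, rfl⟩
    exacts [⟨h1, h2⟩, ⟨h2, h1⟩]
  have hgreen : χ (D.site₁ c') = .green →
      D.leave χ s' u = D.leave χ s v ∧ D.leave χ s' v = D.leave χ s u := by
    intro h
    have h1 := leave_site₁_of_ne h hc' hsc'
    have h2 := leave_site₂_of_ne h hc' hsc'
    rcases huv with ⟨rfl, rfl⟩ | ⟨rfl, rfl⟩
    exacts [⟨h1, h2⟩, ⟨h2, h1⟩]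
  have hn1 : D.leave χ s (D.site₁ c) ≠ D.leave χ s u := fun h => hcc (by
    have := congrArg Prod.fst h; rwa [leave_fst, leave_fst, hfst.1] at this)
  have hn2 : D.leave χ s (D.site₂ c) ≠ D.leave χ s v := fun h => hcc (by
    have := congrArg Prod.fst h; rwa [leave_fst, leave_fst, hfst.2] at this)
  rw [← cycleOf_leave χ s (D.site₁ c), ← cycleOf_leave χ s u,
    ← hχ.sameCycle_flow_iff] at hxu
  rw [← cycleOf_leave χ s (D.site₂ c), ← cycleOf_leave χ s v,
    ← hχ.sameCycle_flow_iff] at hyv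
  rw [← cycleOf_leave χ s (D.site₁ c), ← cycleOf_leave χ s (D.site₂ c), Ne,
    ← hχ.sameCycle_flow_iff] at hxy
  have k1 := Equiv.Perm.not_sameCycle_swap_mul_swap_mul hxu hyv hxy hn1 hn2
  have k2 := Equiv.Perm.not_sameCycle_swap_mul_swap_mul hyv hxu (fun h => hxy h.symm) hn2 hn1
  rw [Equiv.swap_comm, Equiv.swap_comm (D.leave χ s v)] at k2
  rw [← hflow, hχ'.sameCycle_flow_iff] at k1 k2
  -- `k1` and `k2` separate leaving ends read in `s`. Passing to the sites in `s'` exchanges the two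
  -- ends at a green crossing and does nothing at a red one, so the site separated from the first
  -- site of `c` depends only on whether the colours agree.
  cases hx : χ (D.site₁ c) <;> cases hu : χ (D.site₁ c')
  · rw [if_pos rfl]
    rwa [leave_site₁_of_red hx, (hred hu).1] at k1
  · rw [if_neg (by simp)]
    rwa [leave_site₁_of_red hx, ← (hgreen hu).2, cycleOf_leave] at k1
  · rw [if_neg (by simp)]
    rwa [(hred hu).2, ← leave_site₁_of_ne hx hc hsc, cycleOf_leave] at k2
  · rw [if_pos rfl]
    rwa [← (hgreen hu).1, ← leave_site₁_of_ne hx hc hsc, cycleOf_leave, cycleOf_leave] at k2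

end VirtualLinkDiagram

end VirtualKhovanovLee

/-! ### Cycles away from the resmoothed crossing. -/

namespace VirtualKhovanovLee

variable {ι : Type}

namespace VirtualLinkDiagram

/-- The ends of the semi-arcs, and one point on each component without crossings. -/
abbrev Point (D : VirtualLinkDiagram ι) : Type := HalfEdge ι ⊕ Fin D.circles

variable (D : VirtualLinkDiagram ι)

/-- The cycle of the state `s` through a point. -/
def cycleThrough (s : State ι) : D.Point → D.Cycle s := Sum.map (D.cycleOf s) id

variable {D}

@[simp] theorem cycleThrough_inl (s : State ι) (h : HalfEdge ι) :
    D.cycleThrough s (.inl h) = .inl (D.cycleOf s h) := rfl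

@[simp] theorem cycleThrough_inr (s : State ι) (i : Fin D.circles) :
    D.cycleThrough s (.inr i) = .inr i := rfl

theorem cycleThrough_surjective (s : State ι) : Function.Surjective (D.cycleThrough s) :=
  Function.Surjective.sumMap Quotient.mk_surjective Function.surjective_id

/-- The states `s` and `s'` differ exactly at the crossing `c`, and the colouring `χ` is compatible
with both of them and has a single colour at `c`. -/
structure FreeEdge (χ : HalfEdge ι → Colour) (c : ι) (s s' : State ι) : Prop where
  compatible : D.Compatible s χ
  free : χ (D.site₁ c) = χ (D.site₂ c)
  agree : ∀ d, d ≠ c → s' d = s d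
  ne : s c ≠ s' c

namespace FreeEdge

variable {χ : HalfEdge ι → Colour} {c : ι} {s s' : State ι}

theorem symm (E : D.FreeEdge χ c s s') : D.FreeEdge χ c s' s :=
  ⟨E.compatible.of_free E.free E.agree, E.free, fun d hd => (E.agree d hd).symm, E.ne.symm⟩

variable [Finite ι]

theorem split_iff (E : D.FreeEdge χ c s s') :
    D.cycleOf s' (D.site₁ c) ≠ D.cycleOf s' (D.site₂ c) ↔
      D.cycleOf s (D.site₁ c) = D.cycleOf s (D.site₂ c) := by
  rw [Ne, cycleOf_site_iff E.compatible E.free E.agree E.ne, not_not]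

theorem cycleThrough_eq_iff (E : D.FreeEdge χ c s s')
    (hm : D.cycleOf s (D.site₁ c) ≠ D.cycleOf s (D.site₂ c)) {a b : D.Point} :
    D.cycleThrough s' a = D.cycleThrough s' b ↔ D.cycleThrough s a = D.cycleThrough s b ∨
      (D.cycleThrough s a = D.cycleThrough s (.inl (D.site₁ c)) ∧
        D.cycleThrough s (.inl (D.site₂ c)) = D.cycleThrough s b) ∨
      (D.cycleThrough s a = D.cycleThrough s (.inl (D.site₂ c)) ∧
        D.cycleThrough s (.inl (D.site₁ c)) = D.cycleThrough s b) := by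
  rcases a with a | a <;> rcases b with b | b
  · simp only [cycleThrough_inl, Sum.inl.injEq]
    exact cycleOf_eq_iff_of_merge E.compatible E.free E.agree E.ne hm
  all_goals simp

end FreeEdge

variable (D) in
/-- The cycle of the state `s` through `q` does not meet the crossing `c`. -/
def Avoids (c : ι) (s : State ι) (q : D.Point) : Prop :=
  D.cycleThrough s q ≠ D.cycleThrough s (.inl (D.site₁ c)) ∧
    D.cycleThrough s q ≠ D.cycleThrough s (.inl (D.site₂ c))

namespace FreeEdge

variable {χ : HalfEdge ι → Colour} {c : ι} {s s' : State ι} [Finite ι]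

theorem avoids_iff (E : D.FreeEdge χ c s s') {q : D.Point} :
    D.Avoids c s' q ↔ D.Avoids c s q := by
  have key : ∀ {s s' : State ι} (_ : D.FreeEdge χ c s s')
      (_ : D.cycleOf s (D.site₁ c) ≠ D.cycleOf s (D.site₂ c)),
      D.Avoids c s' q ↔ D.Avoids c s q := by
    intro s s' E hm
    rw [Avoids, Avoids, Ne, Ne, E.cycleThrough_eq_iff hm, E.cycleThrough_eq_iff hm]
    tauto
  by_cases hm : D.cycleOf s (D.site₁ c) = D.cycleOf s (D.site₂ c)
  · exact (key E.symm (E.split_iff.2 hm)).symm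
  · exact key E hm

/-- Edges may be reversed, so the resmoothing may be taken to be a merge, and a merge identifies no
cycles other than those of the two sites. -/
theorem cycleThrough_eq_iff_of_avoids (E : D.FreeEdge χ c s s') {q r : D.Point}
    (hq : D.Avoids c s q) :
    D.cycleThrough s q = D.cycleThrough s r ↔ D.cycleThrough s' q = D.cycleThrough s' r := by
  have key : ∀ {s s' : State ι} (_ : D.FreeEdge χ c s s') (_ : D.Avoids c s q)
      (_ : D.cycleOf s (D.site₁ c) ≠ D.cycleOf s (D.site₂ c)),
      D.cycleThrough s q = D.cycleThrough s r ↔ D.cycleThrough s' q = D.cycleThrough s' r := by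
    intro s s' E hq hm
    rw [E.cycleThrough_eq_iff hm]
    rw [Avoids] at hq
    tauto
  by_cases hm : D.cycleOf s (D.site₁ c) = D.cycleOf s (D.site₂ c)
  · exact (key E.symm (E.avoids_iff.2 hq) (E.split_iff.2 hm)).symm
  · exact key E hq hm

end FreeEdge

/-- A common point treats the cycles through crossings and the components without crossings alike.
-/
theorem unaffected_iff {c : ι} {s s' : State ι} {p : D.Cycle s × D.Cycle s'} :
    D.Unaffected c s s' p ↔
      ∃ q, D.Avoids c s q ∧ D.cycleThrough s q = p.1 ∧ D.cycleThrough s' q = p.2 := by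
  rcases p with ⟨z | i, z' | j⟩
  · simp only [Unaffected, Avoids]
    constructor
    · rintro ⟨h1, h2, h, rfl, rfl⟩
      exact ⟨.inl h, by simpa using ⟨h1, h2⟩, rfl, rfl⟩
    · rintro ⟨q | q, ⟨h1, h2⟩, h3, h4⟩
      · simp only [cycleThrough_inl, Sum.inl.injEq, ne_eq] at h1 h2 h3 h4
        subst h3 h4
        exact ⟨h1, h2, q, rfl, rfl⟩
      · simp at h3
  · simp only [Unaffected, false_iff]
    rintro ⟨q | q, _, h3, h4⟩
    · simp at h4
    · simp at h3
  · simp only [Unaffected, false_iff]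
    rintro ⟨q | q, _, h3, h4⟩
    · simp at h3
    · simp at h4
  · simp only [Unaffected]
    constructor
    · rintro rfl
      exact ⟨.inr i, by simp [Avoids], rfl, rfl⟩
    · rintro ⟨q | q, _, h3, h4⟩
      · simp at h3
      · simp only [cycleThrough_inr, Sum.inr.injEq] at h3 h4
        exact h3.symm.trans h4

/-- If resmoothing `c` splits a cycle, then every colouring that is compatible with the first state
has a single colour at `c`. -/
theorem Compatible.free_of_split {χ : HalfEdge ι → Colour} {c : ι} {s s' : State ι}
    (hχ : D.Compatible s χ) (hs : ∀ d, d ≠ c → s' d = s d)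
    (h1 : D.cycleOf s (D.site₁ c) = D.cycleOf s (D.site₂ c))
    (h2 : D.cycleOf s' (D.site₁ c) ≠ D.cycleOf s' (D.site₂ c)) :
    χ (D.site₁ c) = χ (D.site₂ c) := by
  classical
  -- The sites lie on different cycles of `s'`, so both can be marked points and some compatible
  -- colouring of `s'` makes both red. It remains compatible with `s`, where the sites share a
  -- cycle; all compatible colourings agree on whether two points of one cycle have equal colours.
  let star : D.CrossingCycle s' → HalfEdge ι := fun z =>
    if z = D.cycleOf s' (D.site₁ c) then D.site₁ c
    else if z = D.cycleOf s' (D.site₂ c) then D.site₂ c else z.out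
  have hstar : ∀ z, D.cycleOf s' (star z) = z := by
    intro z
    simp only [star]
    split_ifs with h h'
    · exact h.symm
    · exact h'.symm
    · exact Quotient.out_eq _
  obtain ⟨χ', hχ', hz⟩ := exists_compatible_of_star star hstar fun _ => .red
  have e1 : χ' (D.site₁ c) = .red := by
    have := hz (D.cycleOf s' (D.site₁ c)); simpa [star] using this
  have e2 : χ' (D.site₂ c) = .red := by
    have := hz (D.cycleOf s' (D.site₂ c)); simpa [star, h2.symm] using this
  have hχs := hχ'.of_free (e1.trans e2.symm) fun d hd => (hs d hd).symm
  exact (hχ.eq_iff hχs h1).2 (e1.trans e2.symm)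

section UnaffectedPairs

variable [Finite ι]

open Classical in
variable (D) in
/-- The cycles that do not meet the crossing `c`, paired with the same cycles in another state. -/
noncomputable def unaffectedPairs (c : ι) (s s' : State ι) : Finset (D.Cycle s × D.Cycle s') :=
  Finset.univ.filter (D.Unaffected c s s')

theorem mem_unaffectedPairs {c : ι} {s s' : State ι} {p : D.Cycle s × D.Cycle s'} :
    p ∈ D.unaffectedPairs c s s' ↔ D.Unaffected c s s' p := by
  simp [unaffectedPairs]

variable {χ : HalfEdge ι → Colour} {c : ι} {s s' : State ι}

theorem FreeEdge.fst_injective (E : D.FreeEdge χ c s s') {p q : D.Cycle s × D.Cycle s'}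
    (hp : D.Unaffected c s s' p) (hq : D.Unaffected c s s' q) (h : p.1 = q.1) : p = q := by
  obtain ⟨a, ha, ha1, ha2⟩ := unaffected_iff.1 hp
  obtain ⟨b, hb, hb1, hb2⟩ := unaffected_iff.1 hq
  refine Prod.ext h ?_
  rw [← ha2, ← hb2, ← E.cycleThrough_eq_iff_of_avoids ha, ha1, hb1, h]

variable {M : Type*} [CommMonoid M]

/-- The pair of site cycles is a finset, which collapses to a singleton when the sites share a
cycle; one formula therefore serves both ends of a merge and of a split. -/
theorem FreeEdge.prod_fst (E : D.FreeEdge χ c s s') (f : D.Cycle s → M) :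
    ∏ z, f z = (∏ z ∈ {.inl (D.cycleOf s (D.site₁ c)), .inl (D.cycleOf s (D.site₂ c))}, f z) *
      ∏ p ∈ D.unaffectedPairs c s s', f p.1 := by
  rw [← Finset.prod_image (s := D.unaffectedPairs c s s') (g := Prod.fst) (f := f)
    fun p hp q hq h => E.fst_injective (mem_unaffectedPairs.1 hp) (mem_unaffectedPairs.1 hq) h,
    ← Finset.prod_union]
  · congr 1
    symm
    rw [Finset.eq_univ_iff_forall]
    intro z
    obtain ⟨q, rfl⟩ := cycleThrough_surjective s z
    by_cases hq : D.Avoids c s q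
    · refine Finset.mem_union_right _ (Finset.mem_image.2 ⟨(_, D.cycleThrough s' q), ?_, rfl⟩)
      exact mem_unaffectedPairs.2 (unaffected_iff.2 ⟨q, hq, rfl, rfl⟩)
    · refine Finset.mem_union_left _ ?_
      rw [Avoids] at hq
      simp only [Finset.mem_insert, Finset.mem_singleton]
      simp only [cycleThrough_inl] at hq
      tauto
  · rw [Finset.disjoint_left]
    intro z hz hz'
    obtain ⟨p, hp, rfl⟩ := Finset.mem_image.1 hz'
    obtain ⟨q, hq, hq1, -⟩ := unaffected_iff.1 (mem_unaffectedPairs.1 hp)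
    rw [Avoids, hq1] at hq
    simp only [Finset.mem_insert, Finset.mem_singleton] at hz
    exact hz.elim hq.1 hq.2

theorem FreeEdge.prod_snd (E : D.FreeEdge χ c s s') (f : D.Cycle s' → M) :
    ∏ z, f z = (∏ z ∈ {.inl (D.cycleOf s' (D.site₁ c)), .inl (D.cycleOf s' (D.site₂ c))}, f z) *
      ∏ p ∈ D.unaffectedPairs c s s', f p.2 := by
  rw [E.symm.prod_fst]
  congr 1
  refine Finset.prod_bij' (fun p _ => p.swap) (fun p _ => p.swap) ?_ ?_ ?_ ?_ ?_
  · intro p hp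
    obtain ⟨q, hq, h1, h2⟩ := unaffected_iff.1 (mem_unaffectedPairs.1 hp)
    exact mem_unaffectedPairs.2 (unaffected_iff.2 ⟨q, E.symm.avoids_iff.2 hq, h2, h1⟩)
  · intro p hp
    obtain ⟨q, hq, h1, h2⟩ := unaffected_iff.1 (mem_unaffectedPairs.1 hp)
    exact mem_unaffectedPairs.2 (unaffected_iff.2 ⟨q, E.avoids_iff.2 hq, h2, h1⟩)
  all_goals intros; simp

end UnaffectedPairs

end VirtualLinkDiagram

end VirtualKhovanovLee

/-! ### The algebra in the basis of idempotents, and transport of colours. -/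

namespace VirtualKhovanovLee

variable {ι : Type}

section Coefficients

variable (R : Type*) [CommRing R]

/-- The coefficients of the basis elements `1 = red + green` and `X = red - green`. -/
def Colour.dualCoeff : Colour → Label → R
  | .red, _ => 1
  | .green, .one => 1
  | .green, .X => -1

/-- The comultiplication sends the idempotent of the colour `k` to this multiple of its square. -/
def Colour.splitWeight : Colour → ℤ
  | .red => 2
  | .green => -2

theorem Label.sum_eq {M : Type*} [AddCommMonoid M] (f : Label → M) : ∑ a, f a = f .one + f .X := by
  rw [show (Finset.univ : Finset Label) = {.one, .X} by decide, Finset.sum_pair (by decide)]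

theorem Colour.sum_eq {M : Type*} [AddCommMonoid M] (f : Colour → M) :
    ∑ a, f a = f .red + f .green := by
  rw [show (Finset.univ : Finset Colour) = {.red, .green} by decide, Finset.sum_pair (by decide)]

variable [Invertible (2 : R)]

/-- The bar operation exchanges the two idempotents. -/
theorem Colour.coeff_mul_barSign (h k : Colour) (a : Label) :
    k.coeff R a * barSign R (h ≠ k) a = h.coeff R a := by
  cases h <;> cases k <;> cases a <;> simp [Colour.coeff, barSign]

theorem Colour.sum_coeff_mul_dualCoeff (h k : Colour) :
    ∑ a, h.coeff R a * k.dualCoeff R a = if h = k then 1 else 0 := by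
  rw [Label.sum_eq]
  cases h <;> cases k <;> simp [Colour.coeff, Colour.dualCoeff]

theorem Colour.sum_dualCoeff_mul_coeff (a b : Label) :
    ∑ k : Colour, k.coeff R a * k.dualCoeff R b = if a = b then 1 else 0 := by
  rw [Colour.sum_eq]
  cases a <;> cases b <;> simp [Colour.coeff, Colour.dualCoeff]

/-- Multiplication is diagonal on the idempotents. Written as a sum of pure tensors over the
colours, it lets a sum over labellings factor over the cycles. -/
theorem mulCoeff_eq_sum (a b c : Label) :
    mulCoeff R a b c = ∑ k : Colour, k.dualCoeff R a * k.dualCoeff R b * k.coeff R c := by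
  rw [Colour.sum_eq]
  cases a <;> cases b <;> cases c <;>
    simp [Colour.coeff, Colour.dualCoeff, mulCoeff, Label.mul]

theorem comulCoeff_eq_sum (a b c : Label) :
    comulCoeff R a b c =
      ∑ k : Colour, (k.splitWeight : R) * (k.dualCoeff R a * (k.coeff R b * k.coeff R c)) := by
  rw [Colour.sum_eq]
  have h2 : (2 : R) * ⅟2 = 1 := mul_invOf_self 2
  cases a <;> cases b <;> cases c <;>
    simp [Colour.coeff, Colour.dualCoeff, comulCoeff, Colour.splitWeight, ← mul_assoc]

theorem Colour.projCoeff_eq (k : Colour) (b a : Label) :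
    k.projCoeff R b a = k.coeff R b * k.dualCoeff R a := by
  rw [Colour.projCoeff, Label.sum_eq]
  cases k <;> cases a <;> cases b <;> simp [Colour.coeff, Colour.dualCoeff, mulCoeff, Label.mul]

end Coefficients

namespace VirtualLinkDiagram.GlobalData

variable {D : VirtualLinkDiagram ι}

section Finite

variable [Finite ι] (G : D.GlobalData)

/-- The marked point of a cycle. -/
def mark (s : State ι) : D.Cycle s → D.Point := Sum.map (G.star s) id

@[simp] theorem mark_inl (s : State ι) (z : D.CrossingCycle s) :
    G.mark s (.inl z) = .inl (G.star s z) := rfl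

@[simp] theorem mark_inr (s : State ι) (i : Fin D.circles) : G.mark s (.inr i) = .inr i := rfl

theorem cycleThrough_mark (s : State ι) (z : D.Cycle s) : D.cycleThrough s (G.mark s z) = z := by
  rcases z with z | i
  · simp [G.cycleOf_star]
  · rfl

variable {c : ι} {s s' : State ι} {ψ : D.Point → Colour}

theorem starBarred_iff (E : D.FreeEdge (ψ ∘ .inl) c s s') {p : D.Cycle s × D.Cycle s'}
    (hp : D.Unaffected c s s' p) :
    G.StarBarred s s' p ↔ ψ (G.mark s' p.2) ≠ ψ (G.mark s p.1) := by
  obtain ⟨q, hq, h1, h2⟩ := unaffected_iff.1 hp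
  have key : D.cycleThrough s (G.mark s' p.2) = p.1 := by
    rw [← h1, eq_comm, E.cycleThrough_eq_iff_of_avoids hq, cycleThrough_mark, h2]
  rcases p with ⟨z | i, z' | j⟩
  · simp only [StarBarred, mark_inl]
    simp only [mark_inl, cycleThrough_inl, Sum.inl.injEq] at key
    rw [E.compatible.barred_iff (by rw [key, G.cycleOf_star]), ne_comm]
    rfl
  · exact hp.elim
  · exact hp.elim
  · obtain rfl : i = j := hp
    simp [StarBarred]

section Weight

variable (c s s' ψ)

open Classical in
/-- The coefficient of the resmoothing of `c` on a state whose colouring has a single colour at `c`,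
apart from the sign of the unaffected cycles. -/
noncomputable def localWeight : ℤ :=
  if D.cycleOf s (D.site₁ c) ≠ D.cycleOf s (D.site₂ c) ∧
      D.cycleOf s' (D.site₁ c) = D.cycleOf s' (D.site₂ c) then
    G.sign₂ s (D.cycleOf s (D.site₁ c)) (D.cycleOf s (D.site₂ c)) *
      G.sign₁ s' (D.cycleOf s' (D.site₁ c))
  else if D.cycleOf s (D.site₁ c) = D.cycleOf s (D.site₂ c) ∧
      D.cycleOf s' (D.site₁ c) ≠ D.cycleOf s' (D.site₂ c) then
    G.sign₁ s (D.cycleOf s (D.site₁ c)) *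
      G.sign₂ s' (D.cycleOf s' (D.site₁ c)) (D.cycleOf s' (D.site₂ c)) *
      (ψ (.inl (D.site₁ c))).splitWeight
  else 0

end Weight

variable (R : Type*) [CommRing R]

open Classical in
/-- The part of `restCoeff` that involves a given cycle. -/
noncomputable def cycleCoeff (c : ι) (s s' : State ι) (l' : D.Cycle s' → Label) (z : D.Cycle s)
    (a : Label) : R :=
  ∏ z', if D.Unaffected c s s' (z, z') then
    (if a = l' z' then barSign R (G.StarBarred s s' (z, z')) a else 0) else 1

theorem restCoeff_eq_prod (c : ι) (s s' : State ι) (l : D.Cycle s → Label)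
    (l' : D.Cycle s' → Label) :
    G.restCoeff R c s s' l l' = ∏ z, G.cycleCoeff R c s s' l' z (l z) := by
  rw [restCoeff, Fintype.prod_prod_type]; rfl

theorem cycleCoeff_site {z : D.Cycle s}
    (hz : z = .inl (D.cycleOf s (D.site₁ c)) ∨ z = .inl (D.cycleOf s (D.site₂ c)))
    (l' : D.Cycle s' → Label) (a : Label) : G.cycleCoeff R c s s' l' z a = 1 := by
  refine Finset.prod_eq_one fun z' _ => if_neg fun h => ?_
  obtain ⟨q, hq, h1, -⟩ := unaffected_iff.1 h
  rw [Avoids, h1] at hq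
  exact hz.elim hq.1 hq.2

variable [Invertible (2 : R)]

/-- The bar operation between the two marked points is applied exactly when ψ differs there, so it
carries the idempotent of one colour to that of the other: transport is the identity on coloured
cycles. -/
theorem sum_cycleCoeff (E : D.FreeEdge (ψ ∘ .inl) c s s') (l' : D.Cycle s' → Label)
    {p : D.Cycle s × D.Cycle s'} (hp : D.Unaffected c s s' p) :
    ∑ a, G.cycleCoeff R c s s' l' p.1 a * (ψ (G.mark s p.1)).coeff R a =
      (ψ (G.mark s' p.2)).coeff R (l' p.2) := by
  have h : ∀ a, G.cycleCoeff R c s s' l' p.1 a =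
      if a = l' p.2 then barSign R (G.StarBarred s s' p) a else 0 := by
    intro a
    rw [cycleCoeff, Finset.prod_eq_single p.2, if_pos hp]
    · intro z' _ hz'
      refine if_neg fun h => hz' ?_
      exact congrArg Prod.snd (E.fst_injective h hp rfl)
    · simp
  simp only [h, ite_mul, zero_mul, Finset.sum_ite_eq', Finset.mem_univ, if_true]
  rw [show G.StarBarred s s' p = (ψ (G.mark s' p.2) ≠ ψ (G.mark s p.1)) from
    propext (G.starBarred_iff E hp), mul_comm, Colour.coeff_mul_barSign]

/-- Transport from a site to the marked point turns the colour at the site into the colour at the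
marked point; `coeff_mul_barSign_star` is the transport back. -/
theorem coeff_mul_siteSign (hχ : D.Compatible s (ψ ∘ .inl)) (l : D.Cycle s → Label)
    (h : HalfEdge ι) :
    (ψ (.inl h)).coeff R (l (.inl (D.cycleOf s h))) * G.siteSign R s l h =
      (ψ (G.mark s (.inl (D.cycleOf s h)))).coeff R (l (.inl (D.cycleOf s h))) := by
  have : D.Barred s h (G.star s (D.cycleOf s h)) ↔
      ψ (G.mark s (.inl (D.cycleOf s h))) ≠ ψ (.inl h) := by
    rw [hχ.barred_iff (G.cycleOf_star _ _).symm, ne_comm]; rfl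
  rw [siteSign, this, Colour.coeff_mul_barSign]

theorem coeff_mul_barSign_star (hχ : D.Compatible s (ψ ∘ .inl)) (h : HalfEdge ι) (a : Label) :
    (ψ (G.mark s (.inl (D.cycleOf s h)))).coeff R a *
      barSign R (D.Barred s h (G.star s (D.cycleOf s h))) a = (ψ (.inl h)).coeff R a := by
  have : D.Barred s h (G.star s (D.cycleOf s h)) ↔
      ψ (.inl h) ≠ ψ (G.mark s (.inl (D.cycleOf s h))) := by
    rw [hχ.barred_iff (G.cycleOf_star _ _).symm]; rfl
  rw [this, Colour.coeff_mul_barSign]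

end Finite

end VirtualLinkDiagram.GlobalData

end VirtualKhovanovLee

/-! ### The differential on coloured states. -/

namespace VirtualKhovanovLee

variable {ι : Type}

theorem sum_prod_eq_prod_sum {R Z A : Type*} [CommRing R] [Fintype Z] [DecidableEq Z] [Fintype A]
    (F : Z → A → R) : ∑ l : Z → A, ∏ z, F z (l z) = ∏ z, ∑ a, F z a := by
  rw [Finset.prod_univ_sum, Fintype.piFinset_univ]

namespace VirtualLinkDiagram.GlobalData

variable {D : VirtualLinkDiagram ι} [Finite ι] (G : D.GlobalData) {c : ι} {s s' : State ι}
  {ψ : D.Point → Colour} (R : Type*) [CommRing R] [Invertible (2 : R)]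

/-- Once the multiplication is expanded over a colour k, the sum over labellings is a product over
cycles. The two site cycles force k to be the colour at each site, hence the vanishing when these
differ, and the unaffected cycles transport their colours. -/
theorem sum_merge (hχ : D.Compatible s (ψ ∘ .inl)) (hs : ∀ d, d ≠ c → s' d = s d)
    (hsc : s c ≠ s' c) (hm : D.cycleOf s (D.site₁ c) ≠ D.cycleOf s (D.site₂ c))
    (hm' : D.cycleOf s' (D.site₁ c) = D.cycleOf s' (D.site₂ c)) (l' : D.Cycle s' → Label) :
    ∑ l : D.Cycle s → Label, G.restCoeff R c s s' l l' *
        (G.siteSign R s l (D.site₁ c) * G.siteSign R s l (D.site₂ c) *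
          mulCoeff R (l (.inl (D.cycleOf s (D.site₁ c)))) (l (.inl (D.cycleOf s (D.site₂ c))))
            (l' (.inl (D.cycleOf s' (D.site₁ c)))) *
          G.siteSign R s' l' (D.site₁ c)) * ∏ z, (ψ (G.mark s z)).coeff R (l z) =
      if ψ (.inl (D.site₁ c)) = ψ (.inl (D.site₂ c)) then
        ∏ z, (ψ (G.mark s' z)).coeff R (l' z) else 0 := by
  classical
  set x := D.site₁ c
  set y := D.site₂ c
  let B : HalfEdge ι → Label → R := fun h a => barSign R (D.Barred s h (G.star s (D.cycleOf s h))) a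
  -- The contribution of the cycle `z` with label `a` to the summand of the colour `k`; the
  -- conditional factors single out the cycles of the two sites.
  let F : Colour → D.Cycle s → Label → R := fun k z a =>
    G.cycleCoeff R c s s' l' z a * (ψ (G.mark s z)).coeff R a *
      ((if z = .inl (D.cycleOf s x) then B x a * k.dualCoeff R a else 1) *
        (if z = .inl (D.cycleOf s y) then B y a * k.dualCoeff R a else 1))
  have hF : ∀ l : D.Cycle s → Label, G.restCoeff R c s s' l l' *
        (G.siteSign R s l x * G.siteSign R s l y *
          mulCoeff R (l (.inl (D.cycleOf s x))) (l (.inl (D.cycleOf s y)))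
            (l' (.inl (D.cycleOf s' x))) *
          G.siteSign R s' l' x) * ∏ z, (ψ (G.mark s z)).coeff R (l z) =
      ∑ k : Colour, k.coeff R (l' (.inl (D.cycleOf s' x))) * G.siteSign R s' l' x *
        ∏ z, F k z (l z) := by
    intro l
    simp only [F, Finset.prod_mul_distrib, Finset.prod_ite_eq', Finset.mem_univ, if_true,
      restCoeff_eq_prod, mulCoeff_eq_sum, Finset.mul_sum, Finset.sum_mul]
    refine Finset.sum_congr rfl fun k _ => ?_
    simp only [B, siteSign]
    ring
  simp only [hF]
  rw [Finset.sum_comm]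
  simp only [← Finset.mul_sum, sum_prod_eq_prod_sum]
  have hX : ∀ k, ∑ a, F k (.inl (D.cycleOf s x)) a = if ψ (.inl x) = k then 1 else 0 := by
    intro k
    rw [← Colour.sum_coeff_mul_dualCoeff R]
    refine Finset.sum_congr rfl fun a _ => ?_
    simp only [F, if_true, Sum.inl.injEq, if_neg hm]
    rw [G.cycleCoeff_site R (.inl rfl), ← G.coeff_mul_barSign_star R hχ]
    ring
  have hY : ∀ k, ∑ a, F k (.inl (D.cycleOf s y)) a = if ψ (.inl y) = k then 1 else 0 := by
    intro k
    rw [← Colour.sum_coeff_mul_dualCoeff R]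
    refine Finset.sum_congr rfl fun a _ => ?_
    simp only [F, if_true, Sum.inl.injEq, if_neg hm.symm]
    rw [G.cycleCoeff_site R (.inr rfl), ← G.coeff_mul_barSign_star R hχ]
    ring
  split_ifs with hfree
  · have E : D.FreeEdge (ψ ∘ .inl) c s s' := ⟨hχ, hfree, hs, hsc⟩
    have hprod : ∀ k, ∏ z, ∑ a, F k z a = if ψ (.inl x) = k then
        ∏ p ∈ D.unaffectedPairs c s s', (ψ (G.mark s' p.2)).coeff R (l' p.2) else 0 := by
      intro k
      rw [E.prod_fst, Finset.prod_pair (by simpa using hm), hX, hY, ← hfree]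
      split_ifs with hk
      · rw [one_mul, one_mul]
        refine Finset.prod_congr rfl fun p hp => ?_
        have hp' := mem_unaffectedPairs.1 hp
        rw [← G.sum_cycleCoeff R E l' hp']
        refine Finset.sum_congr rfl fun a _ => ?_
        obtain ⟨q, hq, h1, -⟩ := unaffected_iff.1 hp'
        rw [Avoids, h1] at hq
        simp only [F]
        rw [if_neg (by exact hq.1), if_neg (by exact hq.2), mul_one, mul_one]
      · simp
    simp only [hprod, mul_ite, mul_zero, Finset.sum_ite_eq, Finset.mem_univ, if_true]
    rw [G.coeff_mul_siteSign R E.symm.compatible, E.prod_snd]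
    rw [← hm', Finset.pair_eq_singleton, Finset.prod_singleton]
  · refine Finset.sum_eq_zero fun k _ => ?_
    have : ∏ z, ∑ a, F k z a = 0 := by
      by_cases hk : ψ (.inl x) = k
      · refine Finset.prod_eq_zero (Finset.mem_univ (.inl (D.cycleOf s y))) ?_
        rw [hY, if_neg (fun h => hfree (hk.trans h.symm))]
      · refine Finset.prod_eq_zero (Finset.mem_univ (.inl (D.cycleOf s x))) ?_
        rw [hX, if_neg hk]
    rw [this, mul_zero]

/-- The factorisation used for a merge applies, with the factor 2 or -2 of the comultiplication.
There is no case of two colours, because a split forces a single colour at the crossing. -/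
theorem sum_split (hχ : D.Compatible s (ψ ∘ .inl)) (hs : ∀ d, d ≠ c → s' d = s d)
    (hsc : s c ≠ s' c) (hm : D.cycleOf s (D.site₁ c) = D.cycleOf s (D.site₂ c))
    (hm' : D.cycleOf s' (D.site₁ c) ≠ D.cycleOf s' (D.site₂ c)) (l' : D.Cycle s' → Label) :
    ∑ l : D.Cycle s → Label, G.restCoeff R c s s' l l' *
        (G.siteSign R s l (D.site₁ c) *
          comulCoeff R (l (.inl (D.cycleOf s (D.site₁ c))))
            (l' (.inl (D.cycleOf s' (D.site₁ c)))) (l' (.inl (D.cycleOf s' (D.site₂ c)))) *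
          (G.siteSign R s' l' (D.site₁ c) * G.siteSign R s' l' (D.site₂ c))) *
        ∏ z, (ψ (G.mark s z)).coeff R (l z) =
      ((ψ (.inl (D.site₁ c))).splitWeight : R) * ∏ z, (ψ (G.mark s' z)).coeff R (l' z) := by
  classical
  have E : D.FreeEdge (ψ ∘ .inl) c s s' := ⟨hχ, hχ.free_of_split hs hm hm', hs, hsc⟩
  have hfree : ψ (.inl (D.site₁ c)) = ψ (.inl (D.site₂ c)) := E.free
  set x := D.site₁ c
  set y := D.site₂ c
  let B : HalfEdge ι → Label → R := fun h a => barSign R (D.Barred s h (G.star s (D.cycleOf s h))) a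
  let F : Colour → D.Cycle s → Label → R := fun k z a =>
    G.cycleCoeff R c s s' l' z a * (ψ (G.mark s z)).coeff R a *
      (if z = .inl (D.cycleOf s x) then B x a * k.dualCoeff R a else 1)
  have hF : ∀ l : D.Cycle s → Label, G.restCoeff R c s s' l l' *
        (G.siteSign R s l x *
          comulCoeff R (l (.inl (D.cycleOf s x)))
            (l' (.inl (D.cycleOf s' x))) (l' (.inl (D.cycleOf s' y))) *
          (G.siteSign R s' l' x * G.siteSign R s' l' y)) *
        ∏ z, (ψ (G.mark s z)).coeff R (l z) =
      ∑ k : Colour, (k.splitWeight : R) *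
        ((k.coeff R (l' (.inl (D.cycleOf s' x))) * G.siteSign R s' l' x) *
        (k.coeff R (l' (.inl (D.cycleOf s' y))) * G.siteSign R s' l' y)) * ∏ z, F k z (l z) := by
    intro l
    simp only [F, Finset.prod_mul_distrib, Finset.prod_ite_eq', Finset.mem_univ, if_true,
      restCoeff_eq_prod, comulCoeff_eq_sum, Finset.mul_sum, Finset.sum_mul]
    refine Finset.sum_congr rfl fun k _ => ?_
    simp only [B, siteSign]
    ring
  simp only [hF]
  rw [Finset.sum_comm]
  simp only [← Finset.mul_sum, sum_prod_eq_prod_sum]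
  have hX : ∀ k, ∑ a, F k (.inl (D.cycleOf s x)) a = if ψ (.inl x) = k then 1 else 0 := by
    intro k
    rw [← Colour.sum_coeff_mul_dualCoeff R]
    refine Finset.sum_congr rfl fun a _ => ?_
    simp only [F, if_true]
    rw [G.cycleCoeff_site R (.inl rfl), ← G.coeff_mul_barSign_star R hχ]
    ring
  have hprod : ∀ k, ∏ z, ∑ a, F k z a = if ψ (.inl x) = k then
      ∏ p ∈ D.unaffectedPairs c s s', (ψ (G.mark s' p.2)).coeff R (l' p.2) else 0 := by
    intro k
    rw [E.prod_fst, ← hm, Finset.pair_eq_singleton, Finset.prod_singleton, hX]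
    split_ifs with hk
    · rw [one_mul]
      refine Finset.prod_congr rfl fun p hp => ?_
      have hp' := mem_unaffectedPairs.1 hp
      rw [← G.sum_cycleCoeff R E l' hp']
      refine Finset.sum_congr rfl fun a _ => ?_
      obtain ⟨q, hq, h1, -⟩ := unaffected_iff.1 hp'
      rw [Avoids, h1] at hq
      simp only [F]
      rw [if_neg (by exact hq.1), mul_one]
    · simp
  simp only [hprod, mul_ite, mul_zero, Finset.sum_ite_eq, Finset.mem_univ, if_true]
  rw [G.coeff_mul_siteSign R E.symm.compatible, hfree, G.coeff_mul_siteSign R E.symm.compatible,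
    E.prod_snd, Finset.prod_pair (by simpa using hm'), mul_assoc]

/-- The sum over the labellings of the source of a partial differential, applied to a coloured
state. -/
theorem sum_localCoeff (hχ : D.Compatible s (ψ ∘ .inl)) (hs : ∀ d, d ≠ c → s' d = s d)
    (hsc : s c ≠ s' c) (l' : D.Cycle s' → Label) :
    ∑ l : D.Cycle s → Label, (G.restSign c s s' : R) * G.restCoeff R c s s' l l' *
        G.localCoeff R c s s' l l' * ∏ z, (ψ (G.mark s z)).coeff R (l z) =
      if ψ (.inl (D.site₁ c)) = ψ (.inl (D.site₂ c)) then
        ((G.restSign c s s' * G.localWeight c s s' ψ : ℤ) : R) *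
          ∏ z, (ψ (G.mark s' z)).coeff R (l' z) else 0 := by
  classical
  by_cases h1 : D.cycleOf s (D.site₁ c) ≠ D.cycleOf s (D.site₂ c) ∧
      D.cycleOf s' (D.site₁ c) = D.cycleOf s' (D.site₂ c)
  · have := congrArg (fun t => (G.restSign c s s' : R) *
      ((G.sign₂ s (D.cycleOf s (D.site₁ c)) (D.cycleOf s (D.site₂ c)) *
      G.sign₁ s' (D.cycleOf s' (D.site₁ c)) : ℤ) : R) * t) (G.sum_merge R hχ hs hsc h1.1 h1.2 l')
    simp only [localCoeff, localWeight, if_pos h1]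
    simp only [Finset.mul_sum, mul_ite, mul_zero] at this
    push_cast at this ⊢
    rw [← this]
    refine Finset.sum_congr rfl fun l _ => ?_
    ring
  by_cases h2 : D.cycleOf s (D.site₁ c) = D.cycleOf s (D.site₂ c) ∧
      D.cycleOf s' (D.site₁ c) ≠ D.cycleOf s' (D.site₂ c)
  · have := congrArg (fun t => (G.restSign c s s' : R) *
      ((G.sign₁ s (D.cycleOf s (D.site₁ c)) *
      G.sign₂ s' (D.cycleOf s' (D.site₁ c)) (D.cycleOf s' (D.site₂ c)) : ℤ) : R) * t)
      (G.sum_split R hχ hs hsc h2.1 h2.2 l')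
    have hf : ψ (.inl (D.site₁ c)) = ψ (.inl (D.site₂ c)) := hχ.free_of_split hs h2.1 h2.2
    simp only [localCoeff, localWeight, if_neg h1, if_pos h2, if_pos hf]
    simp only [Finset.mul_sum] at this
    push_cast at this ⊢
    refine Eq.trans ?_ (this.trans (by ring))
    refine Finset.sum_congr rfl fun l _ => ?_
    ring
  · simp [localCoeff, localWeight, if_neg h1, if_neg h2]

end VirtualLinkDiagram.GlobalData

namespace VirtualLinkDiagram.GlobalData

variable [Fintype ι] [DecidableEq ι] {D : VirtualLinkDiagram ι} (G : D.GlobalData)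

/-- The coefficient of the resmoothing of `c` on a coloured state with a single colour at `c`. -/
noncomputable def edgeWeight (c : ι) (s : State ι) (ψ : D.Point → Colour) : ℤ :=
  G.restSign c s (Function.update s c true) * G.localWeight c s (Function.update s c true) ψ

variable (R : Type*) [CommRing R] [Invertible (2 : R)]

/-- The tensor product of the idempotents given by the colours of the cycles of the state `s`. -/
noncomputable def colourVector (s : State ι) (ψ : D.Point → Colour) : D.EnhancedState → R :=
  fun x => if x.1 = s then ∏ z, (ψ (G.mark x.1 z)).coeff R (x.2 z) else 0

/-- All marked points and bar operations are absorbed by the colouring, which the differential does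
not change. Only the state moves, along the crossings of a single colour. -/
theorem differential_mulVec_colourVector {s : State ι} {ψ : D.Point → Colour}
    (hχ : D.Compatible s (ψ ∘ .inl)) :
    (G.differential R).mulVec (G.colourVector R s ψ) =
      ∑ c, if s c = false ∧ ψ (.inl (D.site₁ c)) = ψ (.inl (D.site₂ c)) then
        (G.edgeWeight c s ψ : R) • G.colourVector R (Function.update s c true) ψ else 0 := by
  ext ⟨s', l'⟩
  rw [Matrix.mulVec, dotProduct, Fintype.sum_sigma, Finset.sum_eq_single s]
  · simp only [differential, colourVector, if_true, Finset.sum_mul, Finset.sum_apply]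
    rw [Finset.sum_comm]
    refine Finset.sum_congr rfl fun c _ => ?_
    by_cases h1 : s c = false
    · by_cases h2 : s' = Function.update s c true
      · subst h2
        simp only [h1, true_and, if_true]
        rw [G.sum_localCoeff R hχ (fun d hd => Function.update_of_ne hd _ _) (by simp [h1])]
        split_ifs
        · simp [colourVector, edgeWeight]
        · rfl
      · simp only [h1, h2, and_false, if_false, zero_mul, Finset.sum_const_zero, true_and]
        split_ifs
        · simp [colourVector, h2]
        · rfl
    · simp [h1]
  · intro t _ ht
    refine Finset.sum_eq_zero fun l _ => ?_
    rw [colourVector, if_neg ht, mul_zero]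
  · simp

end VirtualLinkDiagram.GlobalData

end VirtualKhovanovLee

/-! ### Signs of orders of cycles. -/

namespace VirtualKhovanovLee

section ListSign

variable {P : Type*} (o o' : P → ℕ)

/-- The sign that tells whether `a` comes before `b` in the order given by the positions `o`. -/
def orderSign (a b : P) : ℤ := if o a < o b then 1 else if o b < o a then -1 else 0

/-- The sign of the permutation that sorts a list by the positions `o`, or zero if some position
occurs twice. -/
def listSign : List P → ℤ
  | [] => 1
  | a :: l => (l.map (orderSign o a)).prod * listSign l

variable {o o'}

theorem orderSign_comm (a b : P) : orderSign o b a = -orderSign o a b := by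
  unfold orderSign
  split_ifs <;> omega

theorem orderSign_congr {a b : P} (h : o a = o b) : orderSign o a = orderSign o b := by
  funext c; simp only [orderSign, h]

theorem orderSign_mul_self {a b : P} (h : o a ≠ o b) : orderSign o a b * orderSign o a b = 1 := by
  unfold orderSign
  split_ifs <;> omega

theorem listSign_cons_congr {a b : P} (h : o a = o b) (l : List P) :
    listSign o (a :: l) = listSign o (b :: l) := by
  simp only [listSign, orderSign_congr h]

theorem listSign_swap (a b : P) (l : List P) :
    listSign o (a :: b :: l) = -listSign o (b :: a :: l) := by
  simp only [listSign, List.map_cons, List.prod_cons, orderSign_comm a b]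
  ring

theorem listSign_append_cons (a : P) (l₁ l₂ : List P) :
    listSign o (l₁ ++ a :: l₂) = (-1) ^ l₁.length * listSign o (a :: (l₁ ++ l₂)) := by
  induction l₁ with
  | nil => simp
  | cons b l₁ ih =>
    have h1 : listSign o (b :: (l₁ ++ a :: l₂)) =
        (-1) ^ l₁.length * listSign o (b :: a :: (l₁ ++ l₂)) := by
      rw [listSign, ih]
      simp only [listSign, List.map_append, List.map_cons, List.prod_append, List.prod_cons]
      ring
    simp only [List.cons_append, List.length_cons]
    rw [h1, listSign_swap]
    ring

theorem listSign_eq_zero {l : List P} (h : ¬ (l.map o).Nodup) : listSign o l = 0 := by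
  induction l with
  | nil => simp at h
  | cons a l ih =>
    rw [listSign]
    by_cases hl : (l.map o).Nodup
    · have : o a ∈ l.map o := by
        by_contra h'
        exact h (by rw [List.map_cons]; exact List.nodup_cons.2 ⟨h', hl⟩)
      obtain ⟨b, hb, hab⟩ := List.mem_map.1 this
      rw [List.prod_eq_zero, zero_mul]
      exact List.mem_map.2 ⟨b, hb, by simp [orderSign, hab]⟩
    · rw [ih hl, mul_zero]

theorem listSign_mul_self {l : List P} (h : (l.map o).Nodup) : listSign o l * listSign o l = 1 := by
  induction l with
  | nil => simp [listSign]
  | cons a l ih =>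
    rw [List.map_cons, List.nodup_cons] at h
    have h1 : (l.map (orderSign o a)).prod * (l.map (orderSign o a)).prod = 1 := by
      rw [← List.prod_map_mul]
      refine List.prod_eq_one fun x hx => ?_
      obtain ⟨b, hb, rfl⟩ := List.mem_map.1 hx
      exact orderSign_mul_self fun e => h.1 (List.mem_map.2 ⟨b, hb, e.symm⟩)
    rw [listSign]
    linear_combination h1 * (listSign o l * listSign o l) + ih h.2

/-- The parity of the number of inversions between two orders. -/
theorem prod_inversions_eq {l : List P} (h : (l.map o).Nodup) (h' : (l.map o').Nodup) :
    (l.map fun a => (l.map fun b => if o a < o b ∧ o' b < o' a then (-1 : ℤ) else 1).prod).prod =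
      listSign o l * listSign o' l := by
  induction l with
  | nil => simp [listSign]
  | cons a l ih =>
    rw [List.map_cons, List.nodup_cons] at h h'
    simp only [List.map_cons, List.prod_cons, lt_irrefl, false_and, if_false, one_mul, listSign,
      List.prod_map_mul]
    rw [ih h.2 h'.2, ← mul_assoc, ← List.prod_map_mul]
    have : (l.map fun b => (if o a < o b ∧ o' b < o' a then (-1 : ℤ) else 1) *
        if o b < o a ∧ o' a < o' b then (-1 : ℤ) else 1) =
        l.map fun b => orderSign o a b * orderSign o' a b := by
      refine List.map_congr_left fun b hb => ?_
      have h1 : o a ≠ o b := fun e => h.1 (List.mem_map.2 ⟨b, hb, e.symm⟩)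
      have h2 : o' a ≠ o' b := fun e => h'.1 (List.mem_map.2 ⟨b, hb, e.symm⟩)
      unfold orderSign
      split_ifs <;> omega
    rw [this, List.prod_map_mul]
    ring

end ListSign

variable {ι : Type}

namespace VirtualLinkDiagram.GlobalData

variable {D : VirtualLinkDiagram ι} [Finite ι] (G : D.GlobalData)

/-- The position of the cycle through a point in the order of the cycles of the state `s`. -/
noncomputable def position (s : State ι) (p : D.Point) : ℕ := G.order s (D.cycleThrough s p)

theorem position_eq_iff {s : State ι} {p q : D.Point} :
    G.position s p = G.position s q ↔ D.cycleThrough s p = D.cycleThrough s q := by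
  rw [position, position, Fin.val_inj, (G.order s).injective.eq_iff]

theorem nodup_position_iff {s : State ι} {l : List D.Point} :
    (l.map (G.position s)).Nodup ↔ (l.map (D.cycleThrough s)).Nodup := by
  have : l.map (G.position s) =
      (l.map (D.cycleThrough s)).map fun z => (G.order s z : ℕ) := by
    rw [List.map_map]; rfl
  rw [this, List.nodup_map_iff]
  exact fun z w h => (G.order s).injective (Fin.val_injective h)

theorem mem_of_nodup {s : State ι} {l : List D.Point} (h : (l.map (D.cycleThrough s)).Nodup)
    (hl : l.length = Fintype.card (D.Cycle s)) (z : D.Cycle s) : ∃ p ∈ l, D.cycleThrough s p = z := by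
  have h1 : (l.map (D.cycleThrough s)).toFinset = Finset.univ := by
    rw [← Finset.card_eq_iff_eq_univ, List.toFinset_card_of_nodup h, List.length_map, hl]
  have h2 : z ∈ (l.map (D.cycleThrough s)).toFinset := by rw [h1]; exact Finset.mem_univ z
  rwa [List.mem_toFinset, List.mem_map] at h2

/-- The list meets each cycle once, and a point contributes -1 exactly if its cycle precedes that of
`a`; the number of these cycles is the position of `a`. -/
theorem prod_orderSign {s : State ι} {a : D.Point} {r : List D.Point}
    (h : ((a :: r).map (D.cycleThrough s)).Nodup)
    (hl : (a :: r).length = Fintype.card (D.Cycle s)) :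
    (r.map (orderSign (G.position s) a)).prod = (-1) ^ G.position s a := by
  classical
  have hmem := mem_of_nodup h hl
  rw [List.map_cons, List.nodup_cons] at h
  have h1 : r.map (orderSign (G.position s) a) = (r.map (D.cycleThrough s)).map fun z =>
      if G.order s z < G.order s (D.cycleThrough s a) then (-1 : ℤ) else 1 := by
    rw [List.map_map]
    refine List.map_congr_left fun b hb => ?_
    have : G.position s a ≠ G.position s b := fun e =>
      h.1 (List.mem_map.2 ⟨b, hb, (G.position_eq_iff.1 e).symm⟩)
    simp only [orderSign, Function.comp, Fin.lt_def]
    unfold position at *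
    split_ifs <;> omega
  have h2 : (r.map (D.cycleThrough s)).toFinset = Finset.univ.erase (D.cycleThrough s a) := by
    ext z
    simp only [List.mem_toFinset, Finset.mem_erase, Finset.mem_univ, and_true]
    constructor
    · rintro hz rfl; exact h.1 hz
    · intro hz
      obtain ⟨p, hp, rfl⟩ := hmem z
      rcases List.mem_cons.1 hp with rfl | hp
      · exact absurd rfl hz
      · exact List.mem_map.2 ⟨p, hp, rfl⟩
  rw [h1, ← List.prod_toFinset _ h.2, h2, Finset.prod_erase _ (by simp), Finset.prod_ite,
    Finset.prod_const_one, mul_one, Finset.prod_const]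
  congr 1
  have : (Finset.univ.filter fun z => G.order s z < G.order s (D.cycleThrough s a)) =
      (Finset.Iio (G.order s (D.cycleThrough s a))).map (G.order s).symm.toEmbedding := by
    ext z; simp
  rw [this, Finset.card_map, Fin.card_Iio]
  rfl

theorem sign₁_eq {s : State ι} {h : HalfEdge ι} {r : List D.Point}
    (hn : ((.inl h :: r).map (D.cycleThrough s)).Nodup)
    (hl : (Sum.inl h :: r).length = Fintype.card (D.Cycle s)) :
    G.sign₁ s (D.cycleOf s h) = (r.map (orderSign (G.position s) (.inl h))).prod :=
  (G.prod_orderSign hn hl).symm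

/-- Each of the two positions also counts the comparison of the two points with each other. These
two comparisons have opposite signs, which explains the extra sign in one case of `sign₂`. -/
theorem sign₂_eq {s : State ι} {h k : HalfEdge ι} {r : List D.Point}
    (hn : ((.inl h :: .inl k :: r).map (D.cycleThrough s)).Nodup)
    (hl : (Sum.inl h :: Sum.inl k :: r).length = Fintype.card (D.Cycle s)) :
    G.sign₂ s (D.cycleOf s h) (D.cycleOf s k) =
      orderSign (G.position s) (.inl h) (.inl k) *
        ((r.map (orderSign (G.position s) (.inl h))).prod *
          (r.map (orderSign (G.position s) (.inl k))).prod) := by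
  have h1 := G.prod_orderSign hn hl
  have hperm : List.Perm (Sum.inl h :: Sum.inl k :: r) (.inl k :: .inl h :: r) := List.Perm.swap ..
  have h2 := G.prod_orderSign (((hperm.map _).nodup_iff).1 hn) (by rw [← hl]; rfl)
  have hne : G.position s (.inl h) ≠ G.position s (.inl k) := by
    intro e
    rw [List.map_cons, List.nodup_cons] at hn
    exact hn.1 (by rw [G.position_eq_iff.1 e]; simp)
  rw [List.map_cons, List.prod_cons] at h1 h2
  rw [orderSign_comm] at h2
  have hsq := orderSign_mul_self hne
  have key : orderSign (G.position s) (.inl h) (.inl k) *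
        ((r.map (orderSign (G.position s) (.inl h))).prod *
          (r.map (orderSign (G.position s) (.inl k))).prod) =
      -orderSign (G.position s) (.inl h) (.inl k) *
        ((-1) ^ (G.position s (.inl h) + G.position s (.inl k))) := by
    rw [pow_add, ← h1, ← h2]
    linear_combination (-orderSign (G.position s) (.inl h) (.inl k) *
        ((r.map (orderSign (G.position s) (.inl h))).prod *
          (r.map (orderSign (G.position s) (.inl k))).prod)) * hsq
  rw [key, sign₂]
  rcases lt_or_gt_of_ne hne with h | h
  · rw [if_pos (by exact h), orderSign, if_pos h]
    rw [pow_succ, mul_comm]; rfl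
  · rw [if_neg (by exact h.not_gt), orderSign, if_neg h.not_gt, if_pos h, neg_neg, one_mul]
    rfl

/-! ### Resmoothing as contraction of a volume form. -/

section Edge

variable {χ : HalfEdge ι → Colour} {c : ι} {s s' : State ι}

theorem restSign_symm (E : D.FreeEdge χ c s s') : G.restSign c s' s = G.restSign c s s' := by
  classical
  have key : ∀ {s s' : State ι} (_ : D.FreeEdge χ c s s') (p : D.Cycle s × D.Cycle s'),
      D.Unaffected c s s' p → D.Unaffected c s' s p.swap := by
    intro s s' E p hp
    obtain ⟨q, hq, h1, h2⟩ := unaffected_iff.1 hp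
    exact unaffected_iff.2 ⟨q, E.avoids_iff.2 hq, h2, h1⟩
  unfold restSign
  congr 1
  refine Finset.card_bij' (fun p _ => (p.2.swap, p.1.swap)) (fun p _ => (p.2.swap, p.1.swap))
    ?_ ?_ ?_ ?_
  · intro p hp
    simp only [Finset.mem_filter, Finset.mem_univ, true_and] at hp ⊢
    exact ⟨key E.symm _ hp.2.1, key E.symm _ hp.1, hp.2.2.2, hp.2.2.1⟩
  · intro p hp
    simp only [Finset.mem_filter, Finset.mem_univ, true_and] at hp ⊢
    exact ⟨key E _ hp.2.1, key E _ hp.1, hp.2.2.2, hp.2.2.1⟩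
  · intros; rfl
  · intros; rfl

/-- One list of points represents the unaffected cycles in both states. The parity of the inversions
between two orders is the product of the signs that sort this list by each of them. -/
theorem restSign_eq (E : D.FreeEdge χ c s s') {r : List D.Point}
    (hr : (r.map (D.cycleThrough s)).Nodup) (hr' : (r.map (D.cycleThrough s')).Nodup)
    (hav : ∀ p ∈ r, D.Avoids c s p)
    (hcov : ∀ q, D.Avoids c s q → ∃ p ∈ r, D.cycleThrough s p = D.cycleThrough s q) :
    G.restSign c s s' = listSign (G.position s) r * listSign (G.position s') r := by
  classical
  have hU : D.unaffectedPairs c s s' =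
      (r.map fun p => (D.cycleThrough s p, D.cycleThrough s' p)).toFinset := by
    ext p
    rw [mem_unaffectedPairs, unaffected_iff, List.mem_toFinset, List.mem_map]
    constructor
    · rintro ⟨q, hq, h1, h2⟩
      obtain ⟨a, ha, haq⟩ := hcov q hq
      refine ⟨a, ha, Prod.ext (haq.trans h1) ?_⟩
      rw [← h2]
      exact (E.cycleThrough_eq_iff_of_avoids (hav a ha)).1 haq
    · rintro ⟨a, ha, rfl⟩
      exact ⟨a, hav a ha, rfl, rfl⟩
  have hnd : (r.map fun p => (D.cycleThrough s p, D.cycleThrough s' p)).Nodup := by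
    refine List.Nodup.of_map Prod.fst ?_
    rw [List.map_map]; exact hr
  have h1 : G.restSign c s s' = ∏ p ∈ D.unaffectedPairs c s s', ∏ q ∈ D.unaffectedPairs c s s',
      if G.order s p.1 < G.order s q.1 ∧ G.order s' q.2 < G.order s' p.2 then (-1 : ℤ) else 1 := by
    rw [← Finset.prod_product', Finset.prod_ite, Finset.prod_const_one, mul_one, Finset.prod_const,
      restSign]
    congr 2
    ext p
    simp only [Finset.mem_filter, Finset.mem_univ, true_and, Finset.mem_product,
      mem_unaffectedPairs, and_assoc]
  rw [h1, hU, List.prod_toFinset _ hnd, List.map_map, ← prod_inversions_eq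
    (G.nodup_position_iff.2 hr) (G.nodup_position_iff.2 hr')]
  congr 1
  refine List.map_congr_left fun a _ => ?_
  simp only [Function.comp]
  rw [List.prod_toFinset _ hnd, List.map_map]
  rfl

/-- The sign of a merge. -/
noncomputable def mergeSign (c : ι) (s s' : State ι) : ℤ :=
  G.restSign c s s' * (G.sign₂ s (D.cycleOf s (D.site₁ c)) (D.cycleOf s (D.site₂ c)) *
      G.sign₁ s' (D.cycleOf s' (D.site₁ c)))

theorem mergeSign_mul_self (c : ι) (s s' : State ι) :
    G.mergeSign c s s' * G.mergeSign c s s' = 1 := by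
  have h : ∀ n : ℕ, (-1 : ℤ) ^ n * (-1) ^ n = 1 := fun n => by rw [← mul_pow]; simp
  have h2 : G.sign₂ s (D.cycleOf s (D.site₁ c)) (D.cycleOf s (D.site₂ c)) *
      G.sign₂ s (D.cycleOf s (D.site₁ c)) (D.cycleOf s (D.site₂ c)) = 1 := by
    rw [sign₂]; split_ifs <;> exact h _
  have h1 : G.restSign c s s' * G.restSign c s s' = 1 := h _
  have h3 : G.sign₁ s' (D.cycleOf s' (D.site₁ c)) * G.sign₁ s' (D.cycleOf s' (D.site₁ c)) = 1 :=
    h _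
  rw [mergeSign]
  calc _ = (G.restSign c s s' * G.restSign c s s') *
        ((G.sign₂ s (D.cycleOf s (D.site₁ c)) (D.cycleOf s (D.site₂ c)) *
      G.sign₂ s (D.cycleOf s (D.site₁ c)) (D.cycleOf s (D.site₂ c))) *
        (G.sign₁ s' (D.cycleOf s' (D.site₁ c)) * G.sign₁ s' (D.cycleOf s' (D.site₁ c)))) := by ring
    _ = 1 := by rw [h1, h2, h3]; rfl

open Classical in
/-- The volume form of the order of the cycles of the state `s`. -/
noncomputable def form (s : State ι) (l : List D.Point) : ℤ :=
  if l.length = Fintype.card (D.Cycle s) then listSign (G.position s) l else 0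

theorem form_swap (s : State ι) (a b : D.Point) (l : List D.Point) :
    G.form s (a :: b :: l) = -G.form s (b :: a :: l) := by
  simp only [form, List.length_cons]
  split_ifs
  · exact listSign_swap a b l
  · simp

theorem form_congr {s : State ι} {a b : D.Point} (h : D.cycleThrough s a = D.cycleThrough s b)
    (l : List D.Point) : G.form s (a :: l) = G.form s (b :: l) := by
  simp only [form, List.length_cons, listSign_cons_congr (G.position_eq_iff.2 h)]

theorem exists_form_ne_zero (s : State ι) : ∃ l, G.form s l ≠ 0 := by
  refine ⟨(Finset.univ : Finset (D.Cycle s)).toList.map (G.mark s), ?_⟩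
  have hn : ((((Finset.univ : Finset (D.Cycle s)).toList.map (G.mark s)).map
      (G.position s))).Nodup := by
    rw [nodup_position_iff, List.map_map]
    have : D.cycleThrough s ∘ G.mark s = id := funext (G.cycleThrough_mark s)
    rw [this, List.map_id]
    exact Finset.nodup_toList _
  rw [form, if_pos (by simp)]
  intro h0
  have := listSign_mul_self hn
  rw [h0] at this
  simp at this

theorem card_merge (E : D.FreeEdge χ c s s')
    (hm : D.cycleOf s (D.site₁ c) ≠ D.cycleOf s (D.site₂ c)) :
    Fintype.card (D.Cycle s) = Fintype.card (D.Cycle s') + 1 := by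
  have hm' : D.cycleOf s' (D.site₁ c) = D.cycleOf s' (D.site₂ c) := by
    by_contra h; exact hm (E.split_iff.1 h)
  -- The product of the constant 2 over the cycles turns the product decompositions into counts,
  -- read off from the exponents.
  have h1 := E.prod_fst fun _ => (2 : ℕ)
  have h2 := E.prod_snd fun _ => (2 : ℕ)
  rw [Finset.prod_pair (by simpa using hm)] at h1
  rw [← hm', Finset.pair_eq_singleton, Finset.prod_singleton] at h2
  rw [Finset.prod_const, Finset.card_univ] at h1 h2
  refine Nat.pow_right_injective le_rfl ?_
  change 2 ^ _ = 2 ^ _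
  rw [pow_succ, h1, h2]
  ring

/-- Merging two cycles contracts the form by the difference of the two sites. -/
theorem form_merge (E : D.FreeEdge χ c s s')
    (hm : D.cycleOf s (D.site₁ c) ≠ D.cycleOf s (D.site₂ c)) (l : List D.Point) :
    G.form s' l = G.mergeSign c s s' *
      (G.form s (.inl (D.site₁ c) :: l) - G.form s (.inl (D.site₂ c) :: l)) := by
  have hcard := card_merge E hm
  have hm' : D.cycleOf s' (D.site₁ c) = D.cycleOf s' (D.site₂ c) := by
    by_contra h; exact hm (E.split_iff.1 h)
  set x : D.Point := .inl (D.site₁ c)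
  set y : D.Point := .inl (D.site₂ c)
  have hxy : D.cycleThrough s x ≠ D.cycleThrough s y := by simpa [x, y] using hm
  have hxy' : D.cycleThrough s' x = D.cycleThrough s' y := by simpa [x, y] using hm'
  have hiff : ∀ {a b : D.Point}, D.cycleThrough s' a = D.cycleThrough s' b ↔ _ :=
    E.cycleThrough_eq_iff hm
  simp only [form, List.length_cons, hcard, add_left_inj]
  -- For a list of the wrong length both sides take the default value 0 of `form`, so the formula
  -- holds for all lists.
  by_cases hl : l.length = Fintype.card (D.Cycle s')
  swap
  · simp [hl]
  simp only [if_pos hl]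
  by_cases hn : (l.map (D.cycleThrough s')).Nodup
  swap
  -- Two points of `l` on one cycle of `s'` either share a cycle of `s` already or lie on the cycles
  -- of x and y, one of which is repeated by the prepended point. Both terms vanish.
  · have key : ∀ z, (z = x ∨ z = y) → listSign (G.position s) (z :: l) = 0 := by
      intro z hz
      refine listSign_eq_zero fun h => hn ?_
      rw [nodup_position_iff, List.map_cons, List.nodup_cons] at h
      have h2 := h.2
      rw [List.Nodup, List.pairwise_map] at h2 ⊢
      refine h2.imp_of_mem fun {a b} ha hb hab e => ?_
      have ha' : D.cycleThrough s z ≠ D.cycleThrough s a := fun e' =>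
        h.1 (List.mem_map.2 ⟨a, ha, e'.symm⟩)
      have hb' : D.cycleThrough s z ≠ D.cycleThrough s b := fun e' =>
        h.1 (List.mem_map.2 ⟨b, hb, e'.symm⟩)
      rcases hiff.1 e with e | e | e
      · exact hab e
      · rcases hz with rfl | rfl
        · exact ha' e.1.symm
        · exact hb' e.2
      · rcases hz with rfl | rfl
        · exact hb' e.2
        · exact ha' e.1.symm
    rw [key x (.inl rfl), key y (.inr rfl), listSign_eq_zero (by rwa [nodup_position_iff])]
    simp
  -- The list now represents each cycle of `s'` once: `a` is its point on the merged cycle, and `r`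
  -- represents the unaffected cycles in both states.
  obtain ⟨a, ha, hax⟩ := mem_of_nodup hn hl (D.cycleThrough s' x)
  obtain ⟨l₁, l₂, rfl⟩ := List.append_of_mem ha
  have hperm : List.Perm (l₁ ++ a :: l₂) (a :: (l₁ ++ l₂)) := List.perm_middle
  set r := l₁ ++ l₂ with hrdef
  have hn' : ((a :: r).map (D.cycleThrough s')).Nodup := ((hperm.map _).nodup_iff).1 hn
  have hl' : (a :: r).length = Fintype.card (D.Cycle s') := by rw [← hperm.length_eq, hl]
  have hxn' : ((x :: r).map (D.cycleThrough s')).Nodup := by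
    rw [List.map_cons, ← hax]; exact hn'
  have hr' : (r.map (D.cycleThrough s')).Nodup := by
    rw [List.map_cons, List.nodup_cons] at hn'; exact hn'.2
  have hav : ∀ p ∈ r, D.Avoids c s p := by
    intro p hp
    rw [← E.avoids_iff]
    have : D.cycleThrough s' p ≠ D.cycleThrough s' x := by
      intro e
      rw [List.map_cons, List.nodup_cons] at hxn'
      exact hxn'.1 (List.mem_map.2 ⟨p, hp, e⟩)
    exact ⟨this, fun e => this (e.trans hxy'.symm)⟩
  have hr : (r.map (D.cycleThrough s)).Nodup := by
    rw [List.Nodup, List.pairwise_map] at hr' ⊢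
    refine hr'.imp_of_mem fun {a b} ha _ hab e => hab ?_
    exact (E.cycleThrough_eq_iff_of_avoids (hav a ha)).1 e
  have hcov : ∀ q, D.Avoids c s q → ∃ p ∈ r, D.cycleThrough s p = D.cycleThrough s q := by
    intro q hq
    obtain ⟨p, hp, hpq⟩ := mem_of_nodup hxn' hl' (D.cycleThrough s' q)
    rcases List.mem_cons.1 hp with rfl | hp
    · exact absurd hpq.symm (E.avoids_iff.2 hq).1
    · exact ⟨p, hp, ((E.cycleThrough_eq_iff_of_avoids (hav p hp)).2 hpq)⟩
  have hxyr : ((x :: y :: r).map (D.cycleThrough s)).Nodup := by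
    simp only [List.map_cons, List.nodup_cons, List.mem_cons, List.mem_map, not_or]
    refine ⟨⟨hxy, ?_⟩, ?_, hr⟩
    · rintro ⟨p, hp, e⟩; exact (hav p hp).1 e
    · rintro ⟨p, hp, e⟩; exact (hav p hp).2 e
  have hxyl : (x :: y :: r).length = Fintype.card (D.Cycle s) := by
    rw [hcard, ← hl']; rfl
  -- The sign in the differential compares the volume of `x :: y :: r` before the merge with that of
  -- `x :: r` after it.
  have hσ : G.mergeSign c s s' =
      listSign (G.position s) (x :: y :: r) * listSign (G.position s') (x :: r) := by
    rw [mergeSign, G.restSign_eq E hr hr' hav hcov, G.sign₂_eq hxyr hxyl, G.sign₁_eq hxn' hl']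
    simp only [listSign, List.map_cons, List.prod_cons, x, y]
    ring
  have hL := listSign_mul_self (G.nodup_position_iff.2 hxyr)
  rw [hσ, listSign_append_cons, listSign_cons_congr (G.position_eq_iff.2 hax)]
  have hmove : ∀ z : D.Point, listSign (G.position s) (z :: (l₁ ++ a :: l₂)) =
      (-1) ^ (l₁.length + 1) * listSign (G.position s) (a :: z :: r) := by
    intro z
    have := listSign_append_cons (o := G.position s) a (z :: l₁) l₂
    simpa using this
  have hzero : ∀ z : D.Point, D.cycleThrough s a = D.cycleThrough s z →
      listSign (G.position s) (z :: (l₁ ++ a :: l₂)) = 0 := by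
    intro z hz
    refine listSign_eq_zero fun h => ?_
    rw [List.map_cons, List.nodup_cons] at h
    exact h.1 (List.mem_map.2 ⟨a, ha, G.position_eq_iff.2 hz⟩)
  have hcase : D.cycleThrough s a = D.cycleThrough s x ∨ D.cycleThrough s a = D.cycleThrough s y := by
    rcases hiff.1 hax with h | h | h
    exacts [.inl h, .inl h.1, .inr h.1]
  -- The term whose prepended point lies on the cycle of `a` repeats this cycle and vanishes. After
  -- moving `a` to the front, the other is the volume of `x :: y :: r` up to sign, whose square is
  -- 1.
  rcases hcase with h | h
  · rw [hzero x h, hmove y, listSign_cons_congr (G.position_eq_iff.2 h), pow_succ]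
    linear_combination (-(-1) ^ l₁.length * listSign (G.position s') (x :: r)) * hL
  · rw [hzero y h, hmove x, listSign_cons_congr (G.position_eq_iff.2 h), listSign_swap y x, pow_succ]
    linear_combination (-(-1) ^ l₁.length * listSign (G.position s') (x :: r)) * hL

end Edge

end VirtualLinkDiagram.GlobalData

end VirtualKhovanovLee

/-! ### Anticommuting faces. -/

namespace VirtualKhovanovLee

section Contraction

variable {P : Type*} {x y u v : P}

/-- Contracting an alternating form by x - y and by u - v in the two orders gives opposite results;
a nonzero value of the common form `H` allows the coefficients to be compared. -/
theorem contraction_anticomm {F A B H : List P → ℤ} {α β γ δ : ℤ}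
    (hF : ∀ a b l, F (a :: b :: l) = -F (b :: a :: l))
    (hA : ∀ l, A l = α * (F (x :: l) - F (y :: l)))
    (hH : ∀ l, H l = β * (A (u :: l) - A (v :: l)))
    (hB : ∀ l, B l = γ * (F (u :: l) - F (v :: l)))
    (hH' : ∀ l, H l = δ * (B (x :: l) - B (y :: l))) (hne : ∃ l, H l ≠ 0) :
    α * β + γ * δ = 0 := by
  obtain ⟨l, hl⟩ := hne
  have h1 := hH l
  have h2 := hH' l
  rw [hA, hA] at h1
  rw [hB, hB, hF u x, hF v x, hF u y, hF v y] at h2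
  set T := F (x :: u :: l) - F (y :: u :: l) - F (x :: v :: l) + F (y :: v :: l) with hT
  have h1' : H l = α * β * T := by rw [h1, hT]; ring
  have h2' : H l = -(γ * δ) * T := by rw [h2, hT]; ring
  have hT0 : T ≠ 0 := fun h => hl (by rw [h1', h, mul_zero])
  refine (mul_eq_zero.1 ?_).resolve_right hT0
  linear_combination h2' - h1'

/-- Both `A` and `B` are contractions of `F₁` and of `F₂`, with the directions x - y and u - v
exchanged. Where these directions are proportional, `A` is a multiple of `B` through `F₁` and `B`
one of `A` through `F₂`; the composite multiple of the nonzero form `A` is 1. -/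
theorem contraction_cycle {F₁ F₂ A B : List P → ℤ} {α β γ κ δ₁ δ₂ : ℤ}
    (hγ : γ * γ = 1) (hκ : κ * κ = 1)
    (hA : ∀ l, A l = α * (F₁ (x :: l) - F₁ (y :: l)))
    (hB : ∀ l, B l = γ * (F₁ (u :: l) - F₁ (v :: l)))
    (hB' : ∀ l, B l = β * (F₂ (x :: l) - F₂ (y :: l)))
    (hA' : ∀ l, A l = κ * (F₂ (u :: l) - F₂ (v :: l)))
    (h₁ : ∀ l, F₁ (x :: l) - F₁ (y :: l) = δ₁ * (F₁ (u :: l) - F₁ (v :: l)))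
    (h₂ : ∀ l, F₂ (x :: l) - F₂ (y :: l) = δ₂ * (F₂ (u :: l) - F₂ (v :: l)))
    (hne : ∃ l, A l ≠ 0) : α * γ * β * κ * (δ₁ * δ₂) = 1 := by
  obtain ⟨l, hl⟩ := hne
  have e1 : A l = α * δ₁ * γ * B l := by
    rw [hA, hB, h₁]
    linear_combination (-α * δ₁ * (F₁ (u :: l) - F₁ (v :: l))) * hγ
  have e2 : B l = β * δ₂ * κ * A l := by
    rw [hB', hA', h₂]
    linear_combination (-β * δ₂ * (F₂ (u :: l) - F₂ (v :: l))) * hκ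
  refine mul_right_cancel₀ hl ?_
  rw [e2] at e1
  linear_combination -e1

end Contraction

variable {ι : Type}

namespace VirtualLinkDiagram.GlobalData

variable {D : VirtualLinkDiagram ι} [Finite ι] (G : D.GlobalData) {ψ : D.Point → Colour}
  {c c' : ι} {s s' : State ι}

theorem restSign_mul_localWeight_merge (E : D.FreeEdge (ψ ∘ .inl) c s s')
    (hm : D.cycleOf s (D.site₁ c) ≠ D.cycleOf s (D.site₂ c)) :
    G.restSign c s s' * G.localWeight c s s' ψ = G.mergeSign c s s' := by
  have hm' : D.cycleOf s' (D.site₁ c) = D.cycleOf s' (D.site₂ c) := by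
    by_contra h; exact hm (E.split_iff.1 h)
  rw [localWeight, if_pos ⟨hm, hm'⟩, mergeSign]

/-- A split carries the sign of the reversed merge, because comparing the orders of the unaffected
cycles is symmetric. -/
theorem restSign_mul_localWeight_split (E : D.FreeEdge (ψ ∘ .inl) c s s')
    (hm : D.cycleOf s (D.site₁ c) = D.cycleOf s (D.site₂ c)) :
    G.restSign c s s' * G.localWeight c s s' ψ =
      G.mergeSign c s' s * (ψ (.inl (D.site₁ c))).splitWeight := by
  have hm' := E.split_iff.2 hm
  rw [localWeight, if_neg (fun h => h.1 hm), if_pos ⟨hm, hm'⟩, mergeSign, G.restSign_symm E]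
  ring

theorem pairing_of_merge {χ : HalfEdge ι → Colour} {t : State ι} {u v : HalfEdge ι}
    (E : D.FreeEdge χ c s t) (hm : D.cycleOf s (D.site₁ c) ≠ D.cycleOf s (D.site₂ c))
    (h : D.cycleOf s u ≠ D.cycleOf s v) (h' : D.cycleOf t u = D.cycleOf t v) :
    (D.cycleOf s (D.site₁ c) = D.cycleOf s u ∧ D.cycleOf s (D.site₂ c) = D.cycleOf s v) ∨
      (D.cycleOf s (D.site₁ c) = D.cycleOf s v ∧ D.cycleOf s (D.site₂ c) = D.cycleOf s u) := by
  rcases (cycleOf_eq_iff_of_merge E.compatible E.free E.agree E.ne hm).1 h' with h' | h' | h'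
  · exact absurd h' h
  · exact .inl ⟨h'.1.symm, h'.2⟩
  · exact .inr ⟨h'.2, h'.1.symm⟩

/-- In both states the two crossings join the same two cycles, so the differences of their sites
agree up to a sign, δ or δ', that records the pairing. If the crossings have equal colours,
resmoothing both changes the pairing, so δδ' = -1 and the weights agree; if the colours differ, the
pairing is kept and the weights are opposite. -/
theorem exists_pairing_signs (hcc : c ≠ c') (hχ : D.Compatible s (ψ ∘ .inl))
    (hc : ψ (.inl (D.site₁ c)) = ψ (.inl (D.site₂ c)))
    (hc' : ψ (.inl (D.site₁ c')) = ψ (.inl (D.site₂ c')))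
    (hs : ∀ d, d ≠ c → d ≠ c' → s' d = s d) (hsc : s c ≠ s' c) (hsc' : s c' ≠ s' c')
    (hxy : D.cycleOf s (D.site₁ c) ≠ D.cycleOf s (D.site₂ c))
    (hp : (D.cycleOf s (D.site₁ c) = D.cycleOf s (D.site₁ c') ∧
        D.cycleOf s (D.site₂ c) = D.cycleOf s (D.site₂ c')) ∨
      (D.cycleOf s (D.site₁ c) = D.cycleOf s (D.site₂ c') ∧
        D.cycleOf s (D.site₂ c) = D.cycleOf s (D.site₁ c')))
    (hp' : (D.cycleOf s' (D.site₁ c) = D.cycleOf s' (D.site₁ c') ∧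
        D.cycleOf s' (D.site₂ c) = D.cycleOf s' (D.site₂ c')) ∨
      (D.cycleOf s' (D.site₁ c) = D.cycleOf s' (D.site₂ c') ∧
        D.cycleOf s' (D.site₂ c) = D.cycleOf s' (D.site₁ c'))) :
    ∃ δ δ' : ℤ,
      (∀ l, G.form s (.inl (D.site₁ c) :: l) - G.form s (.inl (D.site₂ c) :: l) =
        δ * (G.form s (.inl (D.site₁ c') :: l) - G.form s (.inl (D.site₂ c') :: l))) ∧
      (∀ l, G.form s' (.inl (D.site₁ c) :: l) - G.form s' (.inl (D.site₂ c) :: l) =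
        δ' * (G.form s' (.inl (D.site₁ c') :: l) - G.form s' (.inl (D.site₂ c') :: l))) ∧
      (ψ (.inl (D.site₁ c'))).splitWeight = -(δ * δ' * (ψ (.inl (D.site₁ c))).splitWeight) := by
  classical
  have hcongr : ∀ {s : State ι} {a b : HalfEdge ι} {l : List D.Point},
      D.cycleOf s a = D.cycleOf s b → G.form s (.inl a :: l) = G.form s (.inl b :: l) :=
    fun h => G.form_congr (by simp [h]) _
  have hplus : ∀ s : State ι, (D.cycleOf s (D.site₁ c) = D.cycleOf s (D.site₁ c') ∧
      D.cycleOf s (D.site₂ c) = D.cycleOf s (D.site₂ c')) →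
      ∀ l, G.form s (.inl (D.site₁ c) :: l) - G.form s (.inl (D.site₂ c) :: l) =
        1 * (G.form s (.inl (D.site₁ c') :: l) - G.form s (.inl (D.site₂ c') :: l)) := by
    intro s h l
    rw [hcongr h.1, hcongr h.2, one_mul]
  have hminus : ∀ s : State ι, (D.cycleOf s (D.site₁ c) = D.cycleOf s (D.site₂ c') ∧
      D.cycleOf s (D.site₂ c) = D.cycleOf s (D.site₁ c')) →
      ∀ l, G.form s (.inl (D.site₁ c) :: l) - G.form s (.inl (D.site₂ c) :: l) =
        -1 * (G.form s (.inl (D.site₁ c') :: l) - G.form s (.inl (D.site₂ c') :: l)) := by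
    intro s h l
    rw [hcongr h.1, hcongr h.2]
    ring
  have hcol : ∀ a b : Colour, (if a = b then (-1 : ℤ) else 1) * a.splitWeight = -b.splitWeight := by
    intro a b; cases a <;> cases b <;> rfl
  have hcol' := hcol (ψ (.inl (D.site₁ c))) (ψ (.inl (D.site₁ c')))
  have hif : ((ψ ∘ .inl) (D.site₁ c) = (ψ ∘ .inl) (D.site₁ c')) ↔
      ψ (.inl (D.site₁ c)) = ψ (.inl (D.site₁ c')) := Iff.rfl
  rcases hp with hp | hp
  · have key := cycleOf_ne_of_resmooth_two (χ := ψ ∘ .inl) hcc (.inl ⟨rfl, rfl⟩) hχ hc hc' hs hsc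
      hsc' hp.1 hp.2 hxy
    simp only [hif] at key
    split_ifs at key hcol' with h
    · exact ⟨1, -1, hplus s hp, hminus s' (hp'.resolve_left fun h => key h.1),
        by linear_combination hcol'⟩
    · exact ⟨1, 1, hplus s hp, hplus s' (hp'.resolve_right fun h => key h.1),
        by linear_combination hcol'⟩
  · have key := cycleOf_ne_of_resmooth_two (χ := ψ ∘ .inl) hcc (.inr ⟨rfl, rfl⟩) hχ hc hc' hs hsc
      hsc' hp.1 hp.2 hxy
    simp only [hif] at key
    split_ifs at key hcol' with h
    · exact ⟨-1, 1, hminus s hp, hplus s' (hp'.resolve_right fun h => key h.1),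
        by linear_combination hcol'⟩
    · exact ⟨-1, -1, hminus s hp, hminus s' (hp'.resolve_left fun h => key h.1),
        by linear_combination hcol'⟩

/-- The effect on the forms of resmoothing a crossing of a single colour. -/
theorem FreeEdge.merge_or_split (E : D.FreeEdge (ψ ∘ .inl) c s s') :
    ∃ σ : ℤ, σ * σ = 1 ∧
      ((D.cycleOf s (D.site₁ c) ≠ D.cycleOf s (D.site₂ c) ∧
        D.cycleOf s' (D.site₁ c) = D.cycleOf s' (D.site₂ c) ∧
        Fintype.card (D.Cycle s) = Fintype.card (D.Cycle s') + 1 ∧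
        G.restSign c s s' * G.localWeight c s s' ψ = σ ∧
        ∀ l, G.form s' l =
          σ * (G.form s (.inl (D.site₁ c) :: l) - G.form s (.inl (D.site₂ c) :: l))) ∨
      (D.cycleOf s (D.site₁ c) = D.cycleOf s (D.site₂ c) ∧
        D.cycleOf s' (D.site₁ c) ≠ D.cycleOf s' (D.site₂ c) ∧
        Fintype.card (D.Cycle s') = Fintype.card (D.Cycle s) + 1 ∧
        G.restSign c s s' * G.localWeight c s s' ψ =
          σ * (ψ (.inl (D.site₁ c))).splitWeight ∧
        ∀ l, G.form s l =
          σ * (G.form s' (.inl (D.site₁ c) :: l) - G.form s' (.inl (D.site₂ c) :: l)))) := by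
  by_cases hm : D.cycleOf s (D.site₁ c) = D.cycleOf s (D.site₂ c)
  · have hm' := E.split_iff.2 hm
    exact ⟨_, G.mergeSign_mul_self c s' s, .inr ⟨hm, hm', card_merge E.symm hm',
      G.restSign_mul_localWeight_split E hm, G.form_merge E.symm hm'⟩⟩
  · have hm' : D.cycleOf s' (D.site₁ c) = D.cycleOf s' (D.site₂ c) := by
      by_contra h; exact hm (E.split_iff.1 h)
    exact ⟨_, G.mergeSign_mul_self c s s', .inl ⟨hm, hm', card_merge E hm,
      G.restSign_mul_localWeight_merge E hm, G.form_merge E hm⟩⟩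

/-- The two ways around a face of the cube of resolutions anticommute. -/
theorem face_anticomm {s₀₀ s₁₀ s₀₁ s₁₁ : State ι} (hcc : c ≠ c')
    (Ea : D.FreeEdge (ψ ∘ .inl) c s₀₀ s₁₀) (Eb : D.FreeEdge (ψ ∘ .inl) c s₀₁ s₁₁)
    (Ec : D.FreeEdge (ψ ∘ .inl) c' s₀₀ s₀₁) (Ed : D.FreeEdge (ψ ∘ .inl) c' s₁₀ s₁₁) :
    (G.restSign c s₀₀ s₁₀ * G.localWeight c s₀₀ s₁₀ ψ) *
        (G.restSign c' s₁₀ s₁₁ * G.localWeight c' s₁₀ s₁₁ ψ) +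
      (G.restSign c' s₀₀ s₀₁ * G.localWeight c' s₀₀ s₀₁ ψ) *
        (G.restSign c s₀₁ s₁₁ * G.localWeight c s₀₁ s₁₁ ψ) = 0 := by
  obtain ⟨w, hw₀⟩ : ∃ w, (ψ (.inl (D.site₁ c))).splitWeight = w := ⟨_, rfl⟩
  obtain ⟨w', hw₀'⟩ : ∃ w, (ψ (.inl (D.site₁ c'))).splitWeight = w := ⟨_, rfl⟩
  have hcc' := hcc.symm
  obtain ⟨a, a2, ⟨a1, a1', an, aw, af⟩ | ⟨a1, a1', an, aw, af⟩⟩ :=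
    FreeEdge.merge_or_split G Ea <;>
  obtain ⟨b, b2, ⟨b1, b1', bn, bw, bf⟩ | ⟨b1, b1', bn, bw, bf⟩⟩ :=
    FreeEdge.merge_or_split G Eb <;>
  obtain ⟨e, e2, ⟨e1, e1', en, ew, ef⟩ | ⟨e1, e1', en, ew, ef⟩⟩ :=
    FreeEdge.merge_or_split G Ec <;>
  obtain ⟨d, d2, ⟨d1, d1', dn, dw, df⟩ | ⟨d1, d1', dn, dw, df⟩⟩ :=
    FreeEdge.merge_or_split G Ed <;>
  -- The number of cycles must change equally along both routes, which leaves six of the sixteen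
  -- combinations of merges and splits.
  first
  | (exfalso; omega)
  | (rw [aw, bw, ew, dw]; try simp only [hw₀, hw₀'])
  -- One corner has the most cycles, here `s₀₀`; each edge, read away from it, contracts a form. The
  -- same holds in all other cases that use `contraction_anticomm`.
  · have := contraction_anticomm (G.form_swap s₀₀) af df ef bf (G.exists_form_ne_zero s₁₁)
    linear_combination this
  · have := contraction_anticomm (G.form_swap s₀₁) bf df ef af (G.exists_form_ne_zero s₁₀)
    linear_combination (d * e * w') * this - (b * e * w') * d2 - (a * d * w') * e2
  -- Both routes merge and then split, so `s₀₀` and `s₁₁` are the corners with the most cycles. In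
  -- the next case both routes split and then merge, and `s₁₀` and `s₀₁` play this role.
  · obtain ⟨δ, δ', p, p', hw⟩ := G.exists_pairing_signs hcc Ea.compatible Ea.free Ec.free
      (s' := s₁₁) (fun t h1 h2 => by rw [Eb.agree t h1, Ec.agree t h2])
      (by rw [← Ec.agree c hcc]; exact Eb.ne) (by rw [← Ea.agree c' hcc']; exact Ed.ne) a1
      (pairing_of_merge Ea a1 e1 d1) (pairing_of_merge Eb.symm b1' d1' e1')
    have := contraction_cycle e2 d2 af ef bf df p p' (G.exists_form_ne_zero s₁₀)
    rw [hw₀, hw₀'] at hw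
    rw [hw]
    linear_combination (-(b * e * w)) * this + (a * d * δ * δ' * w * e ^ 2) * b2 +
      (a * d * δ * δ' * w) * e2
  · obtain ⟨δ, δ', p, p', hw⟩ := G.exists_pairing_signs hcc Ea.symm.compatible Ea.free
      Ec.free (s' := s₀₁)
      (fun t h1 h2 => by rw [Ec.agree t h2, Ea.agree t h1])
      (by rw [Ec.agree c hcc]; exact Ea.ne.symm) (by rw [Ea.agree c' hcc']; exact Ec.ne) a1'
      (pairing_of_merge Ea.symm a1' d1 e1) (pairing_of_merge Eb b1 e1' d1')
    have := contraction_cycle d2 e2 af df bf ef p p' (G.exists_form_ne_zero s₀₀)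
    rw [hw₀, hw₀'] at hw
    rw [hw]
    linear_combination (-(a * d * w)) * this + (b * e * δ * δ' * w * a ^ 2) * d2 +
      (b * e * δ * δ' * w) * a2
  · have := contraction_anticomm (G.form_swap s₁₀) af ef df bf (G.exists_form_ne_zero s₀₁)
    linear_combination (a * b * w) * this - (b * e * w) * a2 - (a * d * w) * b2
  · have := contraction_anticomm (G.form_swap s₁₁) bf ef df af (G.exists_form_ne_zero s₀₀)
    linear_combination (w * w') * this

end VirtualLinkDiagram.GlobalData

end VirtualKhovanovLee

/-! ### The basis of coloured states and the vanishing of the square. -/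

namespace VirtualKhovanovLee

variable {ι : Type}

namespace VirtualLinkDiagram

/-- The colourings of the points that are compatible with the state `s`. -/
abbrev Colouring (D : VirtualLinkDiagram ι) (s : State ι) : Type :=
  {ψ : D.Point → Colour // D.Compatible s (ψ ∘ .inl)}

/-- The states with a compatible colouring. -/
abbrev ColouredState (D : VirtualLinkDiagram ι) : Type := (s : State ι) × D.Colouring s

noncomputable instance [Finite ι] (D : VirtualLinkDiagram ι) (s : State ι) :
    Fintype (D.Colouring s) :=
  Fintype.ofFinite _

namespace GlobalData

variable {D : VirtualLinkDiagram ι}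

theorem colouring_ext [Finite ι] (G : D.GlobalData) {s : State ι} {ψ ψ' : D.Point → Colour}
    (h : D.Compatible s (ψ ∘ .inl)) (h' : D.Compatible s (ψ' ∘ .inl))
    (e : ∀ z, ψ (G.mark s z) = ψ' (G.mark s z)) : ψ = ψ' := by
  funext p
  rcases p with p | i
  · exact h.apply_eq h' (G.cycleOf_star s (D.cycleOf s p)) (e (.inl (D.cycleOf s p)))
  · exact e (.inr i)

/-- A compatible colouring is given by the colours at the marked points. -/
noncomputable def colouringEquiv [Finite ι] (G : D.GlobalData) (s : State ι) :
    D.Colouring s ≃ (D.Cycle s → Colour) :=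
  Equiv.ofBijective (fun ψ z => ψ.1 (G.mark s z)) <| by
    constructor
    · intro ψ ψ' h
      exact Subtype.ext (G.colouring_ext ψ.2 ψ'.2 fun z => congrFun h z)
    · intro k
      obtain ⟨χ, hχ, hk⟩ := exists_compatible_of_star (G.star s) (G.cycleOf_star s)
        fun z => k (.inl z)
      refine ⟨⟨Sum.elim χ fun i => k (.inr i), hχ⟩, ?_⟩
      funext z
      rcases z with z | i
      · exact hk z
      · rfl

theorem freeEdge_update [DecidableEq ι] {s : State ι} {ψ : D.Point → Colour} {c : ι}
    (hχ : D.Compatible s (ψ ∘ .inl))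
    (hc : ψ (.inl (D.site₁ c)) = ψ (.inl (D.site₂ c))) {b : Bool} (hs : s c ≠ b) :
    D.FreeEdge (ψ ∘ .inl) c s (Function.update s c b) :=
  ⟨hχ, hc, fun _ hd => Function.update_of_ne hd _ _, by rwa [Function.update_self]⟩

variable [Fintype ι] (G : D.GlobalData) (R : Type*) [CommRing R]

/-- The coordinate of a vector that belongs to a coloured state. -/
noncomputable def colourCoord (s : State ι) (ψ : D.Point → Colour) : (D.EnhancedState → R) →ₗ[R] R :=
  ∑ l : D.Cycle s → Label,
    (∏ z, (ψ (G.mark s z)).dualCoeff R (l z)) • LinearMap.proj (⟨s, l⟩ : D.EnhancedState)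

theorem colourCoord_apply (s : State ι) (ψ : D.Point → Colour) (v : D.EnhancedState → R) :
    G.colourCoord R s ψ v =
      ∑ l : D.Cycle s → Label, (∏ z, (ψ (G.mark s z)).dualCoeff R (l z)) * v ⟨s, l⟩ := by
  simp [colourCoord]

variable [Invertible (2 : R)]

open Classical in
-- On each cycle the two families of coefficients are dual, and a compatible colouring is determined
-- by its values at the marked points.
theorem colourCoord_colourVector {s s' : State ι} {ψ ψ' : D.Point → Colour}
    (h : D.Compatible s (ψ ∘ .inl)) (h' : D.Compatible s' (ψ' ∘ .inl)) :
    G.colourCoord R s ψ (G.colourVector R s' ψ') = if s' = s ∧ ψ' = ψ then 1 else 0 := by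
  rw [colourCoord_apply]
  by_cases hs : s' = s
  · subst hs
    simp only [colourVector, if_true, true_and, ← Finset.prod_mul_distrib]
    rw [sum_prod_eq_prod_sum fun z a =>
      (ψ (G.mark s' z)).dualCoeff R a * (ψ' (G.mark s' z)).coeff R a]
    simp only [mul_comm (Colour.dualCoeff R _ _), Colour.sum_coeff_mul_dualCoeff]
    split_ifs with hψ
    · subst hψ; simp
    · have : ∃ z, ψ' (G.mark s' z) ≠ ψ (G.mark s' z) := by
        by_contra! hz
        exact hψ (G.colouring_ext h' h hz)
      obtain ⟨z, hz⟩ := this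
      exact Finset.prod_eq_zero (Finset.mem_univ z) (if_neg hz)
  · rw [if_neg fun h => hs h.1]
    refine Finset.sum_eq_zero fun l _ => ?_
    rw [colourVector, if_neg (fun h => hs h.symm), mul_zero]

variable [DecidableEq ι]

/-- Colours at the marked points can be prescribed freely, so the sum over colourings is a product
over cycles of the completeness relation of the two idempotents. -/
theorem sum_colourCoord_smul (v : D.EnhancedState → R) :
    ∑ t : D.ColouredState, G.colourCoord R t.1 t.2.1 v • G.colourVector R t.1 t.2.1 = v := by
  ext ⟨s, l₀⟩
  rw [Fintype.sum_sigma, Finset.sum_apply, Finset.sum_eq_single s]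
  · rw [Finset.sum_apply]
    simp only [Pi.smul_apply, smul_eq_mul, colourCoord_apply, colourVector, if_true]
    refine ((G.colouringEquiv s).sum_comp (fun k : D.Cycle s → Colour =>
      (∑ l : D.Cycle s → Label, (∏ z, (k z).dualCoeff R (l z)) * v ⟨s, l⟩) *
        ∏ z, (k z).coeff R (l₀ z))).trans ?_
    simp only [Finset.sum_mul]
    rw [Finset.sum_comm]
    have : ∀ l : D.Cycle s → Label, ∑ k : D.Cycle s → Colour,
        (∏ z, (k z).dualCoeff R (l z)) * v ⟨s, l⟩ * ∏ z, (k z).coeff R (l₀ z) =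
        if l₀ = l then v ⟨s, l⟩ else 0 := by
      intro l
      have h1 : ∀ k : D.Cycle s → Colour,
          (∏ z, (k z).dualCoeff R (l z)) * v ⟨s, l⟩ * ∏ z, (k z).coeff R (l₀ z) =
          (∏ z, (k z).coeff R (l₀ z) * (k z).dualCoeff R (l z)) * v ⟨s, l⟩ := by
        intro k; rw [Finset.prod_mul_distrib]; ring
      simp only [h1, ← Finset.sum_mul]
      rw [sum_prod_eq_prod_sum fun z (k : Colour) => k.coeff R (l₀ z) * k.dualCoeff R (l z)]
      simp only [Colour.sum_dualCoeff_mul_coeff]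
      split_ifs with h
      · subst h; simp
      · obtain ⟨z, hz⟩ := Function.ne_iff.1 h
        rw [Finset.prod_eq_zero (Finset.mem_univ z) (if_neg hz), zero_mul]
    simp only [this, Finset.sum_ite_eq, Finset.mem_univ, if_true]
  · intro s' _ hs'
    rw [Finset.sum_apply]
    refine Finset.sum_eq_zero fun ψ _ => ?_
    rw [Pi.smul_apply, colourVector, if_neg (fun h => hs' h.symm), smul_zero]
  · simp

theorem ext_colourVector {M : Type*} [AddCommMonoid M] [Module R M]
    {f g : (D.EnhancedState → R) →ₗ[R] M}
    (h : ∀ s ψ, D.Compatible s (ψ ∘ .inl) →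
      f (G.colourVector R s ψ) = g (G.colourVector R s ψ)) : f = g := by
  refine LinearMap.ext fun v => ?_
  rw [← G.sum_colourCoord_smul R v, map_sum, map_sum]
  refine Finset.sum_congr rfl fun t _ => ?_
  rw [map_smul, map_smul, h _ _ t.2.2]

section Square

variable {s : State ι} {ψ : D.Point → Colour} {c c' : ι}

theorem edgeWeight_anticomm (hχ : D.Compatible s (ψ ∘ .inl))
    (hc : ψ (.inl (D.site₁ c)) = ψ (.inl (D.site₂ c)))
    (hc' : ψ (.inl (D.site₁ c')) = ψ (.inl (D.site₂ c'))) (hcc : c ≠ c')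
    (hs : s c = false) (hs' : s c' = false) :
    G.edgeWeight c s ψ * G.edgeWeight c' (Function.update s c true) ψ +
      G.edgeWeight c' s ψ * G.edgeWeight c (Function.update s c' true) ψ = 0 := by
  have Ea := freeEdge_update (b := true) hχ hc (by simp [hs])
  have Ec := freeEdge_update (b := true) hχ hc' (by simp [hs'])
  have Eb := freeEdge_update (b := true) Ec.symm.compatible hc (by simp [hs, hcc])
  have Ed := freeEdge_update (b := true) Ea.symm.compatible hc' (by simp [hs', hcc.symm])
  rw [Function.update_comm hcc.symm] at Eb
  have := G.face_anticomm hcc Ea Eb Ec Ed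
  rw [edgeWeight, edgeWeight, edgeWeight, edgeWeight, Function.update_comm hcc.symm]
  exact this

/-- The weight is ±1 or ±2: a single colour excludes the resmoothings of one cycle into one cycle,
which would give 0. -/
theorem isUnit_edgeWeight (hχ : D.Compatible s (ψ ∘ .inl))
    (hc : ψ (.inl (D.site₁ c)) = ψ (.inl (D.site₂ c))) (hs : s c = false) :
    IsUnit (G.edgeWeight c s ψ : R) := by
  have E := freeEdge_update (b := true) hχ hc (by simp [hs])
  obtain ⟨σ, hσ, h⟩ := FreeEdge.merge_or_split G E
  have hu : IsUnit (σ : R) := IsUnit.of_mul_eq_one (σ : R) (by rw [← Int.cast_mul, hσ, Int.cast_one])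
  rw [edgeWeight]
  rcases h with ⟨-, -, -, h, -⟩ | ⟨-, -, -, h, -⟩
  · rw [h]; exact hu
  · rw [h, Int.cast_mul]
    refine hu.mul ?_
    have h2 : IsUnit (2 : R) := isUnit_of_invertible 2
    cases ψ (.inl (D.site₁ c)) <;> simp [Colour.splitWeight, h2]

end Square

/-- On a coloured state the square is a sum over ordered pairs of distinct crossings of a single
colour. Exchanging the two crossings pairs terms that cancel. -/
theorem differential_mul_self : G.differential R * G.differential R = 0 := by
  classical
  have key : (G.differential R).mulVecLin ∘ₗ (G.differential R).mulVecLin = 0 := by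
    refine G.ext_colourVector R fun s ψ hχ => ?_
    rw [LinearMap.comp_apply, Matrix.mulVecLin_apply _ (G.colourVector R s ψ),
      G.differential_mulVec_colourVector R hχ,
      map_sum, LinearMap.zero_apply]
    let f : ι × ι → (D.EnhancedState → R) := fun p =>
      if (s p.1 = false ∧ s p.2 = false ∧ p.1 ≠ p.2) ∧
        ψ (.inl (D.site₁ p.1)) = ψ (.inl (D.site₂ p.1)) ∧
        ψ (.inl (D.site₁ p.2)) = ψ (.inl (D.site₂ p.2)) then
      ((G.edgeWeight p.1 s ψ * G.edgeWeight p.2 (Function.update s p.1 true) ψ : ℤ) : R) •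
        G.colourVector R (Function.update (Function.update s p.1 true) p.2 true) ψ else 0
    have hf : ∀ c, (G.differential R).mulVecLin
        (if s c = false ∧ ψ (.inl (D.site₁ c)) = ψ (.inl (D.site₂ c)) then
        (G.edgeWeight c s ψ : R) • G.colourVector R (Function.update s c true) ψ else 0) =
        ∑ c', f (c, c') := by
      intro c
      by_cases h : s c = false ∧ ψ (.inl (D.site₁ c)) = ψ (.inl (D.site₂ c))
      · have E := freeEdge_update (b := true) hχ h.2 (by simp [h.1])
        rw [if_pos h, map_smul, Matrix.mulVecLin_apply,
          G.differential_mulVec_colourVector R E.symm.compatible, Finset.smul_sum]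
        refine Finset.sum_congr rfl fun c' _ => ?_
        simp only [f]
        rcases eq_or_ne c c' with rfl | hcc
        · simp
        · simp only [Function.update_of_ne hcc.symm, h.1, h.2, hcc, true_and, ne_eq,
            not_false_eq_true, and_true]
          split_ifs
          · rw [smul_smul, Int.cast_mul]
          · rw [smul_zero]
      · rw [if_neg h, map_zero, eq_comm]
        refine Finset.sum_eq_zero fun c' _ => if_neg fun h' => h ⟨h'.1.1, h'.2.1⟩
    simp only [hf]
    rw [← Fintype.sum_prod_type f]
    refine Finset.sum_involution (fun p _ => p.swap) ?_ ?_ (fun _ _ => Finset.mem_univ _)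
      (fun _ _ => Prod.swap_swap _)
    · rintro ⟨c, c'⟩ -
      simp only [f, Prod.swap]
      by_cases h : (s c = false ∧ s c' = false ∧ c ≠ c') ∧
          ψ (.inl (D.site₁ c)) = ψ (.inl (D.site₂ c)) ∧
          ψ (.inl (D.site₁ c')) = ψ (.inl (D.site₂ c'))
      · rw [if_pos h, if_pos ⟨⟨h.1.2.1, h.1.1, h.1.2.2.symm⟩, h.2.2, h.2.1⟩,
          Function.update_comm h.1.2.2, ← add_smul, ← Int.cast_add,
          G.edgeWeight_anticomm hχ h.2.1 h.2.2 h.1.2.2 h.1.1 h.1.2.1, Int.cast_zero, zero_smul]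
      · rw [if_neg h, if_neg fun h' => h ⟨⟨h'.1.2.1, h'.1.1, h'.1.2.2.symm⟩, h'.2.2, h'.2.1⟩,
          add_zero]
    · rintro ⟨c, c'⟩ - hne heq
      apply hne
      simp only [f]
      rw [if_neg]
      intro h
      exact h.1.2.2 (congrArg Prod.snd heq)
  have := congrArg (LinearMap.toMatrix') key
  rwa [← Matrix.mulVecLin_mul, ← Matrix.toLin'_apply', LinearMap.toMatrix'_toLin', map_zero] at this

/-! ### The contracting homotopy. -/

section Contraction

open Classical in
/-- The contraction on a coloured state: the inverse of the resmoothing of a chosen crossing at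
which the colouring has a single colour. -/
noncomputable def contractionVector (s : State ι) (ψ : D.Point → Colour) : D.EnhancedState → R :=
  if h : ∃ c, ψ (.inl (D.site₁ c)) = ψ (.inl (D.site₂ c)) then
    if s h.choose = true then
      -- The weight is known to be a unit only for compatible colourings, so the total inverse is
      -- used.
      Ring.inverse (G.edgeWeight h.choose (Function.update s h.choose false) ψ : R) •
        G.colourVector R (Function.update s h.choose false) ψ
    else 0
  else 0

/-- The contracting homotopy. -/
noncomputable def contraction : (D.EnhancedState → R) →ₗ[R] (D.EnhancedState → R) :=
  ∑ t : D.ColouredState, (G.colourCoord R t.1 t.2.1).smulRight (G.contractionVector R t.1 t.2.1)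

theorem contraction_colourVector {s : State ι} {ψ : D.Point → Colour}
    (hχ : D.Compatible s (ψ ∘ .inl)) :
    G.contraction R (G.colourVector R s ψ) = G.contractionVector R s ψ := by
  classical
  rw [contraction, LinearMap.sum_apply, Finset.sum_eq_single ⟨s, ψ, hχ⟩]
  · rw [LinearMap.smulRight_apply, G.colourCoord_colourVector R hχ hχ, if_pos ⟨rfl, rfl⟩, one_smul]
  · rintro ⟨s', ψ', h'⟩ - hne
    rw [LinearMap.smulRight_apply, G.colourCoord_colourVector R h' hχ, if_neg, zero_smul]
    rintro ⟨rfl, rfl⟩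
    exact hne rfl
  · simp

/-- The colouring has different colours at the two arcs of each crossing. -/
def _root_.VirtualKhovanovLee.VirtualLinkDiagram.Alternating (ψ : D.Point → Colour) : Prop :=
  ∀ c, ψ (.inl (D.site₁ c)) ≠ ψ (.inl (D.site₂ c))

open Classical in
-- The cube of a colouring with a crossing of a single colour is contracted along one such crossing;
-- a cube without any is a single vertex, where both maps vanish.
theorem differential_contraction_add {s : State ι} {ψ : D.Point → Colour}
    (hχ : D.Compatible s (ψ ∘ .inl)) :
    (G.differential R).mulVecLin (G.contraction R (G.colourVector R s ψ)) +
      G.contraction R ((G.differential R).mulVecLin (G.colourVector R s ψ)) =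
      if Alternating ψ then 0 else G.colourVector R s ψ := by
  rw [G.contraction_colourVector R hχ, Matrix.mulVecLin_apply _ (G.colourVector R s ψ),
    G.differential_mulVec_colourVector R hχ]
  by_cases h : ∃ c, ψ (.inl (D.site₁ c)) = ψ (.inl (D.site₂ c))
  swap
  · have hA : Alternating ψ := fun c hc => h ⟨c, hc⟩
    rw [if_pos hA, contractionVector, dif_neg h, map_zero, zero_add]
    rw [Finset.sum_eq_zero fun c _ => if_neg fun h' => hA c h'.2, map_zero]
  rw [if_neg fun hA => hA _ h.choose_spec]
  -- The chosen crossing depends on ψ alone, so it is the same at every vertex of the cube.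
  obtain ⟨c₀, hc₀, hchoose⟩ : ∃ c₀, ψ (.inl (D.site₁ c₀)) = ψ (.inl (D.site₂ c₀)) ∧
      h.choose = c₀ := ⟨_, h.choose_spec, rfl⟩
  have hvec : ∀ s : State ι, G.contractionVector R s ψ = if s c₀ = true then
      Ring.inverse (G.edgeWeight c₀ (Function.update s c₀ false) ψ : R) •
        G.colourVector R (Function.update s c₀ false) ψ else 0 := by
    intro s; rw [contractionVector, dif_pos h, hchoose]
  have hsum : G.contraction R (∑ c, if s c = false ∧ ψ (.inl (D.site₁ c)) = ψ (.inl (D.site₂ c)) then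
        (G.edgeWeight c s ψ : R) • G.colourVector R (Function.update s c true) ψ else 0) =
      ∑ c, if s c = false ∧ ψ (.inl (D.site₁ c)) = ψ (.inl (D.site₂ c)) then
        (G.edgeWeight c s ψ : R) • G.contractionVector R (Function.update s c true) ψ else 0 := by
    rw [map_sum]
    refine Finset.sum_congr rfl fun c _ => ?_
    split_ifs with hc
    · rw [map_smul, G.contraction_colourVector R
        (freeEdge_update (b := true) hχ hc.2 (by simp [hc.1])).symm.compatible]
    · rw [map_zero]
  rw [hsum, hvec s]
  by_cases hs : s c₀ = true
  -- The contraction leads back to `s₀`. Resmoothing `c₀` again restores the vector, and for every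
  -- other crossing the two routes from `s` cancel, by the anticommuting face at `s₀`.
  · set s₀ := Function.update s c₀ false with hs₀
    have E := freeEdge_update (b := false) hχ hc₀ (by simp [hs])
    have hχ₀ : D.Compatible s₀ (ψ ∘ .inl) := E.symm.compatible
    have hback : Function.update s₀ c₀ true = s := by
      rw [hs₀, Function.update_idem, ← hs, Function.update_eq_self]
    have hs₀c : s₀ c₀ = false := Function.update_self _ _ _
    have hu := G.isUnit_edgeWeight R hχ₀ hc₀ hs₀c
    rw [if_pos hs, map_smul, Matrix.mulVecLin_apply, G.differential_mulVec_colourVector R hχ₀,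
      Finset.smul_sum, ← Finset.sum_add_distrib, Finset.sum_eq_single c₀]
    · rw [if_pos ⟨hs₀c, hc₀⟩, if_neg (by simp [hs]), add_zero, smul_smul,
        Ring.inverse_mul_cancel _ hu, one_smul, hback]
    · intro c _ hcc
      have hsc : s₀ c = s c := Function.update_of_ne hcc _ _
      rw [hsc]
      split_ifs with hc
      · have hsc' : s₀ c = false := hsc.trans hc.1
        have hsw : Function.update (Function.update s c true) c₀ false =
            Function.update s₀ c true := by
          rw [hs₀, Function.update_comm hcc]
        rw [hvec, if_pos (by rw [Function.update_of_ne hcc.symm]; exact hs), hsw, smul_smul,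
          smul_smul, ← add_smul]
        have hχ₁ := (freeEdge_update (b := true) hχ₀ hc.2 (by simp [hsc'])).symm.compatible
        have hu' := G.isUnit_edgeWeight R hχ₁ hc₀ (by rw [Function.update_of_ne hcc.symm]; exact hs₀c)
        have hanti := G.edgeWeight_anticomm hχ₀ hc₀ hc.2 hcc.symm hs₀c hsc'
        rw [hback] at hanti
        have hanti' := congrArg (Int.cast : ℤ → R) hanti
        push_cast at hanti'
        rw [show Ring.inverse (G.edgeWeight c₀ s₀ ψ : R) * (G.edgeWeight c s₀ ψ : R) +
          (G.edgeWeight c s ψ : R) *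
            Ring.inverse (G.edgeWeight c₀ (Function.update s₀ c true) ψ : R) = 0 from ?_, zero_smul]
        have i1 := Ring.inverse_mul_cancel _ hu
        have i2 := Ring.inverse_mul_cancel _ hu'
        set A := (G.edgeWeight c₀ s₀ ψ : R)
        set B := (G.edgeWeight c₀ (Function.update s₀ c true) ψ : R)
        -- The face relation at `s₀`, divided by the weights of its two edges in the direction `c₀`.
        linear_combination (Ring.inverse A * Ring.inverse B) * hanti' -
          (Ring.inverse B * (G.edgeWeight c s ψ : R)) * i1 -
          (Ring.inverse A * (G.edgeWeight c s₀ ψ : R)) * i2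
      · rw [smul_zero, add_zero]
    · simp
  -- The contraction kills the vector itself. After the differential it only sees the term that
  -- resmooths `c₀`, since all others keep the A-smoothing there.
  · have hs' : s c₀ = false := by simpa using hs
    rw [if_neg hs, map_zero, zero_add, Finset.sum_eq_single c₀]
    · have hback : Function.update (Function.update s c₀ true) c₀ false = s := by
        rw [Function.update_idem, ← hs', Function.update_eq_self]
      rw [if_pos ⟨hs', hc₀⟩, hvec, if_pos (Function.update_self _ _ _), hback, smul_smul,
        Ring.mul_inverse_cancel _ (G.isUnit_edgeWeight R hχ hc₀ hs'), one_smul]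
    · intro c _ hcc
      split_ifs
      · rw [hvec, if_neg (by rw [Function.update_of_ne hcc.symm]; exact hs), smul_zero]
      · rfl
    · simp

end Contraction

end GlobalData

end VirtualLinkDiagram

end VirtualKhovanovLee

/-! ### Homological degrees. -/

namespace VirtualKhovanovLee

universe u

variable {ι : Type}

namespace VirtualLinkDiagram.GlobalData

section Degrees

variable [Fintype ι] {D : VirtualLinkDiagram ι} (R : Type*) [CommRing R]

/-- The restriction of vectors to the enhanced states of degree `i`. -/
def restrict (D : VirtualLinkDiagram ι) (i : ℤ) :
    (D.EnhancedState → R) →ₗ[R] ({x : D.EnhancedState // D.height x.1 = i} → R) :=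
  LinearMap.funLeft R R Subtype.val

/-- The extension by zero of vectors on the enhanced states of degree `i`. -/
noncomputable def extend (D : VirtualLinkDiagram ι) (i : ℤ) :
    ({x : D.EnhancedState // D.height x.1 = i} → R) →ₗ[R] (D.EnhancedState → R) :=
  Function.ExtendByZero.linearMap R Subtype.val

theorem restrict_extend (i : ℤ) (v : {x : D.EnhancedState // D.height x.1 = i} → R) :
    restrict R D i (extend R D i v) = v := by
  funext x
  exact Subtype.val_injective.extend_apply _ _ _

theorem extend_restrict_apply (i : ℤ) (v : D.EnhancedState → R) (x : D.EnhancedState) :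
    extend R D i (restrict R D i v) x = if D.height x.1 = i then v x else 0 := by
  split_ifs with h
  · exact Subtype.val_injective.extend_apply (restrict R D i v) 0 ⟨x, h⟩
  · exact Function.extend_apply' _ _ _ fun ⟨y, hy⟩ => h (hy ▸ y.2)

/-- A linear map that raises the degree by `k`. -/
def Homogeneous (k : ℤ) (f : (D.EnhancedState → R) →ₗ[R] (D.EnhancedState → R)) : Prop :=
  ∀ i j v, i + k = j →
    extend R D j (restrict R D j (f v)) = f (extend R D i (restrict R D i v))

/-- This reduces computations in the graded pieces to the total module, on which the differential
and the contraction are homogeneous maps. -/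
theorem toLin'_differential_submatrix [DecidableEq ι] (G : D.GlobalData) (i j : ℤ)
    (v : {x : D.EnhancedState // D.height x.1 = i} → R) :
    Matrix.toLin' ((G.differential R).submatrix
      (Subtype.val : {x : D.EnhancedState // D.height x.1 = j} → _)
      (Subtype.val : {x : D.EnhancedState // D.height x.1 = i} → _)) v =
      restrict R D j ((G.differential R).mulVecLin (extend R D i v)) := by
  funext y
  change ∑ x : {x : D.EnhancedState // D.height x.1 = i}, G.differential R y.1 x.1 * v x =
    ∑ x, G.differential R y.1 x * extend R D i v x
  rw [← Finset.sum_subset (Finset.subset_univ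
    (Finset.univ.filter fun x : D.EnhancedState => D.height x.1 = i)),
    Finset.sum_subtype (p := fun x : D.EnhancedState => D.height x.1 = i) _ (by simp)]
  · refine Finset.sum_congr rfl fun x _ => ?_
    exact congrArg _ (congrFun (restrict_extend R i v) x).symm
  · intro x _ hx
    have : extend R D i v x = 0 := Function.extend_apply' _ _ _ fun ⟨y, hy⟩ =>
      hx (by simp [← hy, y.2])
    rw [this, mul_zero]

variable {R}

theorem Homogeneous.extend_restrict {k i j : ℤ}
    {f : (D.EnhancedState → R) →ₗ[R] (D.EnhancedState → R)} (hf : Homogeneous R k f)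
    (hij : i + k = j) (v : {x : D.EnhancedState // D.height x.1 = i} → R) :
    extend R D j (restrict R D j (f (extend R D i v))) = f (extend R D i v) := by
  rw [hf i j _ hij, restrict_extend]

theorem Homogeneous.restrict_eq_zero {k i j : ℤ}
    {f : (D.EnhancedState → R) →ₗ[R] (D.EnhancedState → R)} (hf : Homogeneous R k f)
    (hij : i + k ≠ j) (v : {x : D.EnhancedState // D.height x.1 = i} → R) :
    restrict R D j (f (extend R D i v)) = 0 := by
  funext x
  rw [← hf.extend_restrict rfl v]
  refine (extend_restrict_apply R _ _ x.1).trans (if_neg ?_)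
  rw [x.2]
  exact hij.symm

end Degrees

section

variable [Fintype ι] {D : VirtualLinkDiagram ι} (G : D.GlobalData) (R : Type*) [CommRing R]
  [Invertible (2 : R)]

theorem extend_restrict_colourVector (s : State ι) (ψ : D.Point → Colour) (i : ℤ) :
    extend R D i (restrict R D i (G.colourVector R s ψ)) =
      if D.height s = i then G.colourVector R s ψ else 0 := by
  funext x
  rw [extend_restrict_apply, colourVector]
  by_cases hx : x.1 = s
  · subst hx; by_cases h : D.height x.1 = i <;> simp [colourVector, h]
  · split_ifs <;> simp [colourVector, hx]

theorem restrict_colourVector_of_ne {s : State ι} {i : ℤ} (h : D.height s ≠ i)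
    (ψ : D.Point → Colour) : restrict R D i (G.colourVector R s ψ) = 0 := by
  rw [← restrict_extend R i (restrict R D i _), extend_restrict_colourVector, if_neg h, map_zero]

variable [DecidableEq ι]

theorem homogeneous_of_colourVector {k : ℤ}
    {f : (D.EnhancedState → R) →ₗ[R] (D.EnhancedState → R)}
    (hf : ∀ s ψ, D.Compatible s (ψ ∘ .inl) →
      extend R D (D.height s + k) (restrict R D (D.height s + k) (f (G.colourVector R s ψ))) =
        f (G.colourVector R s ψ)) : Homogeneous R k f := by
  rintro i _ v rfl
  have : extend R D (i + k) ∘ₗ restrict R D (i + k) ∘ₗ f =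
      f ∘ₗ extend R D i ∘ₗ restrict R D i := by
    refine G.ext_colourVector R fun s ψ hχ => ?_
    simp only [LinearMap.comp_apply, extend_restrict_colourVector]
    split_ifs with h
    · subst h; exact hf s ψ hχ
    · rw [map_zero, ← hf s ψ hχ]
      funext x
      rw [extend_restrict_apply, extend_restrict_apply, Pi.zero_apply]
      split_ifs with h1 h2
      · omega
      · rfl
      · rfl
  exact LinearMap.congr_fun this v

theorem homogeneous_differential : Homogeneous R 1 (G.differential R).mulVecLin := by
  refine G.homogeneous_of_colourVector R fun s ψ hχ => ?_
  rw [Matrix.mulVecLin_apply, G.differential_mulVec_colourVector R hχ, map_sum, map_sum]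
  refine Finset.sum_congr rfl fun c _ => ?_
  split_ifs with h
  · rw [map_smul, map_smul, extend_restrict_colourVector, if_pos (D.height_update s c h.1)]
  · rw [map_zero, map_zero]

theorem homogeneous_contraction : Homogeneous R (-1) (G.contraction R) := by
  refine G.homogeneous_of_colourVector R fun s ψ hχ => ?_
  rw [G.contraction_colourVector R hχ, contractionVector]
  split_ifs with h hs
  · rw [map_smul, map_smul, extend_restrict_colourVector, if_pos]
    have := D.height_update (Function.update s h.choose false) h.choose
      (Function.update_self _ _ _)
    rw [Function.update_idem, ← hs, Function.update_eq_self] at this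
    rw [this]; ring
  · rw [map_zero, map_zero]
  · rw [map_zero, map_zero]

theorem ext_restrict {M : Type*} [AddCommMonoid M] [Module R M] {i : ℤ}
    {f g : ({x : D.EnhancedState // D.height x.1 = i} → R) →ₗ[R] M}
    (h : ∀ s ψ, D.Compatible s (ψ ∘ .inl) → D.height s = i →
      f (restrict R D i (G.colourVector R s ψ)) = g (restrict R D i (G.colourVector R s ψ))) :
    f = g := by
  have : f ∘ₗ restrict R D i = g ∘ₗ restrict R D i := by
    refine G.ext_colourVector R fun s ψ hχ => ?_
    by_cases hs : D.height s = i
    · exact h s ψ hχ hs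
    · simp only [LinearMap.comp_apply, G.restrict_colourVector_of_ne R hs, map_zero]
  refine LinearMap.ext fun v => ?_
  rw [← restrict_extend R i v]
  exact LinearMap.congr_fun this _

end

end VirtualLinkDiagram.GlobalData

end VirtualKhovanovLee

/-! ### The generators have rank one. -/

namespace VirtualKhovanovLee

universe u

variable {ι : Type}

/-- The image of an idempotent of rank one in the Karoubi envelope is isomorphic to the base
ring. -/
noncomputable def karoubiIsoOfRankOne {R : Type u} [CommRing R]
    (P : Idempotents.Karoubi (ModuleCat.{u} R)) (φ : P.X →ₗ[R] R) (v : P.X) (h : φ v = 1)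
    (hp : P.p = ModuleCat.ofHom (φ.smulRight v)) :
    P ≅ (Idempotents.toKaroubi (ModuleCat R)).obj (ModuleCat.of R R) where
  hom :=
    { f := ModuleCat.ofHom φ
      comm := by
        ext w
        simp [hp, h] }
  inv :=
    { f := ModuleCat.ofHom (LinearMap.toSpanSingleton R P.X v)
      comm := by
        ext
        simp [hp, h] }
  hom_inv_id := by
    ext w
    simp [hp]
  inv_hom_id := by
    ext
    simp [h]

section

variable (R : Type*) [CommRing R] {Z : Type} [Fintype Z] [DecidableEq Z]

/-- The functional on `V^{⊗ Z}` dual to the tensor product of the idempotents given by `k`. -/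
def colourFunctional (k : Z → Colour) : ((Z → Label) → R) →ₗ[R] R :=
  ∑ l : Z → Label, (∏ z, (k z).dualCoeff R (l z)) • LinearMap.proj l

theorem colourFunctional_apply (k : Z → Colour) (w : (Z → Label) → R) :
    colourFunctional R k w = ∑ l, (∏ z, (k z).dualCoeff R (l z)) * w l := by
  simp [colourFunctional]

variable [Invertible (2 : R)]

theorem colourFunctional_tensor (k : Z → Colour) :
    colourFunctional R k (fun l => ∏ z, (k z).coeff R (l z)) = 1 := by
  simp only [colourFunctional_apply, ← Finset.prod_mul_distrib]
  rw [sum_prod_eq_prod_sum fun z b => (k z).dualCoeff R b * (k z).coeff R b]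
  simp [mul_comm (Colour.dualCoeff R _ _), Colour.sum_coeff_mul_dualCoeff]

/-- Multiplication by an idempotent of a colour has rank one on V, so the tensor product of these
projections has rank one too. -/
theorem toLin'_colourProjection (k : Z → Colour) :
    Matrix.toLin' (colourProjection R k) =
      (colourFunctional R k).smulRight fun l => ∏ z, (k z).coeff R (l z) := by
  refine LinearMap.ext fun w => funext fun l => ?_
  rw [Matrix.toLin'_apply, LinearMap.smulRight_apply, Pi.smul_apply, colourFunctional_apply,
    smul_eq_mul, Finset.sum_mul]
  refine Finset.sum_congr rfl fun l' _ => ?_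
  simp only [colourProjection, Colour.projCoeff_eq, Finset.prod_mul_distrib]
  ring

end

namespace AlternatelyColouredSmoothing

variable {D : VirtualLinkDiagram ι}

/-- The colours of the points. -/
def pointColour (a : AlternatelyColouredSmoothing D) : D.Point → Colour :=
  Sum.elim a.colour a.circleColour

theorem compatible (a : AlternatelyColouredSmoothing D) :
    D.Compatible a.state (a.pointColour ∘ .inl) :=
  ⟨a.colour_smooth, a.colour_glue⟩

theorem alternating (a : AlternatelyColouredSmoothing D) :
    VirtualLinkDiagram.Alternating a.pointColour :=
  a.alternate

theorem ext_pointColour {a b : AlternatelyColouredSmoothing D} (hs : a.state = b.state)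
    (h : a.pointColour = b.pointColour) : a = b :=
  AlternatelyColouredSmoothing.ext hs (funext fun x => congrFun h (.inl x))
    (funext fun i => congrFun h (.inr i))

/-- The alternately coloured smoothing given by a compatible alternating colouring. -/
def ofColouring {s : State ι} {ψ : D.Point → Colour} (h : D.Compatible s (ψ ∘ .inl))
    (hψ : VirtualLinkDiagram.Alternating ψ) : AlternatelyColouredSmoothing D where
  state := s
  colour := ψ ∘ .inl
  circleColour := ψ ∘ .inr
  colour_smooth := h.smooth
  colour_glue := h.glue
  alternate := hψ

theorem pointColour_ofColouring {s : State ι} {ψ : D.Point → Colour}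
    (h : D.Compatible s (ψ ∘ .inl)) (hψ : VirtualLinkDiagram.Alternating ψ) :
    (ofColouring h hψ).pointColour = ψ :=
  Sum.elim_comp_inl_inr ψ

noncomputable instance [Finite ι] : Fintype (AlternatelyColouredSmoothing D) :=
  Fintype.ofFinite _

variable [Fintype ι] (R : Type u) [CommRing R] [Invertible (2 : R)] (G : D.GlobalData)

/-- The generator of an alternately coloured smoothing is isomorphic to the base ring. -/
noncomputable def generatorIso (a : AlternatelyColouredSmoothing D) :
    a.generator R G ≅ (Idempotents.toKaroubi (ModuleCat R)).obj (ModuleCat.of R R) :=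
  karoubiIsoOfRankOne (a.generator R G) (colourFunctional R (a.cycleColour G))
    (fun l => ∏ z, (a.cycleColour G z).coeff R (l z)) (colourFunctional_tensor R _)
    (congrArg ModuleCat.ofHom (toLin'_colourProjection R _))

end AlternatelyColouredSmoothing

end VirtualKhovanovLee

/-! ### Splitting off the alternately coloured smoothings. -/

namespace VirtualKhovanovLee

universe u

variable {ι : Type}

section Summands

open Limits

variable {K : Type*} [Category K]

variable {C : Type*} [Category C] (F : C ⥤ K)

theorem map_comp_conj {X Y Z : C} {S T : K} (s : S ⟶ F.obj X) (f : X ⟶ Y) (g : Y ⟶ Z)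
    (t : F.obj Z ⟶ T) : (s ≫ F.map f) ≫ F.map g ≫ t = s ≫ F.map (f ≫ g) ≫ t := by
  rw [Category.assoc, F.map_comp_assoc]

variable [Preadditive K] [Preadditive C] [F.Additive]

theorem map_comp_eq_zero_right {X Y Z : C} {T : K} (t : T ⟶ F.obj X) {f : X ⟶ Y} {g : Y ⟶ Z}
    (h : f ≫ g = 0) : (t ≫ F.map f) ≫ F.map g = 0 := by
  rw [Category.assoc, ← F.map_comp, h, F.map_zero, comp_zero]

theorem map_comp_eq_zero_left {X Y Z : C} {T : K} (t : F.obj Z ⟶ T) {f : X ⟶ Y} {g : Y ⟶ Z}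
    (h : f ≫ g = 0) : F.map f ≫ F.map g ≫ t = 0 := by
  rw [← Category.assoc, ← F.map_comp, h, F.map_zero, zero_comp]

/-- The complex with vanishing differentials on the given objects. -/
abbrev zeroDifferential (X : ℤ → K) : CochainComplex K ℤ where
  X := X
  d _ _ := 0

variable [HasFiniteBiproducts K]

/-- A complex whose identity is homotopic to the projection to a family of direct summands on which
the differentials vanish is homotopy equivalent to the sum of these. -/
noncomputable def homotopyEquivOfSummands {A : CochainComplex K ℤ} {J : ℤ → Type}
    [∀ i, Fintype (J i)] {Y : ∀ i, J i → K} (ε : ∀ i a, Y i a ⟶ A.X i)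
    (π : ∀ i a, A.X i ⟶ Y i a) (hε : ∀ i j a, ε i a ≫ A.d i j = 0)
    (hπ : ∀ i j, i + 1 = j → ∀ a, A.d i j ≫ π j a = 0) (h_one : ∀ i a, ε i a ≫ π i a = 𝟙 _)
    (h_zero : ∀ i a b, a ≠ b → ε i a ≫ π i b = 0) (P : A ⟶ A)
    (hP : ∀ i, P.f i = ∑ a, π i a ≫ ε i a) (H : Homotopy (𝟙 A) P) :
    HomotopyEquiv A (zeroDifferential fun i => ⨁ Y i) where
  hom :=
    { f := fun i => biproduct.lift (π i)
      comm' := fun i j hij => by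
        rw [comp_zero]
        exact (biproduct.hom_ext _ _ fun a => by simp [hπ i j hij a]).symm }
  inv :=
    { f := fun i => biproduct.desc (ε i)
      comm' := fun i j _ => by
        rw [zero_comp]
        exact biproduct.hom_ext' _ _ fun a => by simp [hε i j a] }
  homotopyHomInvId := (H.trans (Homotopy.ofEq (by
    ext i
    rw [hP, HomologicalComplex.comp_f, biproduct.lift_desc]))).symm
  homotopyInvHomId := Homotopy.ofEq (by
    classical
    ext i : 1
    refine biproduct.hom_ext' _ _ fun a => biproduct.hom_ext _ _ fun b => ?_
    rw [HomologicalComplex.comp_f, HomologicalComplex.id_f, Category.comp_id,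
      biproduct.ι_desc_assoc, Category.assoc, biproduct.lift_π]
    rcases eq_or_ne a b with rfl | hab
    · rw [h_one, biproduct.ι_π_self]
    · rw [h_zero i a b hab, biproduct.ι_π_ne _ hab])

end Summands

namespace VirtualLinkDiagram.GlobalData

variable [Fintype ι] {D : VirtualLinkDiagram ι} (G : D.GlobalData) (R : Type u) [CommRing R]

theorem complex_d_apply [DecidableEq ι] (hd : G.differential R * G.differential R = 0) (i j : ℤ)
    (v : {x : D.EnhancedState // D.height x.1 = i} → R) :
    ((G.complex R hd).d i j).hom v =
      restrict R D j ((G.differential R).mulVecLin (extend R D i v)) :=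
  toLin'_differential_submatrix R G i j v

variable [Invertible (2 : R)]

/-- The idempotent of an alternately coloured smoothing as an element of the Khovanov-Lee
complex. -/
noncomputable def smoothingVector (i : ℤ) (a : AlternatelyColouredSmoothing D) :
    {x : D.EnhancedState // D.height x.1 = i} → R :=
  restrict R D i (G.colourVector R a.state a.pointColour)

/-- The coordinate of an alternately coloured smoothing. -/
noncomputable def smoothingCoord (i : ℤ) (a : AlternatelyColouredSmoothing D) :
    ({x : D.EnhancedState // D.height x.1 = i} → R) →ₗ[R] R :=
  G.colourCoord R a.state a.pointColour ∘ₗ extend R D i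

theorem smoothingCoord_restrict {i : ℤ} (a : AlternatelyColouredSmoothing D) {s : State ι}
    (hs : D.height s = i) (ψ : D.Point → Colour) :
    G.smoothingCoord R i a (restrict R D i (G.colourVector R s ψ)) =
      G.colourCoord R a.state a.pointColour (G.colourVector R s ψ) := by
  rw [smoothingCoord, LinearMap.comp_apply, extend_restrict_colourVector, if_pos hs]

open Classical in
theorem smoothingCoord_smoothingVector {i : ℤ} (a b : AlternatelyColouredSmoothing D)
    (hb : D.height b.state = i) :
    G.smoothingCoord R i a (G.smoothingVector R i b) = if b = a then 1 else 0 := by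
  rw [smoothingVector, smoothingCoord_restrict G R a hb,
    G.colourCoord_colourVector R a.compatible b.compatible]
  refine if_congr ⟨fun h => AlternatelyColouredSmoothing.ext_pointColour h.1 h.2, ?_⟩ rfl rfl
  rintro rfl
  exact ⟨rfl, rfl⟩

variable [DecidableEq ι]

/-- No crossing has a single colour, so nothing can be resmoothed. -/
theorem differential_smoothing (a : AlternatelyColouredSmoothing D) :
    (G.differential R).mulVecLin (G.colourVector R a.state a.pointColour) = 0 := by
  rw [Matrix.mulVecLin_apply, G.differential_mulVec_colourVector R a.compatible]
  exact Finset.sum_eq_zero fun c _ => if_neg fun h => a.alternate c h.2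

/-- Every term in the differential of a coloured state keeps a colouring with a single colour at
some crossing, so it is never alternating. -/
theorem colourCoord_differential (a : AlternatelyColouredSmoothing D) :
    G.colourCoord R a.state a.pointColour ∘ₗ (G.differential R).mulVecLin = 0 := by
  classical
  refine G.ext_colourVector R fun s ψ hχ => ?_
  rw [LinearMap.comp_apply, Matrix.mulVecLin_apply, G.differential_mulVec_colourVector R hχ,
    map_sum, LinearMap.zero_apply]
  refine Finset.sum_eq_zero fun c _ => ?_
  split_ifs with h
  · rw [map_smul, G.colourCoord_colourVector R a.compatible
      (freeEdge_update (b := true) hχ h.2 (by simp [h.1])).symm.compatible, if_neg, smul_zero]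
    rintro ⟨-, rfl⟩
    exact a.alternate c h.2
  · rw [map_zero]

theorem restrict_differential_smoothingVector (i j : ℤ) (a : AlternatelyColouredSmoothing D)
    (ha : D.height a.state = i) :
    restrict R D j ((G.differential R).mulVecLin (extend R D i (G.smoothingVector R i a))) = 0 := by
  rw [smoothingVector, extend_restrict_colourVector, if_pos ha, differential_smoothing, map_zero]

theorem smoothingCoord_restrict_differential {i j : ℤ} (hij : i + 1 = j)
    (a : AlternatelyColouredSmoothing D)
    (v : {x : D.EnhancedState // D.height x.1 = i} → R) :
    G.smoothingCoord R j a (restrict R D j ((G.differential R).mulVecLin (extend R D i v))) = 0 := by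
  rw [smoothingCoord, LinearMap.comp_apply, (G.homogeneous_differential R).extend_restrict hij]
  exact LinearMap.congr_fun (G.colourCoord_differential R a) _

variable (hd : G.differential R * G.differential R = 0)

/-- The inclusion of the summand of an alternately coloured smoothing. -/
noncomputable def smoothingInclusion (i : ℤ) (a : AlternatelyColouredSmoothing D) :
    ModuleCat.of R R ⟶ (G.complex R hd).X i :=
  ModuleCat.ofHom (LinearMap.toSpanSingleton R _ (G.smoothingVector R i a))

/-- The projection to the summand of an alternately coloured smoothing. -/
noncomputable def smoothingProjection (i : ℤ) (a : AlternatelyColouredSmoothing D) :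
    (G.complex R hd).X i ⟶ ModuleCat.of R R :=
  ModuleCat.ofHom (G.smoothingCoord R i a)

theorem smoothingInclusion_d (i j : ℤ) (a : AlternatelyColouredSmoothing D)
    (ha : D.height a.state = i) : G.smoothingInclusion R hd i a ≫ (G.complex R hd).d i j = 0 := by
  refine ModuleCat.hom_ext (LinearMap.ext_ring ?_)
  refine (congrArg ((G.complex R hd).d i j).hom (LinearMap.toSpanSingleton_apply_one R _ _)).trans ?_
  exact (G.complex_d_apply R hd i j _).trans (G.restrict_differential_smoothingVector R i j a ha)

theorem d_smoothingProjection (i j : ℤ) (hij : i + 1 = j) (a : AlternatelyColouredSmoothing D) :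
    (G.complex R hd).d i j ≫ G.smoothingProjection R hd j a = 0 := by
  refine ModuleCat.hom_ext (LinearMap.ext fun v => ?_)
  exact (congrArg (G.smoothingCoord R j a) (G.complex_d_apply R hd i j v)).trans
    (G.smoothingCoord_restrict_differential R hij a v)

theorem smoothingInclusion_projection_self (i : ℤ) (a : AlternatelyColouredSmoothing D)
    (ha : D.height a.state = i) :
    G.smoothingInclusion R hd i a ≫ G.smoothingProjection R hd i a = 𝟙 _ := by
  refine ModuleCat.hom_ext (LinearMap.ext_ring ?_)
  refine (congrArg (G.smoothingCoord R i a) (LinearMap.toSpanSingleton_apply_one R _ _)).trans ?_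
  rw [G.smoothingCoord_smoothingVector R a a ha, if_pos rfl]
  rfl

theorem smoothingInclusion_projection_of_ne (i : ℤ) {a b : AlternatelyColouredSmoothing D}
    (ha : D.height a.state = i) (hab : a ≠ b) :
    G.smoothingInclusion R hd i a ≫ G.smoothingProjection R hd i b = 0 := by
  refine ModuleCat.hom_ext (LinearMap.ext_ring ?_)
  refine (congrArg (G.smoothingCoord R i b) (LinearMap.toSpanSingleton_apply_one R _ _)).trans ?_
  rw [G.smoothingCoord_smoothingVector R b a ha, if_neg hab]
  rfl

/-- The projection of the Khovanov-Lee complex to the span of the alternately coloured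
smoothings. -/
noncomputable def alternatingProjection : G.complex R hd ⟶ G.complex R hd where
  f i := ∑ a : {a : AlternatelyColouredSmoothing D // D.height a.state = i},
    G.smoothingProjection R hd i a.1 ≫ G.smoothingInclusion R hd i a.1
  comm' i j hij := by
    rw [Preadditive.sum_comp, Preadditive.comp_sum, Finset.sum_eq_zero, Finset.sum_eq_zero]
    · intro a _
      rw [← Category.assoc, G.d_smoothingProjection R hd i j hij, Limits.zero_comp]
    · intro a _
      rw [Category.assoc, G.smoothingInclusion_d R hd i j _ a.2, Limits.comp_zero]

theorem alternatingProjection_apply {i : ℤ} {s : State ι} {ψ : D.Point → Colour}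
    (hχ : D.Compatible s (ψ ∘ .inl)) (hs : D.height s = i) [Decidable (Alternating ψ)] :
    ((G.alternatingProjection R hd).f i).hom (restrict R D i (G.colourVector R s ψ)) =
      if Alternating ψ then restrict R D i (G.colourVector R s ψ) else 0 := by
  classical
  have : ((G.alternatingProjection R hd).f i).hom (restrict R D i (G.colourVector R s ψ)) =
      ∑ a : {a : AlternatelyColouredSmoothing D // D.height a.state = i},
        G.smoothingCoord R i a.1 (restrict R D i (G.colourVector R s ψ)) •
          G.smoothingVector R i a.1 :=
    (LinearMap.congr_fun (ModuleCat.hom_sum _ _) _).trans (LinearMap.sum_apply _ _ _)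
  rw [this]
  simp only [G.smoothingCoord_restrict R _ hs]
  split_ifs with h
  · let a := AlternatelyColouredSmoothing.ofColouring hχ h
    have ha : a.pointColour = ψ := AlternatelyColouredSmoothing.pointColour_ofColouring hχ h
    rw [Finset.sum_eq_single ⟨a, hs⟩]
    · rw [G.colourCoord_colourVector R a.compatible hχ, if_pos ⟨rfl, ha.symm⟩, one_smul,
        smoothingVector, ha]
      rfl
    · intro b _ hb
      rw [G.colourCoord_colourVector R b.1.compatible hχ, if_neg, zero_smul]
      rintro ⟨h1, h2⟩
      exact hb (Subtype.ext (AlternatelyColouredSmoothing.ext_pointColour h1.symm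
        (h2.symm.trans ha.symm)))
    · exact fun h => (h (Finset.mem_univ _)).elim
  · refine Finset.sum_eq_zero fun a _ => ?_
    have hne : ¬ (s = a.1.state ∧ ψ = a.1.pointColour) := fun h' => h (h'.2 ▸ a.1.alternating)
    rw [G.colourCoord_colourVector R a.1.compatible hχ, if_neg hne, zero_smul]
    rfl

/-- The contraction in a given degree. -/
noncomputable def contractionHom (i j : ℤ) : (G.complex R hd).X i ⟶ (G.complex R hd).X j :=
  ModuleCat.ofHom (restrict R D j ∘ₗ G.contraction R ∘ₗ extend R D i)

/-- The contraction shows that the identity is homotopic to the projection to the span of the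
alternately coloured smoothings. -/
noncomputable def homotopyIdAlternatingProjection :
    Homotopy (𝟙 (G.complex R hd)) (G.alternatingProjection R hd) where
  hom := G.contractionHom R hd
  zero i j hij := by
    refine ModuleCat.hom_ext (LinearMap.ext fun v => ?_)
    refine (G.homogeneous_contraction R).restrict_eq_zero (fun h => hij ?_) v
    change j + 1 = i
    omega
  comm i := by
    classical
    rw [dNext_eq _ (show (ComplexShape.up ℤ).Rel i (i + 1) from rfl),
      prevD_eq _ (show (ComplexShape.up ℤ).Rel (i - 1) i from sub_add_cancel i 1)]
    refine ModuleCat.hom_ext (G.ext_restrict R fun s ψ hχ hs => ?_)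
    set e := G.colourVector R s ψ
    have he : extend R D i (restrict R D i e) = e := by
      rw [extend_restrict_colourVector, if_pos hs]
    have h1 := G.alternatingProjection_apply R hd hχ hs
    have h2 : restrict R D i (G.contraction R (extend R D (i + 1)
        (((G.complex R hd).d i (i + 1)).hom (restrict R D i e)))) =
        restrict R D i (G.contraction R ((G.differential R).mulVecLin e)) := by
      rw [complex_d_apply, (G.homogeneous_differential R).extend_restrict rfl, he]
    have h3 : ((G.complex R hd).d (i - 1) i).hom (restrict R D (i - 1)
        (G.contraction R (extend R D i (restrict R D i e)))) =
        restrict R D i ((G.differential R).mulVecLin (G.contraction R e)) := by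
      rw [complex_d_apply, (G.homogeneous_contraction R).extend_restrict (by ring), he]
    -- Addition is fixed on the function type, so that the three equations combine up to
    -- definitional equality with the maps of modules.
    let plus (v w : {x : D.EnhancedState // D.height x.1 = i} → R) := v + w
    refine Eq.trans ?_ (congrArg₂ plus (congrArg₂ plus h2 h3) h1).symm
    change restrict R D i e = _ + _ + _
    rw [← map_add, add_comm (G.contraction R _), G.differential_contraction_add R hχ]
    split_ifs
    · rw [map_zero, zero_add]
    · rw [add_zero]

/-- The Khovanov-Lee complex is homotopy equivalent to the complex of the generators. -/
noncomputable def homotopyEquivGeneratorComplex :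
    HomotopyEquiv (((Idempotents.toKaroubi (ModuleCat R)).mapHomologicalComplex
      (ComplexShape.up ℤ)).obj (G.complex R hd)) (generatorComplex R G) :=
  let F := Idempotents.toKaroubi (ModuleCat.{u} R)
  homotopyEquivOfSummands
    (A := (F.mapHomologicalComplex (ComplexShape.up ℤ)).obj (G.complex R hd))
    (Y := fun i (a : {a : AlternatelyColouredSmoothing D // D.height a.state = i}) =>
      a.1.generator R G)
    -- The summands of the complex are copies of R spanned by the smoothing vectors; the
    -- isomorphisms of rank one replace them by the generators.
    (fun i a => (a.1.generatorIso R G).hom ≫ F.map (G.smoothingInclusion R hd i a.1))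
    (fun i a => F.map (G.smoothingProjection R hd i a.1) ≫ (a.1.generatorIso R G).inv)
    (fun i j a => map_comp_eq_zero_right F _ (G.smoothingInclusion_d R hd i j _ a.2))
    (fun i j hij a => map_comp_eq_zero_left F _ (G.d_smoothingProjection R hd i j hij a.1))
    (fun i a => (map_comp_conj F _ _ _ _).trans <| by
      rw [G.smoothingInclusion_projection_self R hd i _ a.2, F.map_id, Category.id_comp,
        Iso.hom_inv_id])
    (fun i a b hab => (map_comp_conj F _ _ _ _).trans <| by
      rw [G.smoothingInclusion_projection_of_ne R hd i a.2 fun h => hab (Subtype.ext h),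
        F.map_zero, Limits.zero_comp, Limits.comp_zero])
    ((F.mapHomologicalComplex _).map (G.alternatingProjection R hd))
    (fun i => by
      refine (F.map_sum _ _).trans (Finset.sum_congr rfl fun a _ => ?_)
      rw [F.map_comp]
      exact (((Category.assoc _ _ _).trans (congrArg _ (Iso.inv_hom_id_assoc _ _)))).symm)
    ((Homotopy.ofEq ((F.mapHomologicalComplex _).map_id _).symm).trans
      (F.mapHomotopy (G.homotopyIdAlternatingProjection R hd)))

end VirtualLinkDiagram.GlobalData

end VirtualKhovanovLee

theorem mainTheorem5 {ι : Type} [Fintype ι] [DecidableEq ι]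
    (D : VirtualKhovanovLee.VirtualLinkDiagram ι) (G : D.GlobalData)
    (R : Type*) [CommRing R] [Invertible (2 : R)] :
    ∃ hd : G.differential R * G.differential R = 0,
      Nonempty (HomotopyEquiv
        (((CategoryTheory.Idempotents.toKaroubi (ModuleCat R)).mapHomologicalComplex
          (ComplexShape.up ℤ)).obj (G.complex R hd))
        (VirtualKhovanovLee.generatorComplex R G)) ∧
      ∀ a : VirtualKhovanovLee.AlternatelyColouredSmoothing D,
        Nonempty (a.generator R G ≅
          (CategoryTheory.Idempotents.toKaroubi (ModuleCat R)).obj (ModuleCat.of R R)) :=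
  ⟨G.differential_mul_self R, ⟨G.homotopyEquivGeneratorComplex R _⟩,
    fun a => ⟨a.generatorIso R G⟩⟩
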